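/- **Setting.** Let $A_1,\dots,A_p\in\mathbb Z[\sqrt{-1}]^{n\times n}$ ($p\ge 1$) be a basis of a matrix space $\mathcal A\subseteq\mathbb C^{n\times n}$, with all entries of absolute value at most $M$. For a subspace $U\subseteq\mathbb C^n$ put $\mathcal A(U)=\langle Bu: B\in\mathcal A,\ u\in U\rangle$; let $\operatorname{ncrank}\mathcal A=\min_U\,(n-\dim U+\dim\mathcal A(U))$ and $c=n-\operatorname{ncrank}\mathcal A$. A subspace $U$ is *$c$-shrunk* if $\dim U-\dim\mathcal A(U)\ge c$; the *minimum* $c$-shrunk subspace is the one contained in all others. Let $d\ge1$ be the minimum blow-up size of $\mathcal A$, i.e. the least $d$ at which $\sup_{d\ge 1}\max\{\frac1d\operatorname{rk}(\sum_i A_i\otimes X_i): X_i\in\mathbb C^{d\times d}\}$ is attained, let $\mathcal A^{\{d\}}=\langle A_i\otimes E_{jl}: i\in[p],\ j,l\in[d]\rangle$ be the $d$-th blow-up space, and let $k$ be an integer with $\operatorname{ncrank}\mathcal A\le k$. The Wong sequence of $(A,\mathcal A^{\{d\}})$ is $W_0=0$, $W_{i}=\mathcal A^{\{d\}}(A^{-1}(W_{i-1}))$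 (preimage under $A$), with limit $W_\infty=\bigcup_i W_i$. **Algorithm.** Given $A_1,\dots,A_p$, $d$ and $k$: 1. Draw $d\times d$ matrices $X_1,\dots,X_p$ with independent entries, uniform in $\{0,1,\dots,2dk-1\}$, and compute $A=\sum_i A_i\otimes X_i$. 2. By fraction-free Gaussian elimination compute a basis of $\ker A$ and a pseudoinverse $A^+$ scaled to Gaussian integers (i.e. $AA^+w=\delta w$ for $w\in\operatorname{Im}A$, with a fixed $\delta\neq0$). 3. Compute the Wong sequence of $(A,\mathcal A^{\{d\}})$: start with the basis of $\ker A$; in each of $n$ rounds, for the vectors $u=\sum_b u_b\otimes e_b$ added last, compute all $A_ju_b\in\mathbb C^n$, append those that are linearly independent of the vectors selected so far (tested by fraction-free elimination), and add the vectors $A^+(w\otimes e_a)$, $a\in[d]$, for each newly selected $w$. The vectors $w\otimes e_a$ are to be a basis of $W_\infty$, and the vectors $u$ a basis of $U^*=A^{-1}(W_\infty)$. 4. Output a maximal linearly independent set of the blocks $u_b$ of the vectors $u$, as a basis of the subspace $U_0$. **Theorem.** With probability at least $1/2$, the algorithm has computed bases of $W_\infty$ and of $U^*=A^{-1}(W_\infty)$,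 its output is a basis of $U_0=\{u\in\mathbb C^n: u\otimes e_a\in U^*\text{ for all }a\in[d]\}$, one has $U^*=U_0\otimes\mathbb C^d$, and $U_0$ is the minimum $c$-shrunk subspace of $\mathcal A$. Moreover, for every outcome of the draw, the algorithm makes $O(p\,d^4n^4)$ arithmetic operations over $\mathbb Q$ (tests for zero included); all numbers that it computes are Gaussian integers; the entries of the output and of all intermediate vectors, and all numbers computed outside the tableaux of the linear independence tests, have absolute value at most $e^{O(L)}$, where $$L=n^2d^2\log(Mndk)+nd\log M ;$$ and the numbers in the tableaux of those tests, which are eliminations in $\mathbb C^n$ on such vectors, have absolute value at most $e^{O(nL)}$. The constants in the $O(\cdot)$ are absolute. -/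

import Mathlib

open scoped Kronecker

namespace ShrunkSubspace

/-! ### Matrix spaces, noncommutative rank, blow-ups and Wong sequences -/

section MatrixSpaces

variable {ι : Type} [Fintype ι] [DecidableEq ι]

/-- `𝒜(U)`, the linear span of all `B u` with `B ∈ 𝒜` and `u ∈ U`. -/
def image (𝒜 : Submodule ℂ (Matrix ι ι ℂ)) (U : Submodule ℂ (ι → ℂ)) : Submodule ℂ (ι → ℂ) :=
  Submodule.span ℂ {v | ∃ B ∈ 𝒜, ∃ u ∈ U, v = B.mulVec u}

/-- The noncommutative rank: the minimum of `n - dim U + dim 𝒜(U)` over all subspaces `U` of `ℂⁿ`.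
(`dim U ≤ n`, so the subtraction of natural numbers is exact.) -/
noncomputable def ncrank (𝒜 : Submodule ℂ (Matrix ι ι ℂ)) : ℕ :=
  sInf {r | ∃ U : Submodule ℂ (ι → ℂ),
    r = Fintype.card ι - Module.finrank ℂ U + Module.finrank ℂ (image 𝒜 U)}

/-- `U` is a `c`-shrunk subspace of `𝒜`: `dim U - dim 𝒜(U) ≥ c`. -/
def IsShrunk (𝒜 : Submodule ℂ (Matrix ι ι ℂ)) (c : ℕ) (U : Submodule ℂ (ι → ℂ)) : Prop :=
  Module.finrank ℂ (image 𝒜 U) + c ≤ Module.finrank ℂ U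

/-- The (second) Wong sequence of `(B, 𝒜)`: `W₀ = 0` and `Wᵢ₊₁ = 𝒜(B⁻¹(Wᵢ))`. -/
def wongSeq (B : Matrix ι ι ℂ) (𝒜 : Submodule ℂ (Matrix ι ι ℂ)) : ℕ → Submodule ℂ (ι → ℂ)
  | 0 => ⊥
  | i + 1 => image 𝒜 ((wongSeq B 𝒜 i).comap B.mulVecLin)

/-- The limit `W_∞` of the (increasing) Wong sequence. -/
def wongLimit (B : Matrix ι ι ℂ) (𝒜 : Submodule ℂ (Matrix ι ι ℂ)) : Submodule ℂ (ι → ℂ) :=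
  ⨆ i, wongSeq B 𝒜 i

end MatrixSpaces

/-- The matrix space spanned by `A₁, …, A_p`. -/
def matrixSpace {p n : ℕ} (A : Fin p → Matrix (Fin n) (Fin n) ℂ) :
    Submodule ℂ (Matrix (Fin n) (Fin n) ℂ) :=
  Submodule.span ℂ (Set.range A)

/-- The `d`-th blow-up space, spanned by all `A_i ⊗ E_{jl}`. -/
def blowUpSpace {p n : ℕ} (A : Fin p → Matrix (Fin n) (Fin n) ℂ) (d : ℕ) :
    Submodule ℂ (Matrix (Fin n × Fin d) (Fin n × Fin d) ℂ) :=
  Submodule.span ℂ {B | ∃ (i : Fin p) (j l : Fin d), B = A i ⊗ₖ Matrix.single j l (1 : ℂ)}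

/-- `(1/d) rk (∑ A_i ⊗ X_i)`. -/
noncomputable def blowUpRatio {p n : ℕ} (A : Fin p → Matrix (Fin n) (Fin n) ℂ) (d : ℕ)
    (X : Fin p → Matrix (Fin d) (Fin d) ℂ) : ℚ :=
  ((∑ i, A i ⊗ₖ X i).rank : ℚ) / (d : ℚ)

/-- `d` is the minimum blow-up size: the least `d ≥ 1` at which the supremum of
`(1/d') rk (∑ A_i ⊗ X_i)` over all `d' ≥ 1` and all `d' × d'` matrices `X_i` is attained. -/
def IsMinBlowUpSize {p n : ℕ} (A : Fin p → Matrix (Fin n) (Fin n) ℂ) (d : ℕ) : Prop :=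
  IsLeast {d : ℕ | 0 < d ∧ ∃ X : Fin p → Matrix (Fin d) (Fin d) ℂ,
    ∀ (d' : ℕ) (X' : Fin p → Matrix (Fin d') (Fin d') ℂ), 0 < d' →
      blowUpRatio A d' X' ≤ blowUpRatio A d X} d

/-- The vector `u ⊗ e_a` of `Kⁿ ⊗ K^d`. -/
def tensorUnit {K : Type} [Zero K] {n d : ℕ} (u : Fin n → K) (a : Fin d) : Fin n × Fin d → K :=
  fun q => if q.2 = a then u q.1 else 0

/-- The subspace `U ⊗ ℂ^d`. -/
def tensorSpace {n : ℕ} (U : Submodule ℂ (Fin n → ℂ)) (d : ℕ) :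
    Submodule ℂ (Fin n × Fin d → ℂ) :=
  Submodule.span ℂ {v | ∃ u ∈ U, ∃ a : Fin d, v = tensorUnit u a}

/-- The span of a list of vectors. -/
def listSpan {ι : Type} (l : List (ι → ℂ)) : Submodule ℂ (ι → ℂ) :=
  Submodule.span ℂ {v | v ∈ l}

/-- The vectors of the list (counted with multiplicity) are linearly independent. -/
def ListIndep {ι : Type} (l : List (ι → ℂ)) : Prop :=
  LinearIndependent ℂ (fun i : Fin l.length => l.get i)

/-! ### Computations with counted arithmetic

A computation carries its value, the number of operations (arithmetic operations and comparisons
with zero) over `ℚ` that it makes, and the sets of all numbers that it computes. A complex number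
is a pair of rationals, so that an addition or subtraction takes 2 operations over `ℚ`, a
multiplication 6, a division 11, and a test for zero 2. The numbers computed inside a linear
independence test are kept separately, in `scratch`. -/

structure Arith (K : Type) (α : Type) : Type where
  val : α
  ops : ℕ
  nums : Set K
  scratch : Set K

namespace Arith

variable {K : Type}

instance : Monad (Arith K) where
  pure a := ⟨a, 0, ∅, ∅⟩
  bind x f := ⟨(f x.val).val, x.ops + (f x.val).ops, x.nums ∪ (f x.val).nums,
    x.scratch ∪ (f x.val).scratch⟩

section Scalars

variable [Field K] [DecidableEq K]

def add (x y : K) : Arith K K := ⟨x + y, 2, {x + y}, ∅⟩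
def sub (x y : K) : Arith K K := ⟨x - y, 2, {x - y}, ∅⟩
def mul (x y : K) : Arith K K := ⟨x * y, 6, {x * y}, ∅⟩
def div (x y : K) : Arith K K := ⟨x / y, 11, {x / y}, ∅⟩
def isZero (x : K) : Arith K Bool := ⟨decide (x = 0), 2, ∅, ∅⟩

end Scalars

/-- Declare the numbers of a computation to be scratch numbers. -/
def asScratch {α : Type} (x : Arith K α) : Arith K α := ⟨x.val, x.ops, ∅, x.nums ∪ x.scratch⟩

/-- Run one computation for each coordinate. -/
def vec {α ι : Type} [Fintype ι] (f : ι → Arith K α) : Arith K (ι → α) :=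
  ⟨fun i => (f i).val, ∑ i, (f i).ops, ⋃ i, (f i).nums, ⋃ i, (f i).scratch⟩

/-- Run the computation `f b` for each `b` in the list. -/
def mapList {α β : Type} (f : β → Arith K α) : List β → Arith K (List α)
  | [] => pure []
  | b :: bs => do
    let a ← f b
    let as ← mapList f bs
    pure (a :: as)

/-- Add up the numbers in a list of computations. -/
def sumList [Field K] : List (Arith K K) → Arith K K
  | [] => pure 0
  | t :: ts => do
    let x ← t
    let s ← sumList ts
    add x s

/-- `∑ i, x i * y i`. -/
def dot [Field K] {m : ℕ} (x y : Fin m → K) : Arith K K :=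
  sumList ((List.finRange m).map fun i => mul (x i) (y i))

end Arith

open Arith

/-! ### Fraction-free Gaussian elimination -/

section Elimination

variable {K : Type} [Field K] [DecidableEq K]

/-- A vector of the eliminated system, with the coordinate of its pivot. -/
structure Pivot (τ K : Type) : Type where
  loc : τ
  row : τ → K

/-- Reduce `v` against the pivots, one after the other. Each step divides by the preceding pivot
entry (1 at the start), as in Bareiss's algorithm. -/
def reduce {τ : Type} [Fintype τ] : K → List (Pivot τ K) → (τ → K) → Arith K (τ → K)
  | _, [], v => pure v
  | prev, P :: Ps, v => do
    let v' ← vec fun t => do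
      let x ← mul (P.row P.loc) (v t)
      let y ← mul (v P.loc) (P.row t)
      let z ← sub x y
      div z prev
    reduce (P.row P.loc) Ps v'

/-- The first coordinate in the list at which `v` does not vanish. -/
def findPivot {τ : Type} (v : τ → K) : List τ → Arith K (Option τ)
  | [] => pure none
  | t :: ts => do
    let z ← isZero (v t)
    if z then findPivot v ts else pure (some t)

/-- Linearly independent vectors selected so far, with their eliminated form. -/
structure Selection (n : ℕ) (K : Type) : Type where
  tableau : List (Pivot (Fin n) K)
  basis : List (Fin n → K)

/-- Go through a list of (yet to be computed) vectors and add every vector that is linearly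
independent of those selected before. -/
def select {n : ℕ} : List (Arith K (Fin n → K)) → Selection n K → Arith K (Selection n K)
  | [], S => pure S
  | c :: cs, S => do
    let w ← c
    let r ← asScratch (reduce 1 S.tableau w)
    let t ← findPivot r (List.finRange n)
    match t with
    | none => select cs S
    | some t => select cs ⟨S.tableau ++ [⟨t, r⟩], S.basis ++ [w]⟩

/-- The coordinates of `Kⁿ ⊗ K^d`, listed. -/
def coords (n d : ℕ) : List (Fin n × Fin d) :=
  (List.finRange n).flatMap fun i => (List.finRange d).map fun a => (i, a)

/-- The eliminated form of a square matrix `B`: pivots `(B x; x)`, and a basis of the kernel. -/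
structure Factored (n d : ℕ) (K : Type) : Type where
  pivots : List (Pivot ((Fin n × Fin d) ⊕ (Fin n × Fin d)) K)
  kernel : List (Fin n × Fin d → K)

/-- Eliminate the columns of `B` in turn, each extended by the unit vector of its index, so that
all vectors occurring are of the form `(B x; x)`; those of the form `(0; x)` give the kernel. -/
def factor {n d : ℕ} (B : Matrix (Fin n × Fin d) (Fin n × Fin d) K) :
    List (Fin n × Fin d) → Factored n d K → Arith K (Factored n d K)
  | [], F => pure F
  | q :: qs, F => do
    let v ← reduce 1 F.pivots (Sum.elim (fun i => B i q) (Pi.single q 1))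
    let t ← findPivot v ((coords n d).map Sum.inl)
    match t with
    | none => factor B qs ⟨F.pivots, F.kernel ++ [fun i => v (Sum.inr i)]⟩
    | some t => factor B qs ⟨F.pivots ++ [⟨t, v⟩], F.kernel⟩

/-- Apply the scaled pseudoinverse `B⁺`. Reducing `(w; 0)` gives `(δ w + B x; x)`, with `δ ≠ 0` the
last pivot entry, and if `w` is in the image of `B` then `B x = - δ w`. -/
def pseudoInverse {n d : ℕ} (F : Factored n d K) (w : Fin n × Fin d → K) :
    Arith K (Fin n × Fin d → K) := do
  let v ← reduce 1 F.pivots (Sum.elim w 0)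
  pure fun i => v (Sum.inr i)

end Elimination

/-! ### The randomized algorithm -/

section Algorithm

variable {K : Type} [Field K] [DecidableEq K] {p n d : ℕ}

/-- Compute `∑ A_i ⊗ X_i`. -/
def blowUpElement (A : Fin p → Matrix (Fin n) (Fin n) K) (X : Fin p → Matrix (Fin d) (Fin d) K) :
    Arith K (Matrix (Fin n × Fin d) (Fin n × Fin d) K) :=
  vec fun q => vec fun q' => dot (fun i => A i q.1 q'.1) (fun i => X i q.2 q'.2)

/-- The vectors `A_j u_b`, where `u_b ∈ Kⁿ` runs over the blocks of the given vectors
`u = ∑ u_b ⊗ e_b`. As `(A_j ⊗ E_{ab}) u = A_j u_b ⊗ e_a`, the vectors `A_j u_b ⊗ e_a` span the image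
under the blow-up space of the span of the vectors `u`. -/
def candidates (A : Fin p → Matrix (Fin n) (Fin n) K) (us : List (Fin n × Fin d → K)) :
    List (Arith K (Fin n → K)) :=
  us.flatMap fun u => (List.finRange d).flatMap fun b => (List.finRange p).map fun j =>
    vec fun s => dot (A j s) (fun t => u (t, b))

/-- The vectors `w ⊗ e_a`. -/
def tensorList (d : ℕ) (ws : List (Fin n → K)) : List (Fin n × Fin d → K) :=
  ws.flatMap fun w => (List.finRange d).map fun a => tensorUnit w a

/-- Steps of the Wong sequence of `B = ∑ A_i ⊗ X_i` and the blow-up space. `S.basis` consists of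
vectors `w` such that the `w ⊗ e_a` form a basis of `W_i`, the list `us` of vectors that (for
`W_i` in the image of `B`) form a basis of `B⁻¹(W_i)`, and `fresh` is the part of `us` added last. -/
def wongSteps (A : Fin p → Matrix (Fin n) (Fin n) K) (F : Factored n d K) :
    ℕ → List (Fin n × Fin d → K) → List (Fin n × Fin d → K) → Selection n K →
      Arith K (Selection n K × List (Fin n × Fin d → K))
  | 0, _, us, S => pure (S, us)
  | m + 1, fresh, us, S => do
    let S' ← select (candidates A fresh) S
    let fresh' ← mapList (pseudoInverse F) (tensorList d (S'.basis.drop S.basis.length))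
    wongSteps A F m fresh' (us ++ fresh') S'

/-- What the algorithm has computed at the end of a run: the matrix `B = ∑ A_i ⊗ X_i`, a basis of
its kernel, vectors `w` such that the `w ⊗ e_a` form the basis of `W_∞`, the basis of
`U* = B⁻¹(W_∞)`, and the output, a basis of `U₀` with `U* = U₀ ⊗ K^d`. -/
structure Result (p n d : ℕ) (K : Type) : Type where
  element : Matrix (Fin n × Fin d) (Fin n × Fin d) K
  factored : Factored n d K
  wong : List (Fin n → K)
  ustar : List (Fin n × Fin d → K)
  output : List (Fin n → K)

/-- The algorithm, after the matrices `X_i` have been drawn. In `ℂⁿ` the Wong sequence is stationary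
after at most `n` steps, and `U₀` is spanned by the blocks of the vectors of `U*`. -/
def algorithm (A : Fin p → Matrix (Fin n) (Fin n) K) (X : Fin p → Matrix (Fin d) (Fin d) K) :
    Arith K (Result p n d K) := do
  let B ← blowUpElement A X
  let F ← factor B (coords n d) ⟨[], []⟩
  let R ← wongSteps A F n F.kernel F.kernel ⟨[], []⟩
  let U ← select
    (R.2.flatMap fun u => (List.finRange d).map fun b => pure fun t => u (t, b)) ⟨[], []⟩
  pure ⟨B, F, R.1.basis, R.2, U.basis⟩

/-- All entries of the vectors and matrices that the algorithm has computed. -/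
def Result.entries (R : Result p n d K) : Set K :=
  {z | (∃ i j, z = R.element i j) ∨ (∃ P ∈ R.factored.pivots, ∃ i, z = P.row i) ∨
    (∃ u ∈ R.factored.kernel, ∃ i, z = u i) ∨ (∃ w ∈ R.wong, ∃ i, z = w i) ∨
    (∃ u ∈ R.ustar, ∃ i, z = u i) ∨ (∃ u ∈ R.output, ∃ i, z = u i)}

end Algorithm

/-- The possible outcomes of the random draw: each entry of the `p` matrices `X_i` of size `d × d`
is one of `0, 1, …, 2dk - 1`. -/
abbrev Draw (p d k : ℕ) : Type := Fin p → Fin d → Fin d → Fin (2 * d * k)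

/-- The complex matrix with the given Gaussian integer entries. -/
noncomputable def toComplexMat {p n : ℕ} (A : Fin p → Matrix (Fin n) (Fin n) GaussianInt) :
    Fin p → Matrix (Fin n) (Fin n) ℂ :=
  fun i => (A i).map GaussianInt.toComplex

/-- The run of the algorithm on the matrices `A_i` with the drawn matrices `X_i`. -/
noncomputable def run {p n d k : ℕ} (A : Fin p → Matrix (Fin n) (Fin n) GaussianInt)
    (X : Draw p d k) : Arith ℂ (Result p n d ℂ) :=
  algorithm (toComplexMat A) (fun i => Matrix.of fun a b => ((X i a b : ℕ) : ℂ))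

/-- The run is successful. With `B = ∑ A_i ⊗ X_i` and `c = n - ncrank 𝒜`: it has computed
bases of the Wong limit `W_∞` and of `U* = B⁻¹(W_∞)`, its output is a basis of
`U₀ = {u : u ⊗ e_a ∈ U* for all a}`, one has `U* = U₀ ⊗ ℂ^d`, and `U₀` is the minimum `c`-shrunk
subspace of `𝒜`. -/
def Successful {p n d k : ℕ} (A : Fin p → Matrix (Fin n) (Fin n) GaussianInt)
    (X : Draw p d k) : Prop :=
  let 𝒜 := matrixSpace (toComplexMat A)
  let R := (run A X).val
  let B : Matrix (Fin n × Fin d) (Fin n × Fin d) ℂ :=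
    ∑ i, toComplexMat A i ⊗ₖ Matrix.of fun a b => ((X i a b : ℕ) : ℂ)
  let W := wongLimit B (blowUpSpace (toComplexMat A) d)
  (ListIndep (tensorList d R.wong) ∧ listSpan (tensorList d R.wong) = W) ∧
  (ListIndep R.ustar ∧ listSpan R.ustar = W.comap B.mulVecLin) ∧
  (ListIndep R.output ∧
    (listSpan R.output : Set (Fin n → ℂ)) =
      {u | ∀ a : Fin d, tensorUnit u a ∈ W.comap B.mulVecLin}) ∧
  W.comap B.mulVecLin = tensorSpace (listSpan R.output) d ∧
  IsLeast {U | IsShrunk 𝒜 (n - ncrank 𝒜) U} (listSpan R.output)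

/-- `z` is a Gaussian integer of absolute value at most `e^b`. -/
def IsGaussianIntLE (z : ℂ) (b : ℝ) : Prop :=
  (∃ g : GaussianInt, z = GaussianInt.toComplex g) ∧ ‖z‖ ≤ Real.exp b

end ShrunkSubspace

/-! Let `B = ∑ A_i ⊗ X_i` have the largest relative rank `rk B / d` among the elements of all
blow-ups. The Wong sequence then never leaves the range of `B`. To see this, take an element `D = ∑
A_i ⊗ Y_i` of the same relative rank and a kernel vector `z` of `D`, and glue `Y` and `X` into block
lower triangular matrices with an arbitrary corner. The rank of the glued element is at least `rk D
+ rk B`, and maximality forbids more. Equality forces the corner to map `z` into the range of `B`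
(`rank_fromBlocks_lower`), and a preimage completes `z` to a kernel vector of the glued element, so
the argument can be iterated (`reachable_step`, `wongSeq_le_range`).

The image of any subspace under a blow-up space has the form `V ⊗ ℂ^d`. Hence the sequence is
stationary after `n` steps, `W_∞ = 𝒜(U₀) ⊗ ℂ^d` and `B⁻¹(W_∞) = U₀ ⊗ ℂ^d`, where `U₀` is spanned by
the blocks of `B⁻¹(W_∞)`. Since `W_∞` lies in the range, `d (dim U₀ - dim 𝒜(U₀))` is the nullity of
`B`. Together with `rk B ≤ d · ncrank` this gives `rk B = d · ncrank`, so `U₀` is `c`-shrunk. For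
any `c`-shrunk `U`, the dimensions force the preimage of `𝒜(U) ⊗ ℂ^d` under `B` to be `U ⊗ ℂ^d`, so
the whole Wong sequence stays in `𝒜(U) ⊗ ℂ^d` and `U₀ ≤ U` (`comap_wongLimit`).

For the numbers, the point is Bareiss's identity: every entry of a reduced vector is a minor of the
input vectors (`borderedMinor_eq`, `Echelon.exists_minor`). So the divisions are exact, and
determinant bounds apply. With `T = M n d k`, one application of the pseudoinverse multiplies the
size by `T^{O(nd)}`, and `n` rounds give `T^{O(n²d)}`; minors of order at most `n` in such vectors
give `T^{O(n³d)}` for the tableaux (`isGaussianLE_algorithm`). The operation count is amortised: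
each vector is fresh only once (`wongSteps_ops_le`).

A fixed optimal element has a nonvanishing minor of order `r ≤ d k` after a change of bases. This is
a polynomial of degree at most `r` in the entries of the `X_i`, and Schwartz–Zippel over a set of
`2dk` values makes it nonzero for at least half of the draws (`exists_rank_polynomial`,
`card_draw_le`). -/

namespace ShrunkSubspace

/-! ### Tensor spaces and images -/

section TensorSpaces

variable {n d p : ℕ}

/-- The block `u_b` of the vector `u = ∑ u_b ⊗ e_b`. -/
def block {K : Type} {n d : ℕ} (u : Fin n × Fin d → K) (b : Fin d) : Fin n → K := fun t => u (t, b)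

lemma block_tensorUnit (u : Fin n → ℂ) (a b : Fin d) :
    block (tensorUnit u a) b = if b = a then u else 0 := by
  ext t; by_cases h : b = a <;> simp [block, tensorUnit, h]

lemma eq_sum_tensorUnit_block (v : Fin n × Fin d → ℂ) :
    v = ∑ b, tensorUnit (block v b) b := by
  ext ⟨t, b⟩
  simp [Finset.sum_apply, tensorUnit, block]

/-- The blockwise description replaces any use of abstract tensor products below. -/
lemma mem_tensorSpace {U : Submodule ℂ (Fin n → ℂ)} {v : Fin n × Fin d → ℂ} :
    v ∈ tensorSpace U d ↔ ∀ b, block v b ∈ U := by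
  constructor
  · intro h
    induction h using Submodule.span_induction with
    | mem x hx =>
      obtain ⟨u, hu, a, rfl⟩ := hx
      intro b
      rw [block_tensorUnit]
      split_ifs
      exacts [hu, U.zero_mem]
    | zero => intro b; exact U.zero_mem
    | add x y _ _ hx hy => intro b; exact U.add_mem (hx b) (hy b)
    | smul c x _ hx => intro b; exact U.smul_mem c (hx b)
  · intro h
    rw [eq_sum_tensorUnit_block v]
    exact Submodule.sum_mem _ fun b _ => Submodule.subset_span ⟨_, h b, b, rfl⟩

lemma tensorUnit_mem_tensorSpace {U : Submodule ℂ (Fin n → ℂ)} {u : Fin n → ℂ} (hu : u ∈ U)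
    (a : Fin d) : tensorUnit u a ∈ tensorSpace U d :=
  Submodule.subset_span ⟨u, hu, a, rfl⟩

lemma tensorSpace_mono {U V : Submodule ℂ (Fin n → ℂ)} (h : U ≤ V) :
    tensorSpace U d ≤ tensorSpace V d := fun _ hv =>
  mem_tensorSpace.2 fun b => h (mem_tensorSpace.1 hv b)

/-- `u ↦ u ⊗ e_a` as a linear map. -/
def tensorUnitLin (n : ℕ) {d : ℕ} (a : Fin d) : (Fin n → ℂ) →ₗ[ℂ] (Fin n × Fin d → ℂ) where
  toFun u := tensorUnit u a
  map_add' u v := by ext q; simp only [tensorUnit, Pi.add_apply]; split_ifs <;> simp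
  map_smul' c u := by ext q; simp [tensorUnit]

lemma tensorSpace_span (s : Set (Fin n → ℂ)) :
    tensorSpace (Submodule.span ℂ s) d =
      Submodule.span ℂ {v | ∃ u ∈ s, ∃ a : Fin d, v = tensorUnit u a} := by
  apply le_antisymm
  · refine Submodule.span_le.2 ?_
    rintro _ ⟨u, hu, a, rfl⟩
    have h : Submodule.span ℂ s ≤
        (Submodule.span ℂ {v | ∃ u ∈ s, ∃ a : Fin d, v = tensorUnit u a}).comap
          (tensorUnitLin n a) :=
      Submodule.span_le.2 fun x hx => Submodule.subset_span ⟨x, hx, a, rfl⟩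
    exact h hu
  · refine Submodule.span_mono ?_
    rintro _ ⟨u, hu, a, rfl⟩
    exact ⟨u, Submodule.subset_span hu, a, rfl⟩

lemma finrank_tensorSpace (U : Submodule ℂ (Fin n → ℂ)) (d : ℕ) :
    Module.finrank ℂ (tensorSpace U d) = d * Module.finrank ℂ U := by
  let f : (Fin d → U) →ₗ[ℂ] (Fin n × Fin d → ℂ) :=
    { toFun := fun g q => (g q.2 : Fin n → ℂ) q.1
      map_add' := fun _ _ => rfl
      map_smul' := fun _ _ => rfl }
  have hf : Function.Injective f := by
    intro g h hgh
    ext b t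
    exact congrFun hgh (t, b)
  have hr : LinearMap.range f = tensorSpace U d := by
    ext v
    rw [mem_tensorSpace]
    constructor
    · rintro ⟨g, rfl⟩ b
      exact (g b).2
    · intro h
      exact ⟨fun b => ⟨block v b, h b⟩, rfl⟩
  rw [← hr, LinearMap.finrank_range_of_inj hf, Module.finrank_pi_fintype]
  simp

/-- The span of all blocks of the vectors in `S`. -/
def blockSpan (S : Set (Fin n × Fin d → ℂ)) : Submodule ℂ (Fin n → ℂ) :=
  Submodule.span ℂ {v | ∃ u ∈ S, ∃ b, v = block u b}

lemma blockSpan_span (s : Set (Fin n × Fin d → ℂ)) :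
    blockSpan (Submodule.span ℂ s : Set (Fin n × Fin d → ℂ)) = blockSpan s := by
  apply le_antisymm
  · refine Submodule.span_le.2 ?_
    rintro _ ⟨u, hu, b, rfl⟩
    have h : Submodule.span ℂ s ≤ tensorSpace (blockSpan s) d :=
      Submodule.span_le.2 fun x hx => mem_tensorSpace.2 fun b =>
        Submodule.subset_span ⟨x, hx, b, rfl⟩
    exact mem_tensorSpace.1 (h hu) b
  · refine Submodule.span_mono ?_
    rintro _ ⟨u, hu, b, rfl⟩
    exact ⟨u, Submodule.subset_span hu, b, rfl⟩

/-- Together with `blockSpan_tensorSpace_le`, this makes `blockSpan S` the smallest `U` with `S ≤ U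
⊗ ℂ^d`. -/
lemma le_tensorSpace_blockSpan (S : Submodule ℂ (Fin n × Fin d → ℂ)) :
    S ≤ tensorSpace (blockSpan (S : Set (Fin n × Fin d → ℂ))) d := fun v hv =>
  mem_tensorSpace.2 fun b => Submodule.subset_span ⟨v, hv, b, rfl⟩

lemma blockSpan_tensorSpace_le (U : Submodule ℂ (Fin n → ℂ)) :
    blockSpan (tensorSpace U d : Set (Fin n × Fin d → ℂ)) ≤ U := by
  refine Submodule.span_le.2 ?_
  rintro _ ⟨u, hu, b, rfl⟩
  exact mem_tensorSpace.1 hu b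

/-- Bilinearity of `(B, u) ↦ B u` lets images be computed from spanning sets of both arguments. -/
lemma image_eq_map₂ {ι : Type} [Fintype ι] (𝒜 : Submodule ℂ (Matrix ι ι ℂ))
    (U : Submodule ℂ (ι → ℂ)) :
    image 𝒜 U = Submodule.map₂ (Matrix.mulVecBilin ℂ ℂ) 𝒜 U := by
  rw [Submodule.map₂_eq_span_image2, image]
  congr 1
  ext v
  simp only [Set.mem_ofPred_eq, Set.mem_image2, SetLike.mem_coe, Matrix.mulVecBilin_apply, eq_comm]

lemma image_span_span {ι : Type} [Fintype ι] (S : Set (Matrix ι ι ℂ))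
    (T : Set (ι → ℂ)) :
    image (Submodule.span ℂ S) (Submodule.span ℂ T) =
      Submodule.span ℂ {v | ∃ B ∈ S, ∃ u ∈ T, v = B.mulVec u} := by
  rw [image_eq_map₂, Submodule.map₂_span_span]
  congr 1
  ext v
  simp only [Set.mem_ofPred_eq, Set.mem_image2, Matrix.mulVecBilin_apply, eq_comm]

lemma image_mono {ι : Type} [Fintype ι] (𝒜 : Submodule ℂ (Matrix ι ι ℂ))
    {U V : Submodule ℂ (ι → ℂ)} (h : U ≤ V) : image 𝒜 U ≤ image 𝒜 V := by
  refine Submodule.span_mono ?_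
  rintro _ ⟨B, hB, u, hu, rfl⟩
  exact ⟨B, hB, u, h hu, rfl⟩

lemma mulVec_mem_image {ι : Type} [Fintype ι] {𝒜 : Submodule ℂ (Matrix ι ι ℂ)}
    {U : Submodule ℂ (ι → ℂ)} {B : Matrix ι ι ℂ} (hB : B ∈ 𝒜) {u : ι → ℂ} (hu : u ∈ U) :
    B.mulVec u ∈ image 𝒜 U := Submodule.subset_span ⟨B, hB, u, hu, rfl⟩

lemma kronecker_single_mulVec (B : Matrix (Fin n) (Fin n) ℂ) (j l : Fin d)
    (u : Fin n × Fin d → ℂ) :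
    (B ⊗ₖ Matrix.single j l (1 : ℂ)).mulVec u = tensorUnit (B.mulVec (block u l)) j := by
  ext ⟨t, a⟩
  simp only [Matrix.mulVec, dotProduct, Fintype.sum_prod_type, Matrix.kroneckerMap_apply,
    tensorUnit, block]
  by_cases h : a = j
  · subst h
    rw [if_pos rfl]
    refine Finset.sum_congr rfl fun s _ => ?_
    rw [Finset.sum_eq_single l]
    · simp
    · intro b _ hb; simp [Matrix.single, hb.symm]
    · simp
  · rw [if_neg h]
    refine Finset.sum_eq_zero fun s _ => Finset.sum_eq_zero fun b _ => ?_
    simp [Matrix.single, Ne.symm h]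

/-- The units `E_jl` carry any block to any slot, so the image remembers the blocks but not their
positions. This is why the algorithm can run its independence tests in `ℂⁿ`. -/
lemma image_blowUpSpace_span (A : Fin p → Matrix (Fin n) (Fin n) ℂ)
    (T : Set (Fin n × Fin d → ℂ)) :
    image (blowUpSpace A d) (Submodule.span ℂ T) =
      tensorSpace (image (matrixSpace A) (blockSpan T)) d := by
  rw [blowUpSpace, image_span_span, matrixSpace, blockSpan, image_span_span, tensorSpace_span]
  congr 1
  ext v
  constructor
  · rintro ⟨_, ⟨i, j, l, rfl⟩, u, hu, rfl⟩
    exact ⟨_, ⟨A i, ⟨i, rfl⟩, _, ⟨u, hu, l, rfl⟩, rfl⟩, j, kronecker_single_mulVec _ _ _ _⟩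
  · rintro ⟨_, ⟨_, ⟨i, rfl⟩, _, ⟨u, hu, l, rfl⟩, rfl⟩, j, rfl⟩
    exact ⟨_, ⟨i, j, l, rfl⟩, u, hu, (kronecker_single_mulVec _ _ _ _).symm⟩

lemma image_blowUpSpace (A : Fin p → Matrix (Fin n) (Fin n) ℂ)
    (U : Submodule ℂ (Fin n × Fin d → ℂ)) :
    image (blowUpSpace A d) U =
      tensorSpace (image (matrixSpace A) (blockSpan (U : Set (Fin n × Fin d → ℂ)))) d := by
  conv_lhs => rw [← Submodule.span_eq U]
  exact image_blowUpSpace_span A _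

lemma sum_kronecker_mem_blowUpSpace (A : Fin p → Matrix (Fin n) (Fin n) ℂ)
    (X : Fin p → Matrix (Fin d) (Fin d) ℂ) : ∑ i, A i ⊗ₖ X i ∈ blowUpSpace A d := by
  refine Submodule.sum_mem _ fun i _ => ?_
  have : A i ⊗ₖ X i = ∑ j, ∑ l, X i j l • (A i ⊗ₖ Matrix.single j l (1 : ℂ)) := by
    conv_lhs => rw [Matrix.matrix_eq_sum_single (X i)]
    ext ⟨s, a⟩ ⟨t, b⟩
    simp only [Matrix.kroneckerMap_apply, Matrix.sum_apply, Finset.mul_sum, Matrix.smul_apply,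
      smul_eq_mul]
    refine Finset.sum_congr rfl fun j _ => Finset.sum_congr rfl fun l _ => ?_
    simp only [Matrix.single, Matrix.of_apply]
    split_ifs <;> simp [mul_comm]
  rw [this]
  exact Submodule.sum_mem _ fun j _ => Submodule.sum_mem _ fun l _ =>
    Submodule.smul_mem _ _ (Submodule.subset_span ⟨i, j, l, rfl⟩)

lemma image_blowUpSpace_tensorSpace_le (A : Fin p → Matrix (Fin n) (Fin n) ℂ)
    (U : Submodule ℂ (Fin n → ℂ)) :
    image (blowUpSpace A d) (tensorSpace U d) ≤ tensorSpace (image (matrixSpace A) U) d := by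
  rw [image_blowUpSpace]
  exact tensorSpace_mono (image_mono _ (blockSpan_tensorSpace_le U))

end TensorSpaces

/-! ### Elements of maximal rank in the blow-ups -/

section Rank

lemma rank_add_finrank_ker {ι κ : Type} [Fintype ι] [Fintype κ]
    (B : Matrix κ ι ℂ) :
    B.rank + Module.finrank ℂ (LinearMap.ker B.mulVecLin) = Fintype.card ι := by
  rw [Matrix.rank, LinearMap.finrank_range_add_finrank_ker, Module.finrank_fintype_fun_eq_card]

/-- A block lower triangular matrix has at least the rank of its diagonal; in case of equality the
lower left block maps the kernel of the first diagonal block into the range of the second. -/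
lemma rank_fromBlocks_lower {ι κ : Type} [Fintype ι] [Fintype κ]
    (D : Matrix ι ι ℂ) (H : Matrix κ ι ℂ) (B : Matrix κ κ ℂ) :
    D.rank + B.rank ≤ (Matrix.fromBlocks D 0 H B).rank ∧
      ((Matrix.fromBlocks D 0 H B).rank ≤ D.rank + B.rank →
        ∀ z, D.mulVec z = 0 → H.mulVec z ∈ LinearMap.range B.mulVecLin) := by
  classical
  set F := Matrix.fromBlocks D 0 H B with hF
  -- Project kernel vectors `(z, y)` of `F` to `z`. The image lies in the space `S` of those `z`
  -- with `D z = 0` and `H z` in the range of `B`; the fibre over `0` embeds into `ker B`.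
  -- Rank-nullity gives the inequality, and equality of ranks leaves no room between `S` and `ker
  -- D`.
  let f : LinearMap.ker F.mulVecLin →ₗ[ℂ] (ι → ℂ) :=
    (LinearMap.funLeft ℂ ℂ (Sum.inl : ι → ι ⊕ κ)).comp (Submodule.subtype _)
  have hmem : ∀ x : ι ⊕ κ → ℂ, x ∈ LinearMap.ker F.mulVecLin ↔
      D.mulVec (x ∘ Sum.inl) = 0 ∧ H.mulVec (x ∘ Sum.inl) + B.mulVec (x ∘ Sum.inr) = 0 := by
    intro x
    rw [LinearMap.mem_ker, Matrix.mulVecLin_apply, hF, Matrix.fromBlocks_mulVec]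
    constructor
    · intro h
      refine ⟨?_, ?_⟩
      · ext i; simpa using congrFun h (Sum.inl i)
      · ext i; simpa using congrFun h (Sum.inr i)
    · rintro ⟨h1, h2⟩
      ext (i | i)
      · simp [h1]
      · simpa using congrFun h2 i
  let S : Submodule ℂ (ι → ℂ) :=
    LinearMap.ker D.mulVecLin ⊓ (LinearMap.range B.mulVecLin).comap H.mulVecLin
  have hrange : LinearMap.range f ≤ S := by
    rintro _ ⟨⟨x, hx⟩, rfl⟩
    obtain ⟨h1, h2⟩ := (hmem x).1 hx
    refine ⟨h1, ?_⟩
    refine ⟨-(x ∘ Sum.inr), ?_⟩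
    rw [Matrix.mulVecLin_apply, Matrix.mulVec_neg]
    exact (eq_neg_of_add_eq_zero_left h2).symm
  let g : LinearMap.ker f →ₗ[ℂ] LinearMap.ker B.mulVecLin :=
    { toFun := fun x => ⟨(x : LinearMap.ker F.mulVecLin).1 ∘ Sum.inr, by
        obtain ⟨h1, h2⟩ := (hmem x.1.1).1 x.1.2
        have h0 : x.1.1 ∘ Sum.inl = 0 := x.2
        simpa [h0] using h2⟩
      map_add' := fun _ _ => rfl
      map_smul' := fun _ _ => rfl }
  have hg : Function.Injective g := by
    intro x y hxy
    apply Subtype.ext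
    apply Subtype.ext
    have hx : x.1.1 ∘ Sum.inl = 0 := x.2
    have hy : y.1.1 ∘ Sum.inl = 0 := y.2
    have h := congrArg Subtype.val hxy
    ext (i | i)
    · exact (congrFun hx i).trans (congrFun hy i).symm
    · exact congrFun h i
  have h1 := LinearMap.finrank_range_add_finrank_ker f
  have h2 := LinearMap.finrank_le_finrank_of_injective hg
  have h3 := Submodule.finrank_mono hrange
  have h4 : Module.finrank ℂ S ≤ Module.finrank ℂ (LinearMap.ker D.mulVecLin) :=
    Submodule.finrank_mono inf_le_left
  have r1 := rank_add_finrank_ker F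
  have r2 := rank_add_finrank_ker D
  have r3 := rank_add_finrank_ker B
  rw [Fintype.card_sum] at r1
  refine ⟨by omega, fun hle z hz => ?_⟩
  have hS : S = LinearMap.ker D.mulVecLin :=
    Submodule.eq_of_le_of_finrank_le inf_le_left (by omega)
  have : z ∈ S := by rw [hS]; exact hz
  exact this.2

variable {n d p : ℕ}

/-- The vectors that are linear images of kernel vectors of elements, of the same relative rank as
`∑ A_i ⊗ X_i`, of other blow-ups. -/
def reachable (A : Fin p → Matrix (Fin n) (Fin n) ℂ) (X : Fin p → Matrix (Fin d) (Fin d) ℂ) :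
    Set (Fin n × Fin d → ℂ) :=
  {x | ∃ (κ : Type) (_ : Fintype κ) (Y : Fin p → Matrix κ κ ℂ)
    (Q : Matrix (Fin d) κ ℂ) (z : Fin n × κ → ℂ),
    (∑ i, A i ⊗ₖ Y i).rank * d = Fintype.card κ * (∑ i, A i ⊗ₖ X i).rank ∧
    (∑ i, A i ⊗ₖ Y i).mulVec z = 0 ∧ x = ((1 : Matrix (Fin n) (Fin n) ℂ) ⊗ₖ Q).mulVec z}

/-- `∑ A_i ⊗ X_i` has the maximal relative rank among the elements of all blow-ups. -/
def IsMaxRatio (A : Fin p → Matrix (Fin n) (Fin n) ℂ) (X : Fin p → Matrix (Fin d) (Fin d) ℂ) :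
    Prop :=
  ∀ (κ : Type) [Fintype κ] (Y : Fin p → Matrix κ κ ℂ),
    (∑ i, A i ⊗ₖ Y i).rank * d ≤ Fintype.card κ * (∑ i, A i ⊗ₖ X i).rank

/-- Clearing denominators and allowing arbitrary finite index types lets blow-ups be glued along `κ
⊕ Fin d` without renumbering. -/
lemma isMaxRatio_of_blowUpRatio_le {A : Fin p → Matrix (Fin n) (Fin n) ℂ} (hd : 0 < d)
    {X : Fin p → Matrix (Fin d) (Fin d) ℂ}
    (h : ∀ (d' : ℕ) (X' : Fin p → Matrix (Fin d') (Fin d') ℂ), 0 < d' →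
      blowUpRatio A d' X' ≤ blowUpRatio A d X) : IsMaxRatio A X := by
  intro κ _ Y
  classical
  let e := Fintype.equivFin κ
  rcases Nat.eq_zero_or_pos (Fintype.card κ) with h0 | hpos
  · have : (∑ i, A i ⊗ₖ Y i).rank ≤ Fintype.card (Fin n × κ) := Matrix.rank_le_card_width _
    simp only [Fintype.card_prod, h0, mul_zero, Nat.le_zero] at this
    simp [this]
  · have hr : (∑ i, A i ⊗ₖ (Y i).submatrix e.symm e.symm).rank = (∑ i, A i ⊗ₖ Y i).rank := by
      rw [← Matrix.rank_submatrix (∑ i, A i ⊗ₖ Y i)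
        ((Equiv.refl (Fin n)).prodCongr e.symm) ((Equiv.refl (Fin n)).prodCongr e.symm)]
      congr 1
      ext ⟨s, a⟩ ⟨t, b⟩
      simp [Matrix.sum_apply]
    have := h _ (fun i => (Y i).submatrix e.symm e.symm) hpos
    rw [blowUpRatio, blowUpRatio, hr, div_le_div_iff₀ (by exact_mod_cast hpos)
      (by exact_mod_cast hd)] at this
    have h2 : (∑ i, A i ⊗ₖ Y i).rank * d ≤ (∑ i, A i ⊗ₖ X i).rank * Fintype.card κ := by
      exact_mod_cast this
    rwa [mul_comm (Fintype.card κ)]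

variable {A : Fin p → Matrix (Fin n) (Fin n) ℂ} {X : Fin p → Matrix (Fin d) (Fin d) ℂ}

lemma mem_reachable_of_ker {x : Fin n × Fin d → ℂ} (hx : (∑ i, A i ⊗ₖ X i).mulVec x = 0) :
    x ∈ reachable A X := by
  refine ⟨Fin d, inferInstance, X, 1, x, ?_, hx, ?_⟩
  · simp [mul_comm]
  · simp

/-- If `x = (1 ⊗ Q) z` with `z` in the kernel of `∑ A_i ⊗ Y_i`, the matrices with diagonal blocks
`Y_i`, `X_i` and corner `Z_i Q` define a larger blow-up element. Maximality bounds its rank by the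
sum of the diagonal ranks, which is the equality case of `rank_fromBlocks_lower`. As the relative
rank is unchanged, kernel vectors of the glued element produce reachable vectors again. -/
lemma reachable_step (hX : IsMaxRatio A X) {x : Fin n × Fin d → ℂ} (hx : x ∈ reachable A X)
    (Z : Fin p → Matrix (Fin d) (Fin d) ℂ) :
    (∑ i, A i ⊗ₖ Z i).mulVec x ∈ LinearMap.range (∑ i, A i ⊗ₖ X i).mulVecLin ∧
      ∀ x', (∑ i, A i ⊗ₖ X i).mulVec x' = -(∑ i, A i ⊗ₖ Z i).mulVec x → x' ∈ reachable A X := by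
  obtain ⟨κ, _, Y, Q, z, hr, hz, rfl⟩ := hx
  classical
  let Y' : Fin p → Matrix (κ ⊕ Fin d) (κ ⊕ Fin d) ℂ := fun i =>
    Matrix.fromBlocks (Y i) 0 (Z i * Q) (X i)
  let H := (∑ i, A i ⊗ₖ Z i) * ((1 : Matrix (Fin n) (Fin n) ℂ) ⊗ₖ Q)
  have hH : H = ∑ i, A i ⊗ₖ (Z i * Q) := by
    simp only [H, Matrix.sum_mul]
    refine Finset.sum_congr rfl fun i _ => ?_
    rw [← Matrix.mul_kronecker_mul, Matrix.mul_one]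
  let e := Equiv.prodSumDistrib (Fin n) κ (Fin d)
  have hsub : (∑ i, A i ⊗ₖ Y' i) =
      (Matrix.fromBlocks (∑ i, A i ⊗ₖ Y i) 0 H (∑ i, A i ⊗ₖ X i)).submatrix e e := by
    rw [hH]
    ext ⟨s, a | a⟩ ⟨t, b | b⟩ <;> simp [Matrix.sum_apply, Y', e]
  have hrank : (∑ i, A i ⊗ₖ Y' i).rank =
      (Matrix.fromBlocks (∑ i, A i ⊗ₖ Y i) 0 H (∑ i, A i ⊗ₖ X i)).rank := by
    rw [hsub, Matrix.rank_submatrix]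
  obtain ⟨hge, hrange⟩ := rank_fromBlocks_lower (∑ i, A i ⊗ₖ Y i) H (∑ i, A i ⊗ₖ X i)
  have hmax := hX _ Y'
  rw [Fintype.card_sum, Fintype.card_fin, hrank] at hmax
  -- The rank inequality comes multiplied by `d`; cancelling it needs `d > 0`.
  rcases Nat.eq_zero_or_pos d with rfl | hd
  · have hzero : ∀ y : Fin n × Fin 0 → ℂ, y = 0 := fun y => by ext ⟨_, b⟩; exact b.elim0
    refine ⟨by rw [hzero (Matrix.mulVec _ _)]; exact Submodule.zero_mem _, fun x' _ => ?_⟩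
    rw [hzero x']
    exact mem_reachable_of_ker (by simp)
  have hle : (Matrix.fromBlocks (∑ i, A i ⊗ₖ Y i) 0 H (∑ i, A i ⊗ₖ X i)).rank ≤
      (∑ i, A i ⊗ₖ Y i).rank + (∑ i, A i ⊗ₖ X i).rank := by
    refine Nat.le_of_mul_le_mul_right ?_ hd
    rw [Nat.add_mul, hr]
    linarith
  have hHz : H.mulVec z = (∑ i, A i ⊗ₖ Z i).mulVec
      (((1 : Matrix (Fin n) (Fin n) ℂ) ⊗ₖ Q).mulVec z) := by
    rw [Matrix.mulVec_mulVec]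
  refine ⟨hHz ▸ hrange hle z hz, fun x' hx' => ?_⟩
  -- The kernel vector is `(z, x')`, and `Q = (0 1)` extracts `x'`.
  refine ⟨κ ⊕ Fin d, inferInstance, Y', Matrix.fromCols 0 1, Sum.elim z x' ∘ e, ?_, ?_, ?_⟩
  · rw [hrank, le_antisymm hle hge, Fintype.card_sum, Fintype.card_fin, Nat.add_mul, hr]
    ring
  · rw [hsub, Matrix.submatrix_mulVec_equiv, Function.comp_assoc, Equiv.self_comp_symm,
      Function.comp_id, Matrix.fromBlocks_mulVec, Sum.elim_comp_inl, Sum.elim_comp_inr, hz, hHz,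
      hx']
    ext ⟨s, a | a⟩ <;> simp [e]
  · ext ⟨s, a⟩
    simp [Matrix.mulVec, dotProduct, Fintype.sum_prod_type, Matrix.one_apply, e,
      Finset.sum_ite_eq]

/-- For an element of maximal relative rank, the Wong sequence stays inside the range. -/
lemma wongSeq_le_range (hX : IsMaxRatio A X) (i : ℕ) :
    wongSeq (∑ i, A i ⊗ₖ X i) (blowUpSpace A d) i ≤
        LinearMap.range (∑ i, A i ⊗ₖ X i).mulVecLin ∧
      (wongSeq (∑ i, A i ⊗ₖ X i) (blowUpSpace A d) i).comap (∑ i, A i ⊗ₖ X i).mulVecLin ≤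
        Submodule.span ℂ (reachable A X) := by
  set B := ∑ i, A i ⊗ₖ X i with hB
  have hker : LinearMap.ker B.mulVecLin ≤ Submodule.span ℂ (reachable A X) := fun x hx =>
    Submodule.subset_span (mem_reachable_of_ker hx)
  -- The induction runs on `W_i ≤ B(span reachable)`. It implies both claims, since `ker B` is
  -- itself reachable.
  have key : ∀ W, W ≤ Submodule.map B.mulVecLin (Submodule.span ℂ (reachable A X)) →
      W ≤ LinearMap.range B.mulVecLin ∧
        W.comap B.mulVecLin ≤ Submodule.span ℂ (reachable A X) := by
    intro W hW
    refine ⟨hW.trans LinearMap.map_le_range, (Submodule.comap_mono hW).trans ?_⟩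
    rw [Submodule.comap_map_eq]
    exact sup_le le_rfl hker
  apply key
  induction i with
  | zero => exact bot_le
  | succ i ih =>
    refine (image_mono _ (key _ ih).2).trans ?_
    rw [blowUpSpace, image_span_span]
    refine Submodule.span_le.2 ?_
    rintro _ ⟨_, ⟨i, j, l, rfl⟩, x, hx, rfl⟩
    have hZ : ∀ c : ℂ, ∑ i', A i' ⊗ₖ (Pi.single i (c • Matrix.single j l (1 : ℂ)) :
        Fin p → Matrix (Fin d) (Fin d) ℂ) i' = c • (A i ⊗ₖ Matrix.single j l (1 : ℂ)) := by
      intro c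
      rw [Finset.sum_eq_single i]
      · rw [Pi.single_eq_same, Matrix.kronecker_smul]
      · intro i' _ hi'
        rw [Pi.single_eq_of_ne hi', Matrix.kronecker_zero]
      · simp
    -- The step lemma is used with both signs: the unit itself yields a preimage `x'`, and its
    -- negative shows that this `x'` is reachable, since there `B x'` must be minus the image.
    obtain ⟨x', hx'⟩ := (reachable_step hX hx
      (Pi.single i ((1 : ℂ) • Matrix.single j l (1 : ℂ)))).1
    rw [hZ, one_smul] at hx'
    refine ⟨x', Submodule.subset_span ?_, hx'⟩
    refine (reachable_step hX hx (Pi.single i ((-1 : ℂ) • Matrix.single j l (1 : ℂ)))).2 x' ?_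
    rw [hZ, ← hB, neg_one_smul, Matrix.neg_mulVec, neg_neg]
    exact hx'

end Rank

/-! ### The limit of the Wong sequence and the minimum shrunk subspace -/

section Wong

lemma finrank_map_add_finrank_inf_ker {V W : Type} [AddCommGroup V] [Module ℂ V]
    [FiniteDimensional ℂ V] [AddCommGroup W] [Module ℂ W] (f : V →ₗ[ℂ] W) (S : Submodule ℂ V) :
    Module.finrank ℂ (S.map f) + Module.finrank ℂ (S ⊓ LinearMap.ker f : Submodule ℂ V) =
      Module.finrank ℂ S := by
  have h := LinearMap.finrank_range_add_finrank_ker (f.domRestrict S)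
  rw [LinearMap.range_domRestrict, LinearMap.ker_domRestrict] at h
  rw [← h, ← Submodule.map_comap_subtype, Submodule.finrank_map_subtype_eq]

/-! ### Stationarity of Wong sequences in general -/

section General

variable {ι : Type} [Fintype ι] (B : Matrix ι ι ℂ)
  (𝒜 : Submodule ℂ (Matrix ι ι ℂ))

lemma wongSeq_le_succ (i : ℕ) : wongSeq B 𝒜 i ≤ wongSeq B 𝒜 (i + 1) := by
  induction i with
  | zero => exact bot_le
  | succ i ih => exact image_mono _ (Submodule.comap_mono ih)

lemma wongSeq_mono : Monotone (wongSeq B 𝒜) := monotone_nat_of_le_succ (wongSeq_le_succ B 𝒜)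

lemma wongSeq_stable {i : ℕ} (h : wongSeq B 𝒜 (i + 1) = wongSeq B 𝒜 i) (j : ℕ) :
    wongSeq B 𝒜 (i + j) = wongSeq B 𝒜 i := by
  induction j with
  | zero => rfl
  | succ j ih =>
    rw [← h, ← add_assoc]
    change image 𝒜 _ = image 𝒜 _
    rw [ih]

lemma wongLimit_eq_of_stable {i : ℕ} (h : wongSeq B 𝒜 (i + 1) = wongSeq B 𝒜 i) :
    wongLimit B 𝒜 = wongSeq B 𝒜 i := by
  refine le_antisymm (iSup_le fun j => ?_) (le_iSup (wongSeq B 𝒜) i)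
  rw [← wongSeq_stable B 𝒜 h j]
  exact wongSeq_mono B 𝒜 (by omega)

end General

variable {n d p : ℕ} (A : Fin p → Matrix (Fin n) (Fin n) ℂ)

lemma exists_wongSeq_eq_tensorSpace (B : Matrix (Fin n × Fin d) (Fin n × Fin d) ℂ) (i : ℕ) :
    ∃ V : Submodule ℂ (Fin n → ℂ), wongSeq B (blowUpSpace A d) i = tensorSpace V d := by
  cases i with
  | zero =>
    refine ⟨⊥, ((Submodule.eq_bot_iff _).2 fun v hv => ?_).symm⟩
    ext ⟨t, b⟩
    exact congrFun ((Submodule.mem_bot ℂ).1 (mem_tensorSpace.1 hv b)) t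
  | succ i => exact ⟨_, image_blowUpSpace A _⟩

/-- In `ℂⁿ ⊗ ℂ^d`, the Wong sequence of a blow-up space is stationary after `n` steps. -/
lemma wongSeq_succ_eq (B : Matrix (Fin n × Fin d) (Fin n × Fin d) ℂ) :
    wongSeq B (blowUpSpace A d) (n + 1) = wongSeq B (blowUpSpace A d) n := by
  choose V hV using exists_wongSeq_eq_tensorSpace A B
  rcases Nat.eq_zero_or_pos d with rfl | hd
  · refine le_antisymm (fun v _ => ?_) (wongSeq_le_succ _ _ _)
    have : v = 0 := by ext ⟨_, b⟩; exact b.elim0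
    rw [this]
    exact Submodule.zero_mem _
  -- Until the sequence becomes stationary, each step strictly enlarges `V_i ⊗ ℂ^d` and so raises
  -- `dim V_i` by at least one; dimension `n + 1` is impossible.
  have key : ∀ i, (∃ j < i, wongSeq B (blowUpSpace A d) (j + 1) = wongSeq B (blowUpSpace A d) j) ∨
      i ≤ Module.finrank ℂ (V i) := by
    intro i
    induction i with
    | zero => exact Or.inr (Nat.zero_le _)
    | succ i ih =>
      rcases ih with ⟨j, hj, h⟩ | ih
      · exact Or.inl ⟨j, by omega, h⟩
      by_cases h : wongSeq B (blowUpSpace A d) (i + 1) = wongSeq B (blowUpSpace A d) i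
      · exact Or.inl ⟨i, by omega, h⟩
      · right
        have hlt := lt_of_le_of_ne (wongSeq_le_succ B (blowUpSpace A d) i) (Ne.symm h)
        have := Submodule.finrank_lt_finrank_of_lt hlt
        rw [hV, hV, finrank_tensorSpace, finrank_tensorSpace] at this
        have := Nat.lt_of_mul_lt_mul_left this
        omega
  rcases key (n + 1) with ⟨j, hj, h⟩ | h
  · obtain ⟨m, rfl⟩ := Nat.exists_eq_add_of_le (Nat.lt_succ_iff.1 hj)
    rw [add_assoc, wongSeq_stable _ _ h, wongSeq_stable _ _ h]
  · have h2 := Submodule.finrank_le (V (n + 1))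
    rw [Module.finrank_fin_fun] at h2
    omega

lemma wongLimit_eq_wongSeq (B : Matrix (Fin n × Fin d) (Fin n × Fin d) ℂ) :
    wongLimit B (blowUpSpace A d) = wongSeq B (blowUpSpace A d) n :=
  wongLimit_eq_of_stable _ _ (wongSeq_succ_eq A B)

lemma map_tensorSpace_le (X : Fin p → Matrix (Fin d) (Fin d) ℂ) (U : Submodule ℂ (Fin n → ℂ)) :
    (tensorSpace U d).map (∑ i, A i ⊗ₖ X i).mulVecLin ≤
      tensorSpace (image (matrixSpace A) U) d := by
  rintro _ ⟨u, hu, rfl⟩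
  exact image_blowUpSpace_tensorSpace_le A U
    (mulVec_mem_image (sum_kronecker_mem_blowUpSpace A X) hu)

lemma finrank_le_card {ι : Type} [Fintype ι] (U : Submodule ℂ (ι → ℂ)) :
    Module.finrank ℂ U ≤ Fintype.card ι :=
  (Submodule.finrank_le U).trans (Module.finrank_fintype_fun_eq_card ℂ).le

lemma exists_ncrank_eq {ι : Type} [Fintype ι] (𝒜 : Submodule ℂ (Matrix ι ι ℂ)) :
    ∃ U : Submodule ℂ (ι → ℂ),
      ncrank 𝒜 = Fintype.card ι - Module.finrank ℂ U + Module.finrank ℂ (image 𝒜 U) :=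
  Nat.sInf_mem (s := {r | ∃ U : Submodule ℂ (ι → ℂ),
    r = Fintype.card ι - Module.finrank ℂ U + Module.finrank ℂ (image 𝒜 U)}) ⟨_, ⊥, rfl⟩

lemma ncrank_le {ι : Type} [Fintype ι] (𝒜 : Submodule ℂ (Matrix ι ι ℂ))
    (U : Submodule ℂ (ι → ℂ)) :
    ncrank 𝒜 ≤ Fintype.card ι - Module.finrank ℂ U + Module.finrank ℂ (image 𝒜 U) :=
  Nat.sInf_le ⟨U, rfl⟩

/-- For a minimising `U`, the element maps `U ⊗ ℂ^d` into `𝒜(U) ⊗ ℂ^d`, so its nullity is at least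
`d (dim U - dim 𝒜(U))`. -/
lemma rank_le_mul_ncrank (X : Fin p → Matrix (Fin d) (Fin d) ℂ) :
    (∑ i, A i ⊗ₖ X i).rank ≤ d * ncrank (matrixSpace A) := by
  obtain ⟨U, hU⟩ := exists_ncrank_eq (matrixSpace A)
  have h1 := finrank_map_add_finrank_inf_ker (∑ i, A i ⊗ₖ X i).mulVecLin (tensorSpace U d)
  have h2 := Submodule.finrank_mono (map_tensorSpace_le A X U)
  have h3 : Module.finrank ℂ (tensorSpace U d ⊓ LinearMap.ker (∑ i, A i ⊗ₖ X i).mulVecLin :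
      Submodule ℂ (Fin n × Fin d → ℂ)) ≤ _ := Submodule.finrank_mono inf_le_right
  have h4 := rank_add_finrank_ker (∑ i, A i ⊗ₖ X i)
  have h5 := finrank_le_card U
  rw [finrank_tensorSpace] at h1 h2
  rw [Fintype.card_prod, Fintype.card_fin, Fintype.card_fin] at h4
  rw [Fintype.card_fin] at hU h5
  rw [hU, mul_add, Nat.mul_sub]
  have h6 := Nat.mul_le_mul_left d h5
  have h7 : n * d = d * n := mul_comm _ _
  omega

/-- For an element `B` of maximal relative rank in a blow-up, `U* = B⁻¹(W_∞)` is a tensor product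
`U₀ ⊗ ℂ^d`, and `U₀` is the minimum `c`-shrunk subspace. -/
theorem comap_wongLimit {X : Fin p → Matrix (Fin d) (Fin d) ℂ} (hd : 0 < d)
    (hX : IsMaxRatio A X) {U₀ : Submodule ℂ (Fin n → ℂ)}
    (hU₀ : U₀ = blockSpan ((wongLimit (∑ i, A i ⊗ₖ X i) (blowUpSpace A d)).comap
      (∑ i, A i ⊗ₖ X i).mulVecLin : Set (Fin n × Fin d → ℂ))) :
    (wongLimit (∑ i, A i ⊗ₖ X i) (blowUpSpace A d)).comap (∑ i, A i ⊗ₖ X i).mulVecLin =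
        tensorSpace U₀ d ∧
      IsLeast {U | IsShrunk (matrixSpace A) (n - ncrank (matrixSpace A)) U} U₀ := by
  set B := ∑ i, A i ⊗ₖ X i with hB
  set W := wongLimit B (blowUpSpace A d) with hW
  have hWn : W = wongSeq B (blowUpSpace A d) n := wongLimit_eq_wongSeq A B
  have hrange : W ≤ LinearMap.range B.mulVecLin := hWn ▸ (wongSeq_le_range hX n).1
  have hfix : W = image (blowUpSpace A d) (W.comap B.mulVecLin) := by
    rw [hWn]
    exact (wongSeq_succ_eq A B).symm
  have hWt : W = tensorSpace (image (matrixSpace A) U₀) d := by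
    rw [hU₀, ← image_blowUpSpace]; exact hfix
  have hcomap : W.comap B.mulVecLin = tensorSpace U₀ d := by
    apply le_antisymm
    · rw [hU₀]; exact le_tensorSpace_blockSpan _
    · rw [← Submodule.map_le_iff_le_comap, hWt]
      exact map_tensorSpace_le A X U₀
  have hker : LinearMap.ker B.mulVecLin ≤ W.comap B.mulVecLin := fun x hx => by
    rw [Submodule.mem_comap, LinearMap.mem_ker.1 hx]; exact W.zero_mem
  have h1 := finrank_map_add_finrank_inf_ker B.mulVecLin (W.comap B.mulVecLin)
  rw [Submodule.map_comap_eq, inf_eq_right.2 hrange, inf_eq_right.2 hker, hcomap,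
    finrank_tensorSpace, hWt, finrank_tensorSpace] at h1
  have h2 := rank_add_finrank_ker B
  rw [Fintype.card_prod, Fintype.card_fin, Fintype.card_fin] at h2
  have h3 := rank_le_mul_ncrank A X
  rw [← hB] at h3
  have h4 := ncrank_le (matrixSpace A) U₀
  have h5 := finrank_le_card U₀
  rw [Fintype.card_fin] at h4 h5
  have h6 := Nat.mul_le_mul_left d h4
  rw [mul_add, Nat.mul_sub] at h6
  have h7 := Nat.mul_le_mul_left d h5
  have h8 : n * d = d * n := mul_comm _ _
  -- Testing `ncrank` on `U₀` gives `d · ncrank ≤ rk B`, the converse of `rank_le_mul_ncrank`. Thus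
  -- the nullity of `B` is exactly `d c`.
  have hc : d * (n - ncrank (matrixSpace A)) = Module.finrank ℂ (LinearMap.ker B.mulVecLin) := by
    rw [Nat.mul_sub]; omega
  refine ⟨hcomap, ?_, fun U hU => ?_⟩
  · rw [Set.mem_ofPred_eq, IsShrunk]
    refine Nat.le_of_mul_le_mul_left ?_ hd
    rw [mul_add, hc]
    omega
  · have hU' := Nat.mul_le_mul_left d (show _ + _ ≤ _ from hU)
    rw [mul_add, hc, ← finrank_tensorSpace, ← finrank_tensorSpace] at hU'
    have g1 := finrank_map_add_finrank_inf_ker B.mulVecLin (tensorSpace U d)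
    have g2 := Submodule.finrank_mono (map_tensorSpace_le A X U)
    have g3 : Module.finrank ℂ (tensorSpace U d ⊓ LinearMap.ker B.mulVecLin :
      Submodule ℂ (Fin n × Fin d → ℂ)) ≤ _ := Submodule.finrank_mono inf_le_right
    rw [← hB] at g2
    -- As `U` is `c`-shrunk, `dim (U ⊗ ℂ^d)` is at least `dim (𝒜(U) ⊗ ℂ^d)` plus the nullity of `B`.
    -- Rank-nullity on `U ⊗ ℂ^d` then makes both inclusions equalities: `B` maps onto `𝒜(U) ⊗ ℂ^d`,
    -- and `ker B` lies in `U ⊗ ℂ^d`.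
    have e1 : (tensorSpace U d).map B.mulVecLin = tensorSpace (image (matrixSpace A) U) d :=
      Submodule.eq_of_le_of_finrank_le (map_tensorSpace_le A X U) (by omega)
    have e2 : tensorSpace U d ⊓ LinearMap.ker B.mulVecLin = LinearMap.ker B.mulVecLin :=
      Submodule.eq_of_le_of_finrank_le inf_le_right (by omega)
    have e3 : (tensorSpace (image (matrixSpace A) U) d).comap B.mulVecLin = tensorSpace U d := by
      rw [← e1, Submodule.comap_map_eq, sup_eq_left]
      exact inf_eq_right.1 e2
    have hWi : ∀ i, wongSeq B (blowUpSpace A d) i ≤ tensorSpace (image (matrixSpace A) U) d := by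
      intro i
      induction i with
      | zero => exact bot_le
      | succ i ih =>
        refine (image_mono _ (Submodule.comap_mono ih)).trans ?_
        rw [e3]
        exact image_blowUpSpace_tensorSpace_le A U
    have hle : W.comap B.mulVecLin ≤ tensorSpace U d := by
      rw [← e3]
      exact Submodule.comap_mono (iSup_le hWi)
    rw [hU₀]
    refine Submodule.span_le.2 ?_
    rintro _ ⟨u, hu, b, rfl⟩
    exact mem_tensorSpace.1 (hle hu) b

end Wong

open Arith

/-! ### Values and costs of computations -/

section Cost

variable {K α β : Type}

@[simp] lemma pure_val (a : α) : (pure a : Arith K α).val = a := rfl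
@[simp] lemma pure_ops (a : α) : (pure a : Arith K α).ops = 0 := rfl
@[simp] lemma pure_nums (a : α) : (pure a : Arith K α).nums = ∅ := rfl
@[simp] lemma pure_scratch (a : α) : (pure a : Arith K α).scratch = ∅ := rfl

variable (x : Arith K α) (f : α → Arith K β)

@[simp] lemma bind_val : (x >>= f).val = (f x.val).val := rfl
@[simp] lemma bind_ops : (x >>= f).ops = x.ops + (f x.val).ops := rfl
@[simp] lemma bind_nums : (x >>= f).nums = x.nums ∪ (f x.val).nums := rfl
@[simp] lemma bind_scratch : (x >>= f).scratch = x.scratch ∪ (f x.val).scratch := rfl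

variable {ι : Type} [Fintype ι] (g : ι → Arith K α)

@[simp] lemma vec_val : (vec g).val = fun i => (g i).val := rfl
@[simp] lemma vec_ops : (vec g).ops = ∑ i, (g i).ops := rfl
@[simp] lemma vec_nums : (vec g).nums = ⋃ i, (g i).nums := rfl
@[simp] lemma vec_scratch : (vec g).scratch = ⋃ i, (g i).scratch := rfl

@[simp] lemma asScratch_val : (asScratch x).val = x.val := rfl
@[simp] lemma asScratch_ops : (asScratch x).ops = x.ops := rfl
@[simp] lemma asScratch_nums : (asScratch x).nums = ∅ := rfl
@[simp] lemma asScratch_scratch : (asScratch x).scratch = x.nums ∪ x.scratch := rfl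

lemma mapList_val (f : β → Arith K α) (l : List β) :
    (mapList f l).val = l.map fun b => (f b).val := by
  induction l with
  | nil => rfl
  | cons b bs ih => simp [mapList, ih]

lemma mapList_ops (f : β → Arith K α) (l : List β) :
    (mapList f l).ops = (l.map fun b => (f b).ops).sum := by
  induction l with
  | nil => rfl
  | cons b bs ih => simp [mapList, ih]

lemma mem_mapList_nums {f : β → Arith K α} {l : List β} {z : K} :
    z ∈ (mapList f l).nums ↔ ∃ b ∈ l, z ∈ (f b).nums := by
  induction l with
  | nil => simp [mapList]
  | cons b bs ih => simp [mapList, ih]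

lemma mem_mapList_scratch {f : β → Arith K α} {l : List β} {z : K} :
    z ∈ (mapList f l).scratch ↔ ∃ b ∈ l, z ∈ (f b).scratch := by
  induction l with
  | nil => simp [mapList]
  | cons b bs ih => simp [mapList, ih]

variable [Field K]

@[simp] lemma add_val (x y : K) : (add x y).val = x + y := rfl
@[simp] lemma sub_val (x y : K) : (sub x y).val = x - y := rfl
@[simp] lemma mul_val (x y : K) : (mul x y).val = x * y := rfl
@[simp] lemma div_val (x y : K) : (div x y).val = x / y := rfl
@[simp] lemma add_ops (x y : K) : (add x y).ops = 2 := rfl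
@[simp] lemma sub_ops (x y : K) : (sub x y).ops = 2 := rfl
@[simp] lemma mul_ops (x y : K) : (mul x y).ops = 6 := rfl
@[simp] lemma div_ops (x y : K) : (div x y).ops = 11 := rfl
@[simp] lemma add_nums (x y : K) : (add x y).nums = {x + y} := rfl
@[simp] lemma sub_nums (x y : K) : (sub x y).nums = {x - y} := rfl
@[simp] lemma mul_nums (x y : K) : (mul x y).nums = {x * y} := rfl
@[simp] lemma div_nums (x y : K) : (div x y).nums = {x / y} := rfl
@[simp] lemma add_scratch (x y : K) : (add x y).scratch = ∅ := rfl
@[simp] lemma sub_scratch (x y : K) : (sub x y).scratch = ∅ := rfl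
@[simp] lemma mul_scratch (x y : K) : (mul x y).scratch = ∅ := rfl
@[simp] lemma div_scratch (x y : K) : (div x y).scratch = ∅ := rfl

lemma dot_val {m : ℕ} (x y : Fin m → K) : (dot x y).val = ∑ i, x i * y i := by
  have : ∀ l : List (Fin m), (sumList (l.map fun i => mul (x i) (y i))).val =
      (l.map fun i => x i * y i).sum := by
    intro l
    induction l with
    | nil => rfl
    | cons i l ih => simp [sumList, ih]
  rw [dot, this, ← List.ofFn_eq_map, List.sum_ofFn]

/-- Each term costs a multiplication (6) and an addition (2); the innermost addition is to `0`. -/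
lemma dot_ops {m : ℕ} (x y : Fin m → K) : (dot x y).ops = 8 * m := by
  have : ∀ l : List (Fin m), (sumList (l.map fun i => mul (x i) (y i))).ops = 8 * l.length := by
    intro l
    induction l with
    | nil => rfl
    | cons i l ih => simp [sumList, ih]; ring
  rw [dot, this, List.length_finRange]

lemma dot_scratch {m : ℕ} (x y : Fin m → K) : (dot x y).scratch = ∅ := by
  have : ∀ l : List (Fin m), (sumList (l.map fun i => mul (x i) (y i))).scratch = ∅ := by
    intro l
    induction l with
    | nil => rfl
    | cons i l ih => simp [sumList, ih]
  exact this _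

variable [DecidableEq K]

@[simp] lemma isZero_val (x : K) : (isZero x).val = decide (x = 0) := rfl
@[simp] lemma isZero_ops (x : K) : (isZero x).ops = 2 := rfl
@[simp] lemma isZero_nums (x : K) : (isZero x).nums = ∅ := rfl
@[simp] lemma isZero_scratch (x : K) : (isZero x).scratch = ∅ := rfl

lemma findPivot_cons_of_zero {τ : Type} {v : τ → K} {t : τ} (h : v t = 0) (l : List τ) :
    findPivot v (t :: l) = (isZero (v t) >>= fun _ => findPivot v l) := by
  simp only [findPivot]
  change (⟨_, _, _, _⟩ : Arith K (Option τ)) = ⟨_, _, _, _⟩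
  simp [h]

lemma findPivot_cons_of_ne_zero {τ : Type} {v : τ → K} {t : τ} (h : v t ≠ 0) (l : List τ) :
    findPivot v (t :: l) = (isZero (v t) >>= fun _ => pure (some t)) := by
  simp only [findPivot]
  change (⟨_, _, _, _⟩ : Arith K (Option τ)) = ⟨_, _, _, _⟩
  simp [h]

lemma findPivot_ops_le {τ : Type} (v : τ → K) (l : List τ) :
    (findPivot v l).ops ≤ 2 * l.length := by
  induction l with
  | nil => simp [findPivot]
  | cons t l ih =>
    by_cases h : v t = 0
    · rw [findPivot_cons_of_zero h, bind_ops, isZero_ops, List.length_cons]; omega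
    · rw [findPivot_cons_of_ne_zero h, bind_ops, isZero_ops, pure_ops, List.length_cons]; omega

lemma findPivot_nums {τ : Type} (v : τ → K) (l : List τ) : (findPivot v l).nums = ∅ := by
  induction l with
  | nil => rfl
  | cons t l ih =>
    by_cases h : v t = 0
    · simp [findPivot_cons_of_zero h, ih]
    · simp [findPivot_cons_of_ne_zero h]

lemma findPivot_scratch {τ : Type} (v : τ → K) (l : List τ) : (findPivot v l).scratch = ∅ := by
  induction l with
  | nil => rfl
  | cons t l ih =>
    by_cases h : v t = 0
    · simp [findPivot_cons_of_zero h, ih]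
    · simp [findPivot_cons_of_ne_zero h]

lemma findPivot_eq_none {τ : Type} {v : τ → K} {l : List τ} (h : (findPivot v l).val = none) :
    ∀ t ∈ l, v t = 0 := by
  induction l with
  | nil => simp
  | cons s l ih =>
    by_cases h0 : v s = 0
    · rw [findPivot_cons_of_zero h0] at h
      intro t ht
      rcases List.mem_cons.1 ht with rfl | ht
      · exact h0
      · exact ih h t ht
    · simp [findPivot_cons_of_ne_zero h0] at h

lemma findPivot_eq_some {τ : Type} {v : τ → K} {l : List τ} {t : τ}
    (h : (findPivot v l).val = some t) : t ∈ l ∧ v t ≠ 0 := by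
  induction l with
  | nil => simp [findPivot] at h
  | cons s l ih =>
    by_cases h0 : v s = 0
    · rw [findPivot_cons_of_zero h0] at h
      exact ⟨List.mem_cons_of_mem _ (ih h).1, (ih h).2⟩
    · rw [findPivot_cons_of_ne_zero h0] at h
      simp only [bind_val, pure_val, Option.some.injEq] at h
      subst h
      exact ⟨List.mem_cons_self, h0⟩

end Cost

/-! ### Reduction against an echelon form -/

section Reduce

variable {τ : Type} [Fintype τ]

/-- The last pivot entry (and `prev`, if there is no pivot). -/
def lastPivot {τ K : Type} : K → List (Pivot τ K) → K
  | prev, [] => prev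
  | _, P :: Ps => lastPivot (P.row P.loc) Ps

lemma lastPivot_concat {τ K : Type} (prev : K) (ps : List (Pivot τ K)) (P : Pivot τ K) :
    lastPivot prev (ps ++ [P]) = P.row P.loc := by
  induction ps generalizing prev with
  | nil => rfl
  | cons Q ps ih => exact ih _

/-- `reduce` consumes pivots from the front, whereas echelon forms grow at the back; this exposes
the last elimination step. -/
lemma reduce_concat_val (prev : ℂ) (ps : List (Pivot τ ℂ)) (P : Pivot τ ℂ) (v : τ → ℂ) :
    (reduce prev (ps ++ [P]) v).val = fun t =>
      (P.row P.loc * (reduce prev ps v).val t - (reduce prev ps v).val P.loc * P.row t) /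
        lastPivot prev ps := by
  induction ps generalizing prev v with
  | nil => simp [reduce, lastPivot]
  | cons Q ps ih => simp only [List.cons_append, reduce, bind_val, ih, lastPivot]

lemma mem_reduce_concat_nums {prev : ℂ} {ps : List (Pivot τ ℂ)} {P : Pivot τ ℂ} {v : τ → ℂ}
    {z : ℂ} (hz : z ∈ (reduce prev (ps ++ [P]) v).nums) :
    z ∈ (reduce prev ps v).nums ∨ ∃ t,
      z = P.row P.loc * (reduce prev ps v).val t ∨
      z = (reduce prev ps v).val P.loc * P.row t ∨
      z = P.row P.loc * (reduce prev ps v).val t - (reduce prev ps v).val P.loc * P.row t ∨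
      z = (reduce prev (ps ++ [P]) v).val t := by
  induction ps generalizing prev v with
  | nil =>
    simp only [List.nil_append, reduce, bind_nums, vec_nums, mul_nums, mul_val, sub_nums, sub_val,
      div_nums, pure_nums, Set.union_empty, Set.mem_iUnion, Set.mem_union,
      Set.mem_singleton_iff] at hz
    obtain ⟨t, h⟩ := hz
    refine Or.inr ⟨t, ?_⟩
    simpa [reduce] using h
  | cons Q ps ih =>
    simp only [List.cons_append, reduce, bind_nums] at hz ⊢
    rcases hz with hz | hz
    · exact Or.inl (Or.inl hz)
    · rcases ih hz with h | h
      · exact Or.inl (Or.inr h)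
      · exact Or.inr h

/-- Per coordinate and pivot: two multiplications, a subtraction and a division, `6 + 6 + 2 + 11 =
25`. -/
lemma reduce_ops (prev : ℂ) (ps : List (Pivot τ ℂ)) (v : τ → ℂ) :
    (reduce prev ps v).ops = 25 * Fintype.card τ * ps.length := by
  induction ps generalizing prev v with
  | nil => rfl
  | cons Q ps ih =>
    simp only [reduce, bind_ops, vec_ops, mul_ops, sub_ops, div_ops, ih, Finset.sum_const,
      Finset.card_univ, smul_eq_mul, List.length_cons]
    ring

lemma reduce_scratch (prev : ℂ) (ps : List (Pivot τ ℂ)) (v : τ → ℂ) :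
    (reduce prev ps v).scratch = ∅ := by
  induction ps generalizing prev v with
  | nil => rfl
  | cons Q ps ih => simp [reduce, ih]

/-- `ps` is the echelon form of the vectors `rows`, computed by reducing them one after the other. -/
inductive Echelon : List (τ → ℂ) → List (Pivot τ ℂ) → Prop
  | nil : Echelon [] []
  | concat {rows : List (τ → ℂ)} {ps : List (Pivot τ ℂ)} {v : τ → ℂ} {t : τ} :
      Echelon rows ps → (reduce 1 ps v).val t ≠ 0 →
      Echelon (rows ++ [v]) (ps ++ [⟨t, (reduce 1 ps v).val⟩])

lemma listSpan_concat {ι : Type} (l : List (ι → ℂ)) (v : ι → ℂ) :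
    listSpan (l ++ [v]) = listSpan l ⊔ Submodule.span ℂ {v} := by
  rw [listSpan, listSpan, ← Submodule.span_union]
  congr 1
  ext x
  simp [or_comm]

lemma listSpan_append {ι : Type} (l l' : List (ι → ℂ)) :
    listSpan (l ++ l') = listSpan l ⊔ listSpan l' := by
  rw [listSpan, listSpan, listSpan, ← Submodule.span_union]
  congr 1
  ext x
  simp

lemma mem_listSpan {ι : Type} {l : List (ι → ℂ)} {v : ι → ℂ} (h : v ∈ l) : v ∈ listSpan l :=
  Submodule.subset_span h

lemma listSpan_le {ι : Type} {l : List (ι → ℂ)} {S : Submodule ℂ (ι → ℂ)} :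
    listSpan l ≤ S ↔ ∀ v ∈ l, v ∈ S := Submodule.span_le

@[simp] lemma listSpan_nil {ι : Type} : listSpan ([] : List (ι → ℂ)) = ⊥ := by
  simp [listSpan]

namespace Echelon

variable {rows : List (τ → ℂ)} {ps : List (Pivot τ ℂ)}

lemma length_eq (h : Echelon rows ps) : rows.length = ps.length := by
  induction h with
  | nil => rfl
  | concat _ _ ih => simp [ih]

lemma lastPivot_ne_zero (h : Echelon rows ps) : lastPivot 1 ps ≠ 0 := by
  cases h with
  | nil => exact one_ne_zero
  | concat _ h => rwa [lastPivot_concat]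

/-- Reducing `v` yields `δ v`, up to a combination of the rows. -/
lemma reduce_sub_mem (h : Echelon rows ps) (v : τ → ℂ) :
    (reduce 1 ps v).val - lastPivot 1 ps • v ∈ listSpan rows := by
  induction h generalizing v with
  | nil => simp [reduce, lastPivot]
  | @concat rows ps w t h ht ih =>
    set δ := lastPivot 1 ps with hδ
    have hδ0 : δ ≠ 0 := h.lastPivot_ne_zero
    have hle : listSpan rows ≤ listSpan (rows ++ [w]) := by
      rw [listSpan_concat]; exact le_sup_left
    have hw : w ∈ listSpan (rows ++ [w]) := mem_listSpan (by simp)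
    set r := (reduce 1 ps w).val
    set v' := (reduce 1 ps v).val
    have h1 := hle (ih v)
    have h2 := hle (ih w)
    -- Replacing `v'` and `r` by their differences from `δ v` and `δ w` cancels the division by `δ`;
    -- the multiple of `w` that remains is a row of the extended list.
    have e : (reduce 1 (ps ++ [⟨t, r⟩]) v).val - lastPivot 1 (ps ++ [⟨t, r⟩]) • v =
        (δ⁻¹ * r t) • (v' - δ • v) - (δ⁻¹ * v' t) • (r - δ • w) - v' t • w := by
      rw [reduce_concat_val, lastPivot_concat]
      ext s
      simp only [Pi.sub_apply, Pi.smul_apply, smul_eq_mul, ← hδ]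
      field_simp
      ring
    rw [e]
    exact Submodule.sub_mem _ (Submodule.sub_mem _ (Submodule.smul_mem _ _ h1)
      (Submodule.smul_mem _ _ h2)) (Submodule.smul_mem _ _ hw)

/-- The last step clears the newest pivot coordinate and keeps the earlier zeros, as both vectors
being combined vanish there. -/
lemma reduce_loc (h : Echelon rows ps) (v : τ → ℂ) {P : Pivot τ ℂ} (hP : P ∈ ps) :
    (reduce 1 ps v).val P.loc = 0 := by
  induction h generalizing v with
  | nil => simp at hP
  | @concat rows ps w t h ht ih =>
    rw [reduce_concat_val]
    rcases List.mem_append.1 hP with hP | hP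
    · simp [ih v hP, ih w hP]
    · rw [List.mem_singleton] at hP
      subst hP
      simp only
      rw [mul_comm, sub_self, zero_div]

lemma nodup_locs (h : Echelon rows ps) : (ps.map Pivot.loc).Nodup := by
  induction h with
  | nil => simp
  | @concat rows ps w t h ht ih =>
    rw [List.map_append, List.map_singleton, List.nodup_append]
    refine ⟨ih, by simp, ?_⟩
    rintro _ ha b hb rfl
    obtain ⟨P, hP, rfl⟩ := List.mem_map.1 ha
    rw [List.mem_singleton] at hb
    simp only at hb
    exact ht (hb ▸ h.reduce_loc w hP)

end Echelon

/-! ### Bareiss's identity -/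

section Minor

variable {κ : Type} [Fintype κ] [DecidableEq κ]

/-- The minor with rows `ρ` and columns `c`, bordered by the row `v` and the column `t`. -/
noncomputable def borderedMinor (ρ : κ → τ → ℂ) (c : κ → τ) (v : τ → ℂ) (t : τ) : ℂ :=
  Matrix.det (Matrix.of fun i j : κ ⊕ Unit =>
    (Sum.elim ρ (fun _ => v) i) (Sum.elim c (fun _ => t) j))

omit [Fintype τ] in
-- No induction over the elimination is needed: `v'` is determined by `v' ≡ δ v` modulo the rows and
-- its zeros at the pivot columns. Multiplying the bordered matrix on the left by `T`, whose last
-- row is `(a, δ)`, turns its last row into `(0, v' t)`. Taking determinants gives `δ · minor = δ ·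
-- v' t`.
lemma borderedMinor_eq {ρ : κ → τ → ℂ} {c : κ → τ} {δ : ℂ}
    (hδ : δ = Matrix.det (Matrix.of fun i j => ρ i (c j))) (hδ0 : δ ≠ 0) {v v' : τ → ℂ}
    (hv : v' - δ • v ∈ Submodule.span ℂ (Set.range ρ)) (hc : ∀ j, v' (c j) = 0) (t : τ) :
    v' t = borderedMinor ρ c v t := by
  obtain ⟨a, ha⟩ := (Submodule.mem_span_range_iff_exists_fun ℂ).1 hv
  have hva : ∀ s, v' s = δ * v s + ∑ i, a i * ρ i s := by
    intro s
    have := congrFun ha s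
    simp only [Finset.sum_apply, Pi.smul_apply, Pi.sub_apply, smul_eq_mul] at this
    rw [this]; ring
  let M : Matrix κ κ ℂ := Matrix.of fun i j => ρ i (c j)
  let N : Matrix (κ ⊕ Unit) (κ ⊕ Unit) ℂ := Matrix.of fun i j =>
    (Sum.elim ρ (fun _ => v) i) (Sum.elim c (fun _ => t) j)
  let T : Matrix (κ ⊕ Unit) (κ ⊕ Unit) ℂ :=
    Matrix.fromBlocks 1 0 (Matrix.of fun _ j => a j) (Matrix.of fun _ _ => δ)
  have hTN : T * N = Matrix.fromBlocks M (Matrix.of fun i _ => ρ i t) 0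
      (Matrix.of fun _ _ => v' t) := by
    have hN : N = Matrix.fromBlocks M (Matrix.of fun i _ => ρ i t)
        (Matrix.of fun _ j => v (c j)) (Matrix.of fun _ _ => v t) := by
      ext (i | i) (j | j) <;> rfl
    rw [hN, Matrix.fromBlocks_multiply]
    congr 1
    · simp
    · simp
    · ext i j
      have := hva (c j)
      rw [hc] at this
      simp only [Matrix.add_apply, Matrix.mul_apply, Matrix.of_apply, Finset.univ_unique,
        Finset.sum_singleton, Matrix.zero_apply, M]
      rw [this]; ring
    · ext i j
      simp only [Matrix.add_apply, Matrix.mul_apply, Matrix.of_apply, Finset.univ_unique,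
        Finset.sum_singleton]
      rw [hva t]; ring
  have hdet := congrArg Matrix.det hTN
  rw [Matrix.det_mul, Matrix.det_fromBlocks_zero₁₂, Matrix.det_fromBlocks_zero₂₁, Matrix.det_one,
    one_mul, Matrix.det_unique (n := Unit), Matrix.det_unique (n := Unit), Matrix.of_apply,
    Matrix.of_apply] at hdet
  have : δ * N.det = δ * v' t := by rw [hdet, hδ]
  exact (mul_left_cancel₀ hδ0 this).symm

end Minor

/-- The entries of reduced vectors are minors of the original vectors. -/
lemma Echelon.exists_minor {rows : List (τ → ℂ)} {ps : List (Pivot τ ℂ)} (h : Echelon rows ps) :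
    ∃ (κ : Type) (_ : Fintype κ) (_ : DecidableEq κ) (ρ : κ → τ → ℂ) (c : κ → τ),
      Fintype.card κ = ps.length ∧ (∀ i, ρ i ∈ rows) ∧
      listSpan rows = Submodule.span ℂ (Set.range ρ) ∧ (∀ i, ∃ P ∈ ps, P.loc = c i) ∧
      (∀ P ∈ ps, ∃ i, c i = P.loc) ∧
      lastPivot 1 ps = Matrix.det (Matrix.of fun i j => ρ i (c j)) := by
  induction h with
  | nil =>
    refine ⟨Empty, inferInstance, inferInstance, Empty.elim, Empty.elim, ?_⟩
    simp [lastPivot, Set.range_eq_empty]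
  | @concat rows ps w t h ht ih =>
    obtain ⟨κ, _, _, ρ, c, hcard, hρ, hspan, hc, hc', hdet⟩ := ih
    refine ⟨κ ⊕ Unit, inferInstance, inferInstance, Sum.elim ρ fun _ => w, Sum.elim c fun _ => t,
      ?_, ?_, ?_, ?_, ?_, ?_⟩
    · simp [hcard]
    · rintro (i | i)
      · exact List.mem_append_left _ (hρ i)
      · simp
    · rw [listSpan_concat, hspan, Set.Sum.elim_range, Set.range_const, Submodule.span_union]
    · rintro (i | i)
      · obtain ⟨P, hP, e⟩ := hc i
        exact ⟨P, List.mem_append_left _ hP, e⟩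
      · exact ⟨_, List.mem_append_right _ (List.mem_singleton_self _), rfl⟩
    · intro P hP
      rcases List.mem_append.1 hP with hP | hP
      · obtain ⟨i, e⟩ := hc' P hP
        exact ⟨Sum.inl i, e⟩
      · rw [List.mem_singleton] at hP
        subst hP
        exact ⟨Sum.inr (), rfl⟩
    -- Bordering by the new row and its own pivot coordinate gives the pivot minor of the extended
    -- list.
    · rw [lastPivot_concat]
      refine borderedMinor_eq hdet h.lastPivot_ne_zero (hspan ▸ h.reduce_sub_mem w) ?_ t
      intro j
      obtain ⟨P, hP, e⟩ := hc j
      rw [← e]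
      exact h.reduce_loc w hP

/-- A combination of the rows that vanishes at all pivot coordinates is zero. -/
lemma Echelon.eq_zero_of_loc {rows : List (τ → ℂ)} {ps : List (Pivot τ ℂ)} (h : Echelon rows ps)
    {v : τ → ℂ} (hv : v ∈ listSpan rows) (hloc : ∀ P ∈ ps, v P.loc = 0) : v = 0 := by
  obtain ⟨κ, _, _, ρ, c, -, -, hspan, hc, -, hdet⟩ := h.exists_minor
  rw [hspan] at hv
  obtain ⟨a, rfl⟩ := (Submodule.mem_span_range_iff_exists_fun ℂ).1 hv
  have h0 : Matrix.vecMul a (Matrix.of fun i j => ρ i (c j)) = 0 := by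
    ext j
    obtain ⟨P, hP, e⟩ := hc j
    have := hloc P hP
    rw [e] at this
    simpa [Matrix.vecMul, dotProduct, Finset.sum_apply] using this
  have ha : a = 0 := Matrix.eq_zero_of_vecMul_eq_zero (hdet ▸ h.lastPivot_ne_zero) h0
  simp [ha]

/-- The reduced vector stays in the span and vanishes at all pivots. With
`Echelon.mem_of_reduce_eq_zero`, reduction to zero is an exact test of linear dependence. -/
lemma Echelon.reduce_eq_zero {rows : List (τ → ℂ)} {ps : List (Pivot τ ℂ)} (h : Echelon rows ps)
    {v : τ → ℂ} (hv : v ∈ listSpan rows) : (reduce 1 ps v).val = 0 := by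
  refine h.eq_zero_of_loc ?_ fun P hP => h.reduce_loc v hP
  rw [← sub_add_cancel (reduce 1 ps v).val (lastPivot 1 ps • v)]
  exact Submodule.add_mem _ (h.reduce_sub_mem v) (Submodule.smul_mem _ _ hv)

lemma Echelon.mem_of_reduce_eq_zero {rows : List (τ → ℂ)} {ps : List (Pivot τ ℂ)}
    (h : Echelon rows ps) {v : τ → ℂ} (hv : (reduce 1 ps v).val = 0) : v ∈ listSpan rows := by
  have := h.reduce_sub_mem v
  rw [hv, zero_sub, ← neg_smul] at this
  exact (Submodule.smul_mem_iff _ (neg_ne_zero.2 h.lastPivot_ne_zero)).1 this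

lemma listIndep_concat {ι : Type} {l : List (ι → ℂ)} {v : ι → ℂ} (hl : ListIndep l)
    (hv : v ∉ listSpan l) : ListIndep (l ++ [v]) := by
  have hr : Set.range (fun i : Fin l.length => l.get i) = {x | x ∈ l} := by
    ext x; simp [List.mem_iff_get]
  have h : LinearIndependent ℂ (Fin.snoc (α := fun _ => ι → ℂ)
      (fun i : Fin l.length => l.get i) v) := by
    rw [linearIndependent_finSnoc]
    exact ⟨hl, by rw [hr]; exact hv⟩
  have hlen : (l ++ [v]).length = l.length + 1 := by simp
  have := h.comp (Fin.cast hlen) (Fin.cast_injective _)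
  rw [ListIndep]
  convert! this using 1
  ext1 i
  obtain ⟨i, hi⟩ := i
  simp only [Function.comp_apply, Fin.cast_mk, List.get_eq_getElem, Fin.snoc]
  split_ifs with h'
  · simp [List.getElem_append_left h']
  · have : i = l.length := by omega
    subst this
    simp

lemma listIndep_nil {ι : Type} : ListIndep ([] : List (ι → ℂ)) := by
  unfold ListIndep
  exact linearIndependent_empty_type (ι := Fin 0)

lemma Echelon.listIndep {rows : List (τ → ℂ)} {ps : List (Pivot τ ℂ)} (h : Echelon rows ps) :
    ListIndep rows := by
  induction h with
  | nil => exact listIndep_nil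
  | @concat rows ps w t h ht ih =>
    refine listIndep_concat ih fun hw => ht ?_
    rw [h.reduce_eq_zero hw]; rfl

end Reduce

/-! ### Selection of a basis -/

section ListRank

variable {ι : Type} [Fintype ι]

omit [Fintype ι] in
lemma setOf_mem_eq_range_get (l : List (ι → ℂ)) :
    {v | v ∈ l} = Set.range (fun i : Fin l.length => l.get i) := by
  ext x; simp [List.mem_iff_get]

omit [Fintype ι] in
-- Reduces independence of the kernel, tensor and preimage bases to dimension counts.
lemma listIndep_iff_length_le {l : List (ι → ℂ)} :
    ListIndep l ↔ l.length ≤ Module.finrank ℂ (listSpan l) := by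
  rw [ListIndep, linearIndependent_iff_card_le_finrank_span, Fintype.card_fin, Set.finrank,
    listSpan, setOf_mem_eq_range_get]

omit [Fintype ι] in
lemma finrank_listSpan_le (l : List (ι → ℂ)) :
    Module.finrank ℂ (listSpan l) ≤ l.length := by
  have h := finrank_range_le_card (R := ℂ) (fun i : Fin l.length => l.get i)
  rwa [Fintype.card_fin, Set.finrank, ← setOf_mem_eq_range_get] at h

omit [Fintype ι] in
lemma ListIndep.finrank_eq {l : List (ι → ℂ)} (h : ListIndep l) :
    Module.finrank ℂ (listSpan l) = l.length :=
  le_antisymm (finrank_listSpan_le l) (listIndep_iff_length_le.1 h)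

lemma ListIndep.length_le {l : List (ι → ℂ)} (h : ListIndep l) : l.length ≤ Fintype.card ι := by
  rw [← h.finrank_eq]; exact finrank_le_card _

end ListRank

section Select

variable {n : ℕ}

/-- Both outcomes of the pivot search are packed into one successor state `S'`, so that the
inductions for correctness and for cost share the case distinction. -/
lemma select_cons (c : Arith ℂ (Fin n → ℂ)) (cs : List (Arith ℂ (Fin n → ℂ)))
    (S : Selection n ℂ) :
    ∃ S', (((reduce 1 S.tableau c.val).val = 0 ∧ S' = S) ∨
        ∃ t, (reduce 1 S.tableau c.val).val t ≠ 0 ∧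
          S' = ⟨S.tableau ++ [⟨t, (reduce 1 S.tableau c.val).val⟩], S.basis ++ [c.val]⟩) ∧
      (select (c :: cs) S).val = (select cs S').val ∧
      (select (c :: cs) S).ops ≤
        c.ops + (25 * n * S.tableau.length + 2 * n) + (select cs S').ops ∧
      (select (c :: cs) S).nums = c.nums ∪ (select cs S').nums ∧
      (select (c :: cs) S).scratch =
        c.scratch ∪ ((reduce 1 S.tableau c.val).nums ∪ (select cs S').scratch) := by
  have hops := findPivot_ops_le (reduce 1 S.tableau c.val).val (List.finRange n)
  rw [List.length_finRange] at hops
  have hred := reduce_ops 1 S.tableau c.val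
  rw [Fintype.card_fin] at hred
  cases h : (findPivot (reduce 1 S.tableau c.val).val (List.finRange n)).val with
  | none =>
    refine ⟨S, Or.inl ⟨?_, rfl⟩, ?_⟩
    · ext t
      exact findPivot_eq_none h t (List.mem_finRange t)
    · simp only [select, bind_val, asScratch_val, h, bind_ops, asScratch_ops, bind_nums,
        asScratch_nums, findPivot_nums, bind_scratch, asScratch_scratch, findPivot_scratch,
        reduce_scratch, Set.empty_union, Set.union_empty, true_and, and_true]
      omega
  | some t =>
    refine ⟨_, Or.inr ⟨t, (findPivot_eq_some h).2, rfl⟩, ?_⟩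
    simp only [select, bind_val, asScratch_val, h, bind_ops, asScratch_ops, bind_nums,
      asScratch_nums, findPivot_nums, bind_scratch, asScratch_scratch, findPivot_scratch,
      reduce_scratch, Set.empty_union, Set.union_empty, true_and, and_true]
    omega

lemma Echelon.select_step {S S' : Selection n ℂ} {w : Fin n → ℂ}
    (hS : Echelon S.basis S.tableau)
    (h : ((reduce 1 S.tableau w).val = 0 ∧ S' = S) ∨
        ∃ t, (reduce 1 S.tableau w).val t ≠ 0 ∧
          S' = ⟨S.tableau ++ [⟨t, (reduce 1 S.tableau w).val⟩], S.basis ++ [w]⟩) :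
    Echelon S'.basis S'.tableau ∧ (S'.basis = S.basis ∨ S'.basis = S.basis ++ [w]) ∧
      listSpan S'.basis = listSpan S.basis ⊔ Submodule.span ℂ {w} := by
  rcases h with ⟨h, rfl⟩ | ⟨t, ht, rfl⟩
  · refine ⟨hS, Or.inl rfl, (sup_eq_left.2 ?_).symm⟩
    rw [Submodule.span_singleton_le_iff_mem]
    exact hS.mem_of_reduce_eq_zero h
  · exact ⟨hS.concat ht, Or.inr rfl, listSpan_concat _ _⟩

lemma select_correct (cs : List (Arith ℂ (Fin n → ℂ))) (S : Selection n ℂ)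
    (hS : Echelon S.basis S.tableau) :
    Echelon (select cs S).val.basis (select cs S).val.tableau ∧
      (∃ new, (select cs S).val.basis = S.basis ++ new ∧ ∀ w ∈ new, ∃ c ∈ cs, w = c.val) ∧
      listSpan (select cs S).val.basis =
        listSpan S.basis ⊔ Submodule.span ℂ {v | ∃ c ∈ cs, v = c.val} := by
  induction cs generalizing S with
  | nil => exact ⟨hS, ⟨[], by simp [select]⟩, by simp [select]⟩
  | cons c cs ih =>
    obtain ⟨S', hS', hval, -⟩ := select_cons c cs S
    obtain ⟨h1, h2, h3⟩ := hS.select_step hS'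
    obtain ⟨i1, ⟨new, i2, i3⟩, i4⟩ := ih S' h1
    rw [hval]
    refine ⟨i1, ?_, ?_⟩
    · rcases h2 with h2 | h2
      · refine ⟨new, by rw [i2, h2], fun w hw => ?_⟩
        obtain ⟨c', hc', e⟩ := i3 w hw
        exact ⟨c', List.mem_cons_of_mem _ hc', e⟩
      · refine ⟨c.val :: new, by rw [i2, h2]; simp, fun w hw => ?_⟩
        rcases List.mem_cons.1 hw with rfl | hw
        · exact ⟨c, List.mem_cons_self, rfl⟩
        · obtain ⟨c', hc', e⟩ := i3 w hw
          exact ⟨c', List.mem_cons_of_mem _ hc', e⟩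
    · rw [i4, h3, sup_assoc, ← Submodule.span_union]
      congr 2
      ext v
      simp

/-- The selected vectors are independent, so the tableau never has more than `n` pivots. Scratch
numbers not made by a candidate itself are traced to a reduction against an echelon form of original
vectors, where minor bounds apply. -/
lemma select_cost (cs : List (Arith ℂ (Fin n → ℂ))) (S : Selection n ℂ)
    (hS : Echelon S.basis S.tableau) :
    (select cs S).ops ≤ (cs.map Arith.ops).sum + cs.length * (25 * n * n + 2 * n) ∧
      (∀ z ∈ (select cs S).nums, ∃ c ∈ cs, z ∈ c.nums) ∧
      ∀ z ∈ (select cs S).scratch, ∃ c ∈ cs, z ∈ c.scratch ∨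
        ∃ rows ps, Echelon rows ps ∧ (∀ w ∈ rows, w ∈ S.basis ∨ ∃ c ∈ cs, w = c.val) ∧
          z ∈ (reduce 1 ps c.val).nums := by
  induction cs generalizing S with
  | nil => simp [select]
  | cons c cs ih =>
    obtain ⟨S', hS', -, hops, hnums, hscr⟩ := select_cons c cs S
    obtain ⟨h1, h2, -⟩ := hS.select_step hS'
    obtain ⟨i1, i2, i3⟩ := ih S' h1
    refine ⟨?_, ?_, ?_⟩
    · have hlen := hS.listIndep.length_le
      rw [hS.length_eq, Fintype.card_fin] at hlen
      have := Nat.mul_le_mul_left (25 * n) hlen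
      rw [List.map_cons, List.sum_cons, List.length_cons, Nat.add_mul, one_mul]
      omega
    · rw [hnums]
      rintro z (hz | hz)
      · exact ⟨c, List.mem_cons_self, hz⟩
      · obtain ⟨c', hc', hz'⟩ := i2 z hz
        exact ⟨c', List.mem_cons_of_mem _ hc', hz'⟩
    · rw [hscr]
      rintro z (hz | hz | hz)
      · exact ⟨c, List.mem_cons_self, Or.inl hz⟩
      · exact ⟨c, List.mem_cons_self, Or.inr ⟨_, _, hS, fun w hw => Or.inl hw, hz⟩⟩
      · obtain ⟨c', hc', hz'⟩ := i3 z hz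
        refine ⟨c', List.mem_cons_of_mem _ hc', hz'.imp id ?_⟩
        rintro ⟨rows, ps, he, hr, hz''⟩
        refine ⟨rows, ps, he, fun w hw => ?_, hz''⟩
        rcases hr w hw with hw | ⟨c'', hc'', e⟩
        · rcases h2 with h2 | h2
          · exact Or.inl (h2 ▸ hw)
          · rw [h2, List.mem_append, List.mem_singleton] at hw
            exact hw.imp id fun e => ⟨c, List.mem_cons_self, e⟩
        · exact Or.inr ⟨c'', List.mem_cons_of_mem _ hc'', e⟩

end Select

/-! ### Factorization and pseudoinverse -/

section Factor

variable {n d : ℕ}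

lemma mem_coords (q : Fin n × Fin d) : q ∈ coords n d := by
  simp [coords]

lemma length_coords (n d : ℕ) : (coords n d).length = n * d := by
  simp [coords, List.length_flatMap]

variable (B : Matrix (Fin n × Fin d) (Fin n × Fin d) ℂ)

/-- A column of `B`, extended by the unit vector of its index. -/
def extCol (q : Fin n × Fin d) : (Fin n × Fin d) ⊕ (Fin n × Fin d) → ℂ :=
  Sum.elim (fun i => B i q) (Pi.single q 1)

/-- The vectors `(B x; x)`. -/
def graph : Submodule ℂ ((Fin n × Fin d) ⊕ (Fin n × Fin d) → ℂ) where
  carrier := {v | v ∘ Sum.inl = B.mulVec (v ∘ Sum.inr)}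
  add_mem' {v w} hv hw := by
    change (v + w) ∘ Sum.inl = B.mulVec ((v + w) ∘ Sum.inr)
    rw [Pi.add_comp, Pi.add_comp, Matrix.mulVec_add]
    exact congrArg₂ _ hv hw
  zero_mem' := by
    change (0 : (Fin n × Fin d) ⊕ (Fin n × Fin d) → ℂ) ∘ Sum.inl =
      B.mulVec ((0 : (Fin n × Fin d) ⊕ (Fin n × Fin d) → ℂ) ∘ Sum.inr)
    rw [Pi.zero_comp, Pi.zero_comp, Matrix.mulVec_zero]
  smul_mem' c v hv := by
    change (c • v) ∘ Sum.inl = B.mulVec ((c • v) ∘ Sum.inr)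
    rw [Pi.smul_comp, Pi.smul_comp, Matrix.mulVec_smul]
    exact congrArg _ hv

variable {B}

lemma mem_graph {v : (Fin n × Fin d) ⊕ (Fin n × Fin d) → ℂ} :
    v ∈ graph B ↔ v ∘ Sum.inl = B.mulVec (v ∘ Sum.inr) := Iff.rfl

lemma extCol_mem_graph (q : Fin n × Fin d) : extCol B q ∈ graph B := by
  rw [mem_graph, extCol, Sum.elim_comp_inl, Sum.elim_comp_inr, Matrix.mulVec_single_one]
  rfl

lemma graph_eq_sum {v : (Fin n × Fin d) ⊕ (Fin n × Fin d) → ℂ} (hv : v ∈ graph B) :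
    v = ∑ q, v (Sum.inr q) • extCol B q := by
  ext (i | i)
  · have := congrFun (mem_graph.1 hv) i
    simp only [Function.comp_apply, Matrix.mulVec, dotProduct] at this
    rw [this]
    simp [Finset.sum_apply, extCol, mul_comm]
  · simp [Finset.sum_apply, extCol, Pi.single_apply]

lemma finrank_graph : Module.finrank ℂ (graph B) = n * d := by
  let g : (Fin n × Fin d → ℂ) →ₗ[ℂ] ((Fin n × Fin d) ⊕ (Fin n × Fin d) → ℂ) :=
    { toFun := fun x => Sum.elim (B.mulVec x) x
      map_add' := fun x y => by rw [Matrix.mulVec_add]; ext (i | i) <;> rfl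
      map_smul' := fun c x => by rw [Matrix.mulVec_smul]; ext (i | i) <;> rfl }
  have hg : Function.Injective g := fun x y h => by
    ext i; exact congrFun h (Sum.inr i)
  have hr : LinearMap.range g = graph B := by
    ext v
    constructor
    · rintro ⟨x, rfl⟩; exact mem_graph.2 rfl
    · intro hv
      refine ⟨v ∘ Sum.inr, ?_⟩
      ext (i | i)
      · exact (congrFun (mem_graph.1 hv) i).symm
      · rfl
  rw [← hr, LinearMap.finrank_range_of_inj hg, Module.finrank_fintype_fun_eq_card,
    Fintype.card_prod, Fintype.card_fin, Fintype.card_fin]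

/-- `x ↦ (0; x)`. -/
def inrLin (n d : ℕ) :
    (Fin n × Fin d → ℂ) →ₗ[ℂ] ((Fin n × Fin d) ⊕ (Fin n × Fin d) → ℂ) where
  toFun x := Sum.elim 0 x
  map_add' x y := by ext (i | i) <;> simp
  map_smul' c x := by ext (i | i) <;> simp

lemma inrLin_mem_graph {x : Fin n × Fin d → ℂ} : inrLin n d x ∈ graph B ↔ B.mulVec x = 0 := by
  rw [mem_graph]
  exact eq_comm

/-- The pivots of `F` are an echelon form of extended columns of `B`, with pivot coordinates in the
columns themselves. -/
def IsPartialFactor (B : Matrix (Fin n × Fin d) (Fin n × Fin d) ℂ)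
    (rows : List ((Fin n × Fin d) ⊕ (Fin n × Fin d) → ℂ)) (F : Factored n d ℂ) : Prop :=
  Echelon rows F.pivots ∧ (∀ w ∈ rows, ∃ q, w = extCol B q) ∧
    (∀ P ∈ F.pivots, ∃ i, P.loc = Sum.inl i) ∧ ∀ x ∈ F.kernel, B.mulVec x = 0

lemma IsPartialFactor.listSpan_le_graph {rows : List ((Fin n × Fin d) ⊕ (Fin n × Fin d) → ℂ)}
    {F : Factored n d ℂ} (h : IsPartialFactor B rows F) : listSpan rows ≤ graph B :=
  listSpan_le.2 fun w hw => by
    obtain ⟨q, rfl⟩ := h.2.1 w hw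
    exact extCol_mem_graph q

lemma factor_cons (q : Fin n × Fin d) (qs : List (Fin n × Fin d)) (F : Factored n d ℂ) :
    ∃ F', (((∀ i, (reduce 1 F.pivots (extCol B q)).val (Sum.inl i) = 0) ∧
        F' = ⟨F.pivots, F.kernel ++
          [fun i => (reduce 1 F.pivots (extCol B q)).val (Sum.inr i)]⟩) ∨
        ∃ t, (reduce 1 F.pivots (extCol B q)).val (Sum.inl t) ≠ 0 ∧
          F' = ⟨F.pivots ++ [⟨Sum.inl t, (reduce 1 F.pivots (extCol B q)).val⟩], F.kernel⟩) ∧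
      (factor B (q :: qs) F).val = (factor B qs F').val ∧
      (factor B (q :: qs) F).ops ≤
        50 * (n * d) * F.pivots.length + 2 * (n * d) + (factor B qs F').ops ∧
      (factor B (q :: qs) F).nums =
        (reduce 1 F.pivots (extCol B q)).nums ∪ (factor B qs F').nums ∧
      (factor B (q :: qs) F).scratch = (factor B qs F').scratch := by
  have hops := findPivot_ops_le (reduce 1 F.pivots (extCol B q)).val
    ((coords n d).map Sum.inl)
  rw [List.length_map, length_coords] at hops
  have hred := reduce_ops 1 F.pivots (extCol B q)
  rw [Fintype.card_sum, Fintype.card_prod, Fintype.card_fin, Fintype.card_fin,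
    show 25 * (n * d + n * d) = 50 * (n * d) by ring] at hred
  unfold extCol at hops hred ⊢
  cases h : (findPivot (reduce 1 F.pivots
      (Sum.elim (fun i => B i q) (Pi.single q 1))).val ((coords n d).map Sum.inl)).val with
  | none =>
    refine ⟨_, Or.inl ⟨fun i => ?_, rfl⟩, ?_⟩
    · exact findPivot_eq_none h _ (List.mem_map_of_mem (mem_coords i))
    · simp only [factor, bind_val, h, bind_ops, bind_nums, findPivot_nums, bind_scratch,
        findPivot_scratch, reduce_scratch, Set.empty_union, true_and, and_true]
      omega
  | some t =>
    obtain ⟨ht, ht0⟩ := findPivot_eq_some h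
    obtain ⟨t, -, rfl⟩ := List.mem_map.1 ht
    refine ⟨_, Or.inr ⟨t, ht0, rfl⟩, ?_⟩
    simp only [factor, bind_val, h, bind_ops, bind_nums, findPivot_nums, bind_scratch,
      findPivot_scratch, reduce_scratch, Set.empty_union, true_and, and_true]
    omega

/-- Reduced columns stay in the graph of `B`, so a vanishing left half makes the right half a kernel
vector. Each column contributes either a pivot or a kernel vector, and in both cases lies in the
span collected so far. -/
lemma IsPartialFactor.step {rows : List ((Fin n × Fin d) ⊕ (Fin n × Fin d) → ℂ)}
    {F F' : Factored n d ℂ} {q : Fin n × Fin d} (hF : IsPartialFactor B rows F)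
    (h : ((∀ i, (reduce 1 F.pivots (extCol B q)).val (Sum.inl i) = 0) ∧
        F' = ⟨F.pivots, F.kernel ++
          [fun i => (reduce 1 F.pivots (extCol B q)).val (Sum.inr i)]⟩) ∨
        ∃ t, (reduce 1 F.pivots (extCol B q)).val (Sum.inl t) ≠ 0 ∧
          F' = ⟨F.pivots ++ [⟨Sum.inl t, (reduce 1 F.pivots (extCol B q)).val⟩], F.kernel⟩) :
    ∃ rows', IsPartialFactor B rows' F' ∧
      F'.pivots.length + F'.kernel.length = F.pivots.length + F.kernel.length + 1 ∧
      listSpan rows ⊔ (listSpan F.kernel).map (inrLin n d) ≤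
        listSpan rows' ⊔ (listSpan F'.kernel).map (inrLin n d) ∧
      extCol B q ∈ listSpan rows' ⊔ (listSpan F'.kernel).map (inrLin n d) := by
  have hgraph := hF.listSpan_le_graph
  obtain ⟨h1, h2, h3, h4⟩ := hF
  rcases h with ⟨h, rfl⟩ | ⟨t, ht, rfl⟩
  · set v := (reduce 1 F.pivots (extCol B q)).val with hv
    have hlift : v = inrLin n d (fun i => v (Sum.inr i)) := by
      ext (i | i)
      · exact h i
      · rfl
    have hsub := h1.reduce_sub_mem (extCol B q)
    rw [← hv] at hsub
    have hmem : v ∈ graph B := by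
      rw [← sub_add_cancel v (lastPivot 1 F.pivots • extCol B q)]
      exact Submodule.add_mem _ (hgraph hsub)
        (Submodule.smul_mem _ _ (extCol_mem_graph q))
    refine ⟨rows, ⟨h1, h2, h3, ?_⟩, ?_, ?_, ?_⟩
    · intro x hx
      rcases List.mem_append.1 hx with hx | hx
      · exact h4 x hx
      · rw [List.mem_singleton] at hx
        rw [hx, ← inrLin_mem_graph, ← hlift]
        exact hmem
    · simp [add_assoc]
    · refine sup_le_sup_left (Submodule.map_mono ?_) _
      rw [listSpan_append]
      exact le_sup_left
    · have hδ := h1.lastPivot_ne_zero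
      refine (Submodule.smul_mem_iff _ hδ).1 ?_
      have e : lastPivot 1 F.pivots • extCol B q =
          -(v - lastPivot 1 F.pivots • extCol B q) + v := by abel
      rw [e]
      refine Submodule.add_mem_sup (Submodule.neg_mem _ hsub) ?_
      rw [hlift]
      exact Submodule.mem_map_of_mem (mem_listSpan (by simp [← hlift]))
  · refine ⟨rows ++ [extCol B q], ⟨h1.concat ht, ?_, ?_, h4⟩, ?_, ?_, ?_⟩
    · intro w hw
      rcases List.mem_append.1 hw with hw | hw
      · exact h2 w hw
      · exact ⟨q, List.mem_singleton.1 hw⟩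
    · intro P hP
      rcases List.mem_append.1 hP with hP | hP
      · exact h3 P hP
      · rw [List.mem_singleton] at hP
        subst hP
        exact ⟨t, rfl⟩
    · simp; omega
    · refine sup_le_sup_right ?_ _
      rw [listSpan_append]
      exact le_sup_left
    · exact Submodule.mem_sup_left (mem_listSpan (by simp))

lemma factor_partial (qs : List (Fin n × Fin d)) {F : Factored n d ℂ}
    {rows : List ((Fin n × Fin d) ⊕ (Fin n × Fin d) → ℂ)} (hF : IsPartialFactor B rows F) :
    ∃ rows', IsPartialFactor B rows' (factor B qs F).val ∧
      (factor B qs F).val.pivots.length + (factor B qs F).val.kernel.length =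
        F.pivots.length + F.kernel.length + qs.length ∧
      listSpan rows ⊔ (listSpan F.kernel).map (inrLin n d) ≤
        listSpan rows' ⊔ (listSpan (factor B qs F).val.kernel).map (inrLin n d) ∧
      ∀ q ∈ qs, extCol B q ∈
        listSpan rows' ⊔ (listSpan (factor B qs F).val.kernel).map (inrLin n d) := by
  induction qs generalizing F rows with
  | nil => exact ⟨rows, hF, rfl, le_rfl, by simp⟩
  | cons q qs ih =>
    obtain ⟨F', hF', hval, -⟩ := factor_cons (B := B) q qs F
    obtain ⟨rows₁, h1, h2, h3, h4⟩ := hF.step hF'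
    obtain ⟨rows', i1, i2, i3, i4⟩ := ih h1
    rw [hval]
    refine ⟨rows', i1, ?_, h3.trans i3, ?_⟩
    · rw [i2, h2, List.length_cons]; ring
    · intro q' hq'
      rcases List.mem_cons.1 hq' with rfl | hq'
      · exact i3 h4
      · exact i4 q' hq'

/-- The vectors computed from `ps` by `factor` are reduced extended columns. -/
def IsFactorStage (B : Matrix (Fin n × Fin d) (Fin n × Fin d) ℂ) (N : ℕ)
    (ps : List (Pivot ((Fin n × Fin d) ⊕ (Fin n × Fin d)) ℂ)) : Prop :=
  ps.length + 1 ≤ N ∧ ∃ rows, Echelon rows ps ∧ ∀ w ∈ rows, ∃ q, w = extCol B q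

lemma factor_cost (qs : List (Fin n × Fin d)) {F : Factored n d ℂ}
    {rows : List ((Fin n × Fin d) ⊕ (Fin n × Fin d) → ℂ)} (hF : IsPartialFactor B rows F)
    {N : ℕ} (hN : F.pivots.length + F.kernel.length + qs.length ≤ N) :
    (factor B qs F).ops ≤ qs.length * (50 * (n * d) * N + 2 * (n * d)) ∧
      (factor B qs F).scratch = ∅ ∧
      (∀ z ∈ (factor B qs F).nums, ∃ ps q, IsFactorStage B N ps ∧
        z ∈ (reduce 1 ps (extCol B q)).nums) ∧
      (∀ x ∈ (factor B qs F).val.kernel, x ∈ F.kernel ∨ ∃ ps q, IsFactorStage B N ps ∧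
        x = fun i => (reduce 1 ps (extCol B q)).val (Sum.inr i)) ∧
      (∀ P ∈ (factor B qs F).val.pivots, P ∈ F.pivots ∨ ∃ ps q, IsFactorStage B N ps ∧
        P.row = (reduce 1 ps (extCol B q)).val) := by
  induction qs generalizing F rows with
  | nil => simp only [factor, pure_ops, pure_scratch, pure_nums, pure_val]; simp +contextual
  | cons q qs ih =>
    obtain ⟨F', hF', hval, hops, hnums, hscr⟩ := factor_cons (B := B) q qs F
    obtain ⟨rows₁, h1, h2, -, -⟩ := hF.step hF'
    rw [List.length_cons] at hN
    obtain ⟨i1, i2, i3, i4, i5⟩ := ih h1 (by omega)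
    -- The column being processed is not yet counted, which leaves room for one more row: the
    -- bordered minors have order at most `N`.
    have hstage : IsFactorStage B N F.pivots := ⟨by omega, rows, hF.1, hF.2.1⟩
    refine ⟨?_, hscr.trans i2, ?_, ?_, ?_⟩
    · have hlen : F.pivots.length ≤ N := by omega
      have := Nat.mul_le_mul_left (50 * (n * d)) hlen
      rw [List.length_cons, Nat.add_mul, one_mul]
      omega
    · rw [hnums]
      rintro z (hz | hz)
      · exact ⟨_, q, hstage, hz⟩
      · exact i3 z hz
    · rw [hval]
      intro x hx
      rcases i4 x hx with hx | hx
      · rcases hF' with ⟨-, rfl⟩ | ⟨t, -, rfl⟩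
        · rcases List.mem_append.1 hx with hx | hx
          · exact Or.inl hx
          · exact Or.inr ⟨_, q, hstage, List.mem_singleton.1 hx⟩
        · exact Or.inl hx
      · exact Or.inr hx
    · rw [hval]
      intro P hP
      rcases i5 P hP with hP | hP
      · rcases hF' with ⟨-, rfl⟩ | ⟨t, -, rfl⟩
        · exact Or.inl hP
        · rcases List.mem_append.1 hP with hP | hP
          · exact Or.inl hP
          · rw [List.mem_singleton] at hP
            subst hP
            exact Or.inr ⟨_, q, hstage, rfl⟩
      · exact Or.inr hP

/-- `F` is the eliminated form of `B`. -/
def IsFactor (B : Matrix (Fin n × Fin d) (Fin n × Fin d) ℂ)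
    (rows : List ((Fin n × Fin d) ⊕ (Fin n × Fin d) → ℂ)) (F : Factored n d ℂ) : Prop :=
  IsPartialFactor B rows F ∧ F.pivots.length + F.kernel.length = n * d ∧
    graph B ≤ listSpan rows ⊔ (listSpan F.kernel).map (inrLin n d)

lemma isPartialFactor_nil : IsPartialFactor B [] ⟨[], []⟩ :=
  ⟨Echelon.nil, by simp, by simp, by simp⟩

lemma exists_isFactor (B : Matrix (Fin n × Fin d) (Fin n × Fin d) ℂ) :
    ∃ rows, IsFactor B rows (factor B (coords n d) ⟨[], []⟩).val := by
  obtain ⟨rows, h1, h2, -, h4⟩ := factor_partial (coords n d) (isPartialFactor_nil (B := B))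
  refine ⟨rows, h1, by simpa [length_coords] using h2, fun v hv => ?_⟩
  rw [graph_eq_sum hv]
  exact Submodule.sum_mem _ fun q _ => Submodule.smul_mem _ _ (h4 q (mem_coords q))

variable {rows : List ((Fin n × Fin d) ⊕ (Fin n × Fin d) → ℂ)} {F : Factored n d ℂ}

/-- A vector `(y; x)` of the graph with `y` vanishing at the pivot coordinates has `y = 0`, and `x`
is in the span of the kernel vectors. -/
lemma IsFactor.inl_eq_zero (hF : IsFactor B rows F)
    {v : (Fin n × Fin d) ⊕ (Fin n × Fin d) → ℂ} (hv : v ∈ graph B)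
    (hloc : ∀ P ∈ F.pivots, v P.loc = 0) :
    v ∘ Sum.inl = 0 ∧ v ∘ Sum.inr ∈ listSpan F.kernel := by
  obtain ⟨ρ, hρ, _, ⟨x, hx, rfl⟩, rfl⟩ := Submodule.mem_sup.1 (hF.2.2 hv)
  have hρ0 : ρ = 0 := by
    refine hF.1.1.eq_zero_of_loc hρ fun P hP => ?_
    have := hloc P hP
    obtain ⟨i, hi⟩ := hF.1.2.2.1 P hP
    rw [hi] at this ⊢
    simpa [inrLin] using this
  rw [hρ0, zero_add]
  exact ⟨rfl, hx⟩

lemma IsFactor.listSpan_kernel (hF : IsFactor B rows F) :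
    listSpan F.kernel = LinearMap.ker B.mulVecLin := by
  apply le_antisymm
  · exact listSpan_le.2 fun x hx => hF.1.2.2.2 x hx
  · intro x hx
    have hx' : inrLin n d x ∈ graph B := inrLin_mem_graph.2 hx
    refine (hF.inl_eq_zero hx' fun P hP => ?_).2
    obtain ⟨i, hi⟩ := hF.1.2.2.1 P hP
    rw [hi]; rfl

/-- The graph has dimension `nd` and lies in the span of the rows and lifted kernel vectors, which
number `nd` in total; so no kernel vector is redundant. -/
lemma IsFactor.listIndep_kernel (hF : IsFactor B rows F) : ListIndep F.kernel := by
  rw [listIndep_iff_length_le]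
  have h1 := Submodule.finrank_mono hF.2.2
  have h2 := Submodule.finrank_add_le_finrank_add_finrank (listSpan rows)
    ((listSpan F.kernel).map (inrLin n d))
  have h3 := finrank_listSpan_le rows
  have h4 := Submodule.finrank_map_le (inrLin n d) (listSpan F.kernel)
  have h5 := hF.2.1
  rw [finrank_graph] at h1
  rw [hF.1.1.length_eq] at h3
  omega

lemma pseudoInverse_val (F : Factored n d ℂ) (w : Fin n × Fin d → ℂ) :
    (pseudoInverse F w).val =
      fun i => (reduce 1 F.pivots (Sum.elim w (0 : Fin n × Fin d → ℂ))).val (Sum.inr i) := rfl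

/-- The scaled pseudoinverse. -/
lemma IsFactor.mulVec_pseudoInverse (hF : IsFactor B rows F) {w : Fin n × Fin d → ℂ}
    (hw : w ∈ LinearMap.range B.mulVecLin) :
    B.mulVec (pseudoInverse F w).val = -(lastPivot 1 F.pivots) • w := by
  obtain ⟨y, rfl⟩ := hw
  set δ := lastPivot 1 F.pivots
  set v := (reduce 1 F.pivots (Sum.elim (B.mulVecLin y) (0 : Fin n × Fin d → ℂ))).val with hv
  have h1 := hF.1.listSpan_le_graph (hF.1.1.reduce_sub_mem
    (Sum.elim (B.mulVecLin y) (0 : Fin n × Fin d → ℂ)))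
  rw [mem_graph] at h1
  have hl : (v - δ • (Sum.elim (B.mulVecLin y) (0 : Fin n × Fin d → ℂ))) ∘ Sum.inl =
      v ∘ Sum.inl - δ • B.mulVec y := rfl
  have hr : (v - δ • (Sum.elim (B.mulVecLin y) (0 : Fin n × Fin d → ℂ))) ∘ Sum.inr =
      v ∘ Sum.inr := by
    ext i; simp
  rw [← hv, hl, hr] at h1
  -- Reducing `(B y; 0)` gives a vector outside the graph in general; adding `δ y` to its right half
  -- moves it into the graph. Its left half vanishes at the pivots and hence is zero.
  have h2 : Sum.elim (v ∘ Sum.inl) (v ∘ Sum.inr + δ • y) ∈ graph B := by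
    rw [mem_graph, Sum.elim_comp_inl, Sum.elim_comp_inr, Matrix.mulVec_add, ← h1,
      Matrix.mulVec_smul, sub_add_cancel]
  have h3 := (hF.inl_eq_zero h2 fun P hP => by
    obtain ⟨i, hi⟩ := hF.1.2.2.1 P hP
    have := hF.1.1.reduce_loc (Sum.elim (B.mulVecLin y) (0 : Fin n × Fin d → ℂ)) hP
    rw [hi] at this ⊢
    exact this).1
  rw [Sum.elim_comp_inl] at h3
  rw [pseudoInverse_val]
  change B.mulVec (v ∘ Sum.inr) = _
  rw [← h1, h3, zero_sub, neg_smul]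
  rfl

end Factor

/-! ### Correctness of the computation of the Wong sequence -/

section WongSteps

variable {n d p : ℕ}

lemma listSpan_tensorList (ws : List (Fin n → ℂ)) :
    listSpan (tensorList d ws) = tensorSpace (listSpan ws) d := by
  rw [listSpan, listSpan, tensorSpace_span]
  congr 1
  ext v
  simp [tensorList, eq_comm]

lemma length_tensorList (ws : List (Fin n → ℂ)) :
    (tensorList d ws).length = ws.length * d := by
  simp [tensorList, List.length_flatMap]

lemma listIndep_tensorList {ws : List (Fin n → ℂ)} (h : ListIndep ws) :
    ListIndep (tensorList d ws) := by
  rw [listIndep_iff_length_le, listSpan_tensorList, finrank_tensorSpace, length_tensorList,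
    h.finrank_eq, mul_comm]

lemma tensorSpace_le_iff (hd : 0 < d) {U V : Submodule ℂ (Fin n → ℂ)} :
    tensorSpace U d ≤ tensorSpace V d ↔ U ≤ V := by
  refine ⟨fun h u hu => ?_, tensorSpace_mono⟩
  have := mem_tensorSpace.1 (h (tensorUnit_mem_tensorSpace hu (⟨0, hd⟩ : Fin d))) ⟨0, hd⟩
  simpa [block_tensorUnit] using this

lemma span_candidates (A : Fin p → Matrix (Fin n) (Fin n) ℂ) (us : List (Fin n × Fin d → ℂ)) :
    {v | ∃ c ∈ candidates A us, v = c.val} =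
      {v | ∃ u ∈ us, ∃ b j, v = (A j).mulVec (block u b)} := by
  have key : ∀ (j : Fin p) (u : Fin n × Fin d → ℂ) (b : Fin d),
      (vec fun s => dot (A j s) (fun t => u (t, b))).val = (A j).mulVec (block u b) := by
    intro j u b
    ext s
    exact dot_val _ _
  ext v
  simp only [candidates, List.mem_flatMap, List.mem_map, List.mem_finRange, true_and,
    Set.mem_ofPred_eq]
  constructor
  · rintro ⟨c, ⟨u, hu, b, j, rfl⟩, rfl⟩
    exact ⟨u, hu, b, j, key j u b⟩
  · rintro ⟨u, hu, b, j, rfl⟩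
    exact ⟨_, ⟨u, hu, b, j, rfl⟩, (key j u b).symm⟩

lemma finrank_comap {ι : Type} [Fintype ι] (B : Matrix ι ι ℂ) {W : Submodule ℂ (ι → ℂ)}
    (hW : W ≤ LinearMap.range B.mulVecLin) :
    Module.finrank ℂ (W.comap B.mulVecLin) =
      Module.finrank ℂ W + Module.finrank ℂ (LinearMap.ker B.mulVecLin) := by
  have h := finrank_map_add_finrank_inf_ker B.mulVecLin (W.comap B.mulVecLin)
  have hker : LinearMap.ker B.mulVecLin ≤ W.comap B.mulVecLin := fun x hx => by
    rw [Submodule.mem_comap, LinearMap.mem_ker.1 hx]; exact W.zero_mem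
  rw [Submodule.map_comap_eq, inf_eq_right.2 hW, inf_eq_right.2 hker] at h
  exact h.symm

/-- A basis of `B⁻¹(W)` is extended to one of `B⁻¹(W ⊔ T)`. -/
lemma comap_sup_basis {ι : Type} [Fintype ι] {B : Matrix ι ι ℂ}
    {W : Submodule ℂ (ι → ℂ)} {us ts : List (ι → ℂ)} (hus : ListIndep us)
    (hspan : listSpan us = W.comap B.mulVecLin)
    (hrange : W ⊔ listSpan ts ≤ LinearMap.range B.mulVecLin)
    (hdim : Module.finrank ℂ (W ⊔ listSpan ts : Submodule ℂ (ι → ℂ)) =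
      Module.finrank ℂ W + ts.length)
    {f : (ι → ℂ) → (ι → ℂ)} {c : ℂ} (hc : c ≠ 0) (hf : ∀ t ∈ ts, B.mulVec (f t) = c • t) :
    ListIndep (us ++ ts.map f) ∧
      listSpan (us ++ ts.map f) = (W ⊔ listSpan ts).comap B.mulVecLin := by
  have hW : W ≤ LinearMap.range B.mulVecLin := le_sup_left.trans hrange
  have hker : LinearMap.ker B.mulVecLin ≤ listSpan us := fun x hx => by
    rw [hspan, Submodule.mem_comap, LinearMap.mem_ker.1 hx]; exact W.zero_mem
  have hs : listSpan (us ++ ts.map f) = (W ⊔ listSpan ts).comap B.mulVecLin := by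
    apply le_antisymm
    · rw [listSpan_append, hspan]
      refine sup_le (Submodule.comap_mono le_sup_left) (listSpan_le.2 fun v hv => ?_)
      obtain ⟨t, ht, rfl⟩ := List.mem_map.1 hv
      rw [Submodule.mem_comap, Matrix.mulVecLin_apply, hf t ht]
      exact Submodule.smul_mem _ _ (Submodule.mem_sup_right (mem_listSpan ht))
    · have hle : W ⊔ listSpan ts ≤ (listSpan (us ++ ts.map f)).map B.mulVecLin := by
        refine sup_le ?_ (listSpan_le.2 fun t ht => ?_)
        · have h1 : W = (listSpan us).map B.mulVecLin := by
            rw [hspan, Submodule.map_comap_eq, inf_eq_right.2 hW]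
          conv_lhs => rw [h1]
          refine Submodule.map_mono ?_
          rw [listSpan_append]
          exact le_sup_left
        · refine ⟨c⁻¹ • f t, Submodule.smul_mem _ _ (mem_listSpan ?_), ?_⟩
          · exact List.mem_append_right _ (List.mem_map_of_mem ht)
          · rw [map_smul, Matrix.mulVecLin_apply, hf t ht, smul_smul, inv_mul_cancel₀ hc, one_smul]
      refine (Submodule.comap_mono hle).trans ?_
      rw [Submodule.comap_map_eq, listSpan_append]
      exact sup_le le_rfl (hker.trans le_sup_left)
  refine ⟨?_, hs⟩
  -- Both preimages exceed their images by the nullity of `B`, so the dimension grows by exactly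
  -- `ts.length`.
  rw [listIndep_iff_length_le, hs, finrank_comap B hrange, hdim, List.length_append,
    List.length_map, ← hus.finrank_eq, hspan, finrank_comap B hW]
  omega

/-- The state of the algorithm after `i` steps of the Wong sequence. -/
structure WongState (A : Fin p → Matrix (Fin n) (Fin n) ℂ)
    (B : Matrix (Fin n × Fin d) (Fin n × Fin d) ℂ) (i : ℕ)
    (fresh us : List (Fin n × Fin d → ℂ)) (S : Selection n ℂ) : Prop where
  echelon : Echelon S.basis S.tableau
  wong : wongSeq B (blowUpSpace A d) i = tensorSpace (listSpan S.basis) d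
  indep : ListIndep us
  span : listSpan us = (wongSeq B (blowUpSpace A d) i).comap B.mulVecLin
  fresh_sub : ∀ u ∈ fresh, u ∈ us
  old : ∀ u ∈ us, u ∈ fresh ∨ ∀ b j, (A j).mulVec (block u b) ∈ listSpan S.basis

variable {A : Fin p → Matrix (Fin n) (Fin n) ℂ} {B : Matrix (Fin n × Fin d) (Fin n × Fin d) ℂ}
  {rows : List ((Fin n × Fin d) ⊕ (Fin n × Fin d) → ℂ)} {F : Factored n d ℂ}

lemma WongState.step (hd : 0 < d) (hF : IsFactor B rows F) {i : ℕ}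
    {fresh us : List (Fin n × Fin d → ℂ)} {S : Selection n ℂ} (h : WongState A B i fresh us S)
    (hrange : wongSeq B (blowUpSpace A d) (i + 1) ≤ LinearMap.range B.mulVecLin) :
    WongState A B (i + 1)
      ((tensorList d ((select (candidates A fresh) S).val.basis.drop S.basis.length)).map
        fun w => (pseudoInverse F w).val)
      (us ++ (tensorList d ((select (candidates A fresh) S).val.basis.drop S.basis.length)).map
        fun w => (pseudoInverse F w).val)
      (select (candidates A fresh) S).val := by
  obtain ⟨h1, ⟨new, h2, -⟩, h3⟩ := select_correct (candidates A fresh) S h.echelon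
  set S' := (select (candidates A fresh) S).val
  rw [span_candidates] at h3
  have hdrop : S'.basis.drop S.basis.length = new := by rw [h2]; simp
  rw [hdrop]
  have hsucc : wongSeq B (blowUpSpace A d) (i + 1) =
      tensorSpace (Submodule.span ℂ {v | ∃ u ∈ us, ∃ b j, v = (A j).mulVec (block u b)}) d := by
    change image _ _ = _
    rw [← h.span, listSpan, image_blowUpSpace_span, matrixSpace, blockSpan, image_span_span]
    congr 2
    ext v
    constructor
    · rintro ⟨_, ⟨j, rfl⟩, _, ⟨u, hu, b, rfl⟩, rfl⟩
      exact ⟨u, hu, b, j, rfl⟩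
    · rintro ⟨u, hu, b, j, rfl⟩
      exact ⟨_, ⟨j, rfl⟩, _, ⟨u, hu, b, rfl⟩, rfl⟩
  have hS' : Submodule.span ℂ {v | ∃ u ∈ us, ∃ b j, v = (A j).mulVec (block u b)} =
      listSpan S'.basis := by
    rw [h3]
    apply le_antisymm
    · refine Submodule.span_le.2 ?_
      rintro _ ⟨u, hu, b, j, rfl⟩
      -- Images of older vectors were absorbed in earlier rounds, so candidates from `fresh`
      -- suffice.
      rcases h.old u hu with hu | hu
      · exact Submodule.mem_sup_right (Submodule.subset_span ⟨u, hu, b, j, rfl⟩)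
      · exact Submodule.mem_sup_left (hu b j)
    · refine sup_le ?_ (Submodule.span_mono ?_)
      -- The earlier basis remains inside because `W_i ≤ W_{i+1}`, and for `d > 0` tensoring
      -- reflects inclusion.
      · rw [← tensorSpace_le_iff hd, ← h.wong, ← hsucc]
        exact wongSeq_le_succ _ _ _
      · rintro _ ⟨u, hu, b, j, rfl⟩
        exact ⟨u, h.fresh_sub u hu, b, j, rfl⟩
  have hW' : wongSeq B (blowUpSpace A d) (i + 1) = tensorSpace (listSpan S'.basis) d := by
    rw [hsucc, hS']
  have hsup : wongSeq B (blowUpSpace A d) i ⊔ listSpan (tensorList d new) =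
      wongSeq B (blowUpSpace A d) (i + 1) := by
    rw [hW', h.wong, ← listSpan_tensorList, ← listSpan_tensorList, ← listSpan_append, h2]
    simp [tensorList]
  have hmem : ∀ t ∈ tensorList d new, t ∈ LinearMap.range B.mulVecLin := fun t ht =>
    hrange (hsup ▸ Submodule.mem_sup_right (mem_listSpan ht))
  obtain ⟨k1, k2⟩ := comap_sup_basis h.indep h.span (hsup ▸ hrange) (ts := tensorList d new) (by
      rw [hsup, hW', h.wong, finrank_tensorSpace, finrank_tensorSpace, length_tensorList,
        h1.listIndep.finrank_eq, h.echelon.listIndep.finrank_eq, h2, List.length_append]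
      ring) (neg_ne_zero.2 hF.1.1.lastPivot_ne_zero)
    (f := fun w => (pseudoInverse F w).val)
    (fun t ht => hF.mulVec_pseudoInverse (hmem t ht))
  refine ⟨h1, hW', k1, by rw [k2, hsup], fun u hu => List.mem_append_right _ hu, ?_⟩
  intro u hu
  rcases List.mem_append.1 hu with hu | hu
  · right
    intro b j
    rw [← hS']
    exact Submodule.subset_span ⟨u, hu, b, j, rfl⟩
  · exact Or.inl hu

lemma wongSteps_succ_val (F : Factored n d ℂ) (m : ℕ) (fresh us : List (Fin n × Fin d → ℂ))
    (S : Selection n ℂ) :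
    (wongSteps A F (m + 1) fresh us S).val = (wongSteps A F m
      ((tensorList d ((select (candidates A fresh) S).val.basis.drop S.basis.length)).map
        fun w => (pseudoInverse F w).val)
      (us ++ (tensorList d ((select (candidates A fresh) S).val.basis.drop S.basis.length)).map
        fun w => (pseudoInverse F w).val)
      (select (candidates A fresh) S).val).val := by
  simp only [wongSteps, bind_val, mapList_val]

lemma WongState.wongSteps (hd : 0 < d) (hF : IsFactor B rows F)
    (hrange : ∀ i, wongSeq B (blowUpSpace A d) i ≤ LinearMap.range B.mulVecLin) (m : ℕ) {i : ℕ}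
    {fresh us : List (Fin n × Fin d → ℂ)} {S : Selection n ℂ} (h : WongState A B i fresh us S) :
    ∃ fresh', WongState A B (i + m) fresh' (wongSteps A F m fresh us S).val.2
      (wongSteps A F m fresh us S).val.1 := by
  induction m generalizing i fresh us S with
  | zero => exact ⟨fresh, h⟩
  | succ m ih =>
    rw [wongSteps_succ_val, show i + (m + 1) = i + 1 + m by ring]
    exact ih (h.step hd hF (hrange _))

lemma wongState_zero (hF : IsFactor B rows F) :
    WongState A B 0 F.kernel F.kernel ⟨[], []⟩ where
  echelon := Echelon.nil
  wong := by
    rw [listSpan_nil]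
    refine ((Submodule.eq_bot_iff _).2 fun v hv => ?_).symm
    ext ⟨t, b⟩
    exact congrFun ((Submodule.mem_bot ℂ).1 (mem_tensorSpace.1 hv b)) t
  indep := hF.listIndep_kernel
  span := hF.listSpan_kernel
  fresh_sub := fun _ hu => hu
  old := fun _ hu => Or.inl hu

lemma blowUpElement_val (A : Fin p → Matrix (Fin n) (Fin n) ℂ)
    (X : Fin p → Matrix (Fin d) (Fin d) ℂ) : (blowUpElement A X).val = ∑ i, A i ⊗ₖ X i := by
  ext q q'
  simp only [blowUpElement, vec_val, dot_val, Matrix.sum_apply, Matrix.kroneckerMap_apply]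

/-- If the drawn element has maximal relative rank, the algorithm is correct. -/
theorem successful_of_isMaxRatio {k : ℕ} (hd : 0 < d)
    (A : Fin p → Matrix (Fin n) (Fin n) GaussianInt) (X : Draw p d k)
    (hX : IsMaxRatio (toComplexMat A) fun i => Matrix.of fun a b => ((X i a b : ℕ) : ℂ)) :
    Successful A X := by
  unfold Successful
  extract_lets 𝒜 R B W
  obtain ⟨rows, hF⟩ := exists_isFactor B
  set F := (factor B (coords n d) ⟨[], []⟩).val with hFdef
  have hrange : ∀ i, wongSeq B (blowUpSpace (toComplexMat A) d) i ≤
    LinearMap.range B.mulVecLin := fun i => (wongSeq_le_range hX i).1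
  obtain ⟨fresh', hS⟩ := (wongState_zero (A := toComplexMat A) hF).wongSteps hd hF hrange n
  rw [zero_add] at hS
  set T := (wongSteps (toComplexMat A) F n F.kernel F.kernel ⟨[], []⟩).val with hT
  have hB : (blowUpElement (toComplexMat A)
      fun i => Matrix.of fun a b => ((X i a b : ℕ) : ℂ)).val = B := blowUpElement_val _ _
  have hRw : R.wong = T.1.basis := by
    simp only [R, run, algorithm, bind_val, pure_val, hB, ← hFdef, ← hT]
  have hRu : R.ustar = T.2 := by
    simp only [R, run, algorithm, bind_val, pure_val, hB, ← hFdef, ← hT]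
  let cs : List (Arith ℂ (Fin n → ℂ)) :=
    T.2.flatMap fun u => (List.finRange d).map fun b => pure fun t => u (t, b)
  have hRo : R.output = (select cs ⟨[], []⟩).val.basis := by
    simp only [R, run, algorithm, bind_val, pure_val, hB, ← hFdef, ← hT, cs]
  have hW : W = wongSeq B (blowUpSpace (toComplexMat A) d) n :=
    wongLimit_eq_wongSeq _ _
  have hspan : listSpan T.2 = W.comap B.mulVecLin := by rw [hW]; exact hS.span
  obtain ⟨s1, -, s3⟩ := select_correct cs ⟨[], []⟩ Echelon.nil
  have hout : listSpan R.output =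
      blockSpan (W.comap B.mulVecLin : Set (Fin n × Fin d → ℂ)) := by
    rw [hRo, s3, listSpan_nil, bot_sup_eq, ← hspan, listSpan, blockSpan_span, blockSpan]
    congr 1
    ext v
    simp only [cs, List.mem_flatMap, List.mem_map, List.mem_finRange, true_and,
      Set.mem_ofPred_eq]
    constructor
    · rintro ⟨c, ⟨u, hu, b, rfl⟩, rfl⟩
      exact ⟨u, hu, b, rfl⟩
    · rintro ⟨u, hu, b, rfl⟩
      exact ⟨_, ⟨u, hu, b, rfl⟩, rfl⟩
  obtain ⟨m1, m2⟩ := comap_wongLimit (toComplexMat A) hd hX hout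
  refine ⟨⟨?_, ?_⟩, ⟨?_, ?_⟩, ⟨?_, ?_⟩, m1, m2⟩
  · rw [hRw]; exact listIndep_tensorList hS.echelon.listIndep
  · rw [hRw, listSpan_tensorList, hW]; exact hS.wong.symm
  · rw [hRu]; exact hS.indep
  · rw [hRu]; exact hspan
  · rw [hRo]; exact s1.listIndep
  · ext u
    have m1' : W.comap B.mulVecLin = tensorSpace (listSpan R.output) d := m1
    rw [SetLike.mem_coe, Set.mem_ofPred_eq, m1']
    refine ⟨fun hu a => tensorUnit_mem_tensorSpace hu a, fun h => ?_⟩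
    simpa [block_tensorUnit] using mem_tensorSpace.1 (h ⟨0, hd⟩) ⟨0, hd⟩

end WongSteps

/-! ### The number of operations -/

section Operations

variable {n d p : ℕ}

lemma sum_map_const {α : Type} (l : List α) (c : ℕ) : (l.map fun _ => c).sum = l.length * c := by
  simp

lemma candidates_ops (A : Fin p → Matrix (Fin n) (Fin n) ℂ) (us : List (Fin n × Fin d → ℂ)) :
    (candidates A us).length = us.length * (d * p) ∧
      ((candidates A us).map Arith.ops).sum = us.length * (d * p) * (8 * n * n) := by
  have hlen : (candidates A us).length = us.length * (d * p) := by
    simp [candidates, List.length_flatMap]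
  refine ⟨hlen, ?_⟩
  have : ∀ c ∈ candidates A us, c.ops = 8 * n * n := by
    intro c hc
    simp only [candidates, List.mem_flatMap, List.mem_map] at hc
    obtain ⟨u, -, b, -, j, -, rfl⟩ := hc
    simp only [vec_ops, dot_ops, Finset.sum_const, Finset.card_univ, Fintype.card_fin, smul_eq_mul]
    ring
  rw [List.map_congr_left this, sum_map_const, hlen]

lemma pseudoInverse_ops (F : Factored n d ℂ) (w : Fin n × Fin d → ℂ) :
    (pseudoInverse F w).ops = 50 * (n * d) * F.pivots.length := by
  simp only [pseudoInverse, bind_ops, pure_ops, reduce_ops, Fintype.card_sum, Fintype.card_prod,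
    Fintype.card_fin]
  ring

/-- Per candidate: `8n²` to compute it, at most `25n²` to reduce it and `2n ≤ 2n²` zero tests. -/
lemma select_ops_le (A : Fin p → Matrix (Fin n) (Fin n) ℂ) (us : List (Fin n × Fin d → ℂ))
    {S : Selection n ℂ} (hS : Echelon S.basis S.tableau) :
    (select (candidates A us) S).ops ≤ us.length * (35 * (d * p) * (n * n)) := by
  have h := (select_cost (candidates A us) S hS).1
  rw [(candidates_ops A us).1, (candidates_ops A us).2] at h
  refine h.trans ?_
  have : us.length * (d * p) * n ≤ us.length * (d * p) * (n * n) :=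
    Nat.mul_le_mul_left _ (Nat.le_mul_self n)
  calc _ = us.length * (d * p) * (n * n) * 33 + us.length * (d * p) * n * 2 := by ring
    _ ≤ us.length * (d * p) * (n * n) * 33 + us.length * (d * p) * (n * n) * 2 := by gcongr
    _ = _ := by ring

/-- An amortised bound, independent of the number of rounds: at most `n - S.basis.length` vectors
can still be selected, and each creates `d` fresh vectors, which are processed once at most. -/
lemma wongSteps_ops_le (A : Fin p → Matrix (Fin n) (Fin n) ℂ) {F : Factored n d ℂ}
    (hF : F.pivots.length ≤ n * d) (m : ℕ) (fresh us : List (Fin n × Fin d → ℂ))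
    {S : Selection n ℂ} (hS : Echelon S.basis S.tableau) :
    (wongSteps A F m fresh us S).ops ≤
        (fresh.length + d * (n - S.basis.length)) * (35 * (d * p) * (n * n)) +
          d * (n - S.basis.length) * (50 * (n * d) * (n * d)) ∧
      (wongSteps A F m fresh us S).val.2.length ≤ us.length + d * (n - S.basis.length) := by
  induction m generalizing fresh us S with
  | zero => simp [wongSteps]
  | succ m ih =>
    obtain ⟨h1, ⟨new, h2, -⟩, -⟩ := select_correct (candidates A fresh) S hS
    have hsel := select_ops_le A fresh hS
    have hlen := h1.listIndep.length_le
    rw [h2, List.length_append, Fintype.card_fin] at hlen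
    have hdrop : (select (candidates A fresh) S).val.basis.drop S.basis.length = new := by
      rw [h2]; simp
    obtain ⟨i1, i2⟩ := ih ((tensorList d new).map fun w => (pseudoInverse F w).val)
      (us ++ (tensorList d new).map fun w => (pseudoInverse F w).val) h1
    rw [List.length_map, length_tensorList, h2, List.length_append] at i1
    rw [List.length_append, List.length_map, length_tensorList, h2, List.length_append] at i2
    obtain ⟨r, hr⟩ := Nat.exists_eq_add_of_le hlen
    have e1 : n - (S.basis.length + new.length) = r := by omega
    have e2 : n - S.basis.length = new.length + r := by omega
    rw [e1] at i1 i2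
    rw [e2]
    constructor
    · have hmap : (mapList (pseudoInverse F) (tensorList d new)).ops ≤
          new.length * d * (50 * (n * d) * (n * d)) := by
        simp only [mapList_ops, pseudoInverse_ops, sum_map_const, length_tensorList]
        gcongr
      simp only [wongSteps, bind_ops, mapList_val, hdrop]
      calc _ ≤ fresh.length * (35 * (d * p) * (n * n)) +
            (new.length * d * (50 * (n * d) * (n * d)) +
              ((new.length * d + d * r) * (35 * (d * p) * (n * n)) +
                d * r * (50 * (n * d) * (n * d)))) := by gcongr
        _ = _ := by ring
    · rw [wongSteps_succ_val, hdrop]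
      refine i2.trans (le_of_eq ?_)
      ring

lemma length_blocks (us : List (Fin n × Fin d → ℂ)) :
    (us.flatMap fun u => (List.finRange d).map fun b =>
      (pure fun t => u (t, b) : Arith ℂ (Fin n → ℂ))).length = us.length * d := by
  simp [List.length_flatMap]

lemma blocks_ops (us : List (Fin n × Fin d → ℂ)) :
    ((us.flatMap fun u => (List.finRange d).map fun b =>
      (pure fun t => u (t, b) : Arith ℂ (Fin n → ℂ))).map Arith.ops).sum = 0 := by
  have : ∀ c ∈ us.flatMap fun u => (List.finRange d).map fun b =>
      (pure fun t => u (t, b) : Arith ℂ (Fin n → ℂ)), c.ops = 0 := by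
    intro c hc
    simp only [List.mem_flatMap, List.mem_map] at hc
    obtain ⟨u, -, b, -, rfl⟩ := hc
    rfl
  rw [List.map_congr_left this]
  simp

theorem algorithm_ops_le (hp : 0 < p) (hn : 0 < n) (hd : 0 < d)
    (A : Fin p → Matrix (Fin n) (Fin n) ℂ)
    (X : Fin p → Matrix (Fin d) (Fin d) ℂ) :
    (algorithm A X).ops ≤ 234 * (p * d ^ 4 * n ^ 4) := by
  set B := (blowUpElement A X).val with hB
  obtain ⟨rows, hF⟩ := exists_isFactor B
  have hfac := (factor_cost (B := B) (coords n d) isPartialFactor_nil (N := n * d)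
    (by simp [length_coords])).1
  set F := (factor B (coords n d) ⟨[], []⟩).val with hFdef
  obtain ⟨w1, w2⟩ := wongSteps_ops_le A (F := F) (by have := hF.2.1; omega) n F.kernel F.kernel
    (S := ⟨[], []⟩) Echelon.nil
  have hk : F.kernel.length ≤ n * d := by have := hF.2.1; omega
  have hel : (blowUpElement A X).ops = n * d * (n * d * (8 * p)) := by
    simp only [blowUpElement, vec_ops, dot_ops, Finset.sum_const, Finset.card_univ,
      Fintype.card_prod, Fintype.card_fin, smul_eq_mul]
  have hsel := (select_cost ((wongSteps A F n F.kernel F.kernel ⟨[], []⟩).val.2.flatMap fun u =>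
    (List.finRange d).map fun b => (pure fun t => u (t, b) : Arith ℂ (Fin n → ℂ)))
    ⟨[], []⟩ Echelon.nil).1
  rw [blocks_ops, length_blocks, zero_add] at hsel
  rw [length_coords] at hfac
  simp only [List.length_nil, Nat.sub_zero] at w1 w2
  have w2' : (wongSteps A F n F.kernel F.kernel ⟨[], []⟩).val.2.length ≤ 2 * (n * d) := by
    refine w2.trans ?_
    rw [mul_comm d n]; omega
  have w1' : (wongSteps A F n F.kernel F.kernel ⟨[], []⟩).ops ≤
      (n * d + d * n) * (35 * (d * p) * (n * n)) + d * n * (50 * (n * d) * (n * d)) := by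
    refine w1.trans ?_
    gcongr
  have hsel' := hsel.trans (Nat.mul_le_mul_right (25 * n * n + 2 * n)
    (Nat.mul_le_mul_right d w2'))
  simp only [algorithm, bind_ops, pure_ops, ← hB, ← hFdef, hel]
  -- Every monomial below is dominated by `p d⁴ n⁴`; the coefficients add up to `8 + 100 + 2 + 70 +
  -- 50 + 4 = 234`.
  have key : ∀ a b c : ℕ, a ≤ 1 → b ≤ 4 → c ≤ 4 →
      p ^ a * d ^ b * n ^ c ≤ p * d ^ 4 * n ^ 4 := by
    intro a b c ha hb hc
    calc p ^ a * d ^ b * n ^ c ≤ p ^ 1 * d ^ 4 * n ^ 4 :=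
          Nat.mul_le_mul (Nat.mul_le_mul (Nat.pow_le_pow_right hp ha)
            (Nat.pow_le_pow_right hd hb)) (Nat.pow_le_pow_right hn hc)
      _ = _ := by rw [pow_one]
  have k1 := key 1 2 2 (by norm_num) (by norm_num) (by norm_num)
  have k2 := key 0 3 3 (by norm_num) (by norm_num) (by norm_num)
  have k3 := key 0 2 2 (by norm_num) (by norm_num) (by norm_num)
  have k4 := key 1 2 3 (by norm_num) (by norm_num) (by norm_num)
  have k5 := key 0 2 3 (by norm_num) (by norm_num) (by norm_num)
  have k6 := key 0 2 2 (by norm_num) (by norm_num) (by norm_num)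
  calc _ ≤ n * d * (n * d * (8 * p)) + (n * d * (50 * (n * d) * (n * d) + 2 * (n * d)) +
        ((n * d + d * n) * (35 * (d * p) * (n * n)) + d * n * (50 * (n * d) * (n * d)) +
          (2 * (n * d) * d * (25 * n * n + 2 * n) + 0))) := by gcongr
    _ = 8 * (p ^ 1 * d ^ 2 * n ^ 2) + 100 * (p ^ 0 * d ^ 3 * n ^ 3) +
        2 * (p ^ 0 * d ^ 2 * n ^ 2) + 70 * (p ^ 1 * d ^ 2 * n ^ 3) +
        50 * (p ^ 0 * d ^ 2 * n ^ 3) + 4 * (p ^ 0 * d ^ 2 * n ^ 2) := by ring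
    _ ≤ _ := by omega

end Operations

/-! ### The size of the numbers -/

section Size

/-- `z` is a Gaussian integer of absolute value at most `b`. -/
def IsGaussianLE (b : ℝ) (z : ℂ) : Prop := z ∈ GaussianInt.toComplex.range ∧ ‖z‖ ≤ b

namespace IsGaussianLE

variable {a b : ℝ} {x y z : ℂ}

lemma nonneg (h : IsGaussianLE b z) : 0 ≤ b := (norm_nonneg z).trans h.2

lemma mono (h : IsGaussianLE a z) (hab : a ≤ b) : IsGaussianLE b z := ⟨h.1, h.2.trans hab⟩

lemma zero (hb : 0 ≤ b) : IsGaussianLE b 0 := ⟨Subring.zero_mem _, by simpa using hb⟩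

lemma one (hb : 1 ≤ b) : IsGaussianLE b 1 := ⟨Subring.one_mem _, by simpa using hb⟩

lemma mul (hx : IsGaussianLE a x) (hy : IsGaussianLE b y) : IsGaussianLE (a * b) (x * y) :=
  ⟨Subring.mul_mem _ hx.1 hy.1, by
    rw [norm_mul]; exact mul_le_mul hx.2 hy.2 (norm_nonneg _) hx.nonneg⟩

lemma add (hx : IsGaussianLE a x) (hy : IsGaussianLE b y) : IsGaussianLE (a + b) (x + y) :=
  ⟨Subring.add_mem _ hx.1 hy.1, (norm_add_le _ _).trans (add_le_add hx.2 hy.2)⟩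

lemma natCast (m : ℕ) : IsGaussianLE m (m : ℂ) := ⟨natCast_mem _ m, by simp⟩

end IsGaussianLE

/-- A determinant with Gaussian integer entries that are bounded row by row. -/
lemma isGaussianLE_det {κ : Type} [Fintype κ] [DecidableEq κ] {M : Matrix κ κ ℂ} {b : κ → ℝ}
    (h : ∀ i j, IsGaussianLE (b i) (M i j)) :
    IsGaussianLE ((Fintype.card κ).factorial * ∏ i, b i) M.det := by
  rw [Matrix.det_apply]
  constructor
  · refine Subring.sum_mem _ fun σ _ => ?_
    rw [Units.smul_def]
    exact Subring.zsmul_mem _ (Subring.prod_mem _ fun i _ => (h _ _).1) _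
  · refine (norm_sum_le _ _).trans ?_
    rw [← Fintype.card_perm, ← Finset.card_univ, ← nsmul_eq_mul]
    refine Finset.sum_le_card_nsmul _ _ _ fun σ _ => ?_
    rw [Units.smul_def, zsmul_eq_mul, norm_mul, norm_prod]
    have h1 : ‖((Equiv.Perm.sign σ : ℤˣ) : ℂ)‖ = 1 := by
      rcases Int.units_eq_one_or (Equiv.Perm.sign σ) with h | h <;> rw [h] <;> simp
    -- The Leibniz term takes its factors from rows `σ i`, so the row bounds are permuted to match.
    rw [h1, one_mul, ← Equiv.prod_comp σ b]
    exact Finset.prod_le_prod (fun i _ => norm_nonneg _) fun i _ => (h _ _).2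

lemma isGaussianLE_borderedMinor {κ τ : Type} [Fintype κ] [DecidableEq κ]
    {ρ : κ → τ → ℂ} {c : κ → τ} {v : τ → ℂ} {β γ : ℝ} (hρ : ∀ i t, IsGaussianLE β (ρ i t))
    (hv : ∀ t, IsGaussianLE γ (v t)) (t : τ) :
    IsGaussianLE ((Fintype.card κ + 1).factorial * (β ^ Fintype.card κ * γ))
      (borderedMinor ρ c v t) := by
  have h := isGaussianLE_det (M := Matrix.of fun i j : κ ⊕ Unit =>
    (Sum.elim ρ (fun _ => v) i) (Sum.elim c (fun _ => t) j)) (b := Sum.elim (fun _ => β) fun _ => γ)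
    (by rintro (i | i) j
        · exact hρ i _
        · exact hv _)
  rw [borderedMinor]
  simpa using h

variable {τ : Type} [Fintype τ] {rows : List (τ → ℂ)} {ps : List (Pivot τ ℂ)} {β γ : ℝ} {N : ℕ}

/-- The entries of a reduced vector. The last hypothesis says that there are less than `N` pivots,
unless every coordinate is a pivot coordinate. -/
lemma Echelon.isGaussianLE_reduce (h : Echelon rows ps) (hβ : 1 ≤ β) (hγ : 0 ≤ γ)
    (hrows : ∀ w ∈ rows, ∀ t, IsGaussianLE β (w t)) {v : τ → ℂ}
    (hv : ∀ t, IsGaussianLE γ (v t)) (hN : ps.length + 1 ≤ N ∨ ∀ t, ∃ P ∈ ps, P.loc = t) (t : τ) :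
    IsGaussianLE (N.factorial * β ^ N * γ) ((reduce 1 ps v).val t) := by
  rcases hN with hN | hN
  · obtain ⟨κ, _, _, ρ, c, hcard, hρ, hspan, hc, -, hdet⟩ := h.exists_minor
    rw [borderedMinor_eq (v' := (reduce 1 ps v).val) hdet h.lastPivot_ne_zero (hspan ▸ h.reduce_sub_mem v) (fun j => by
      obtain ⟨P, hP, e⟩ := hc j
      rw [← e]
      exact h.reduce_loc v hP) t]
    refine (isGaussianLE_borderedMinor (fun i s => hrows _ (hρ i) s) hv t).mono ?_
    rw [hcard, ← mul_assoc]
    have h1 : ((ps.length + 1).factorial : ℝ) ≤ N.factorial := by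
      exact_mod_cast Nat.factorial_le hN
    have h2 : β ^ ps.length ≤ β ^ N := pow_le_pow_right₀ hβ (by omega)
    gcongr
  -- With every coordinate a pivot coordinate the reduced vector is zero, and no minor of larger
  -- order is needed.
  · obtain ⟨P, hP, rfl⟩ := hN t
    rw [h.reduce_loc v hP]
    exact IsGaussianLE.zero (by positivity)

lemma one_le_factorial_mul_pow (hβ : 1 ≤ β) (N : ℕ) : 1 ≤ (N.factorial : ℝ) * β ^ N :=
  one_le_mul_of_one_le_of_one_le (by exact_mod_cast N.factorial_pos) (one_le_pow₀ hβ)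

/-- The numbers computed in a reduction. -/
lemma Echelon.isGaussianLE_reduce_nums (h : Echelon rows ps) (hβ : 1 ≤ β) (hγ : 1 ≤ γ)
    (hrows : ∀ w ∈ rows, ∀ t, IsGaussianLE β (w t)) {v : τ → ℂ}
    (hv : ∀ t, IsGaussianLE γ (v t)) (hN₀ : ps.length ≤ N)
    (hN : ps.length + 1 ≤ N ∨ ∀ t, ∃ P ∈ ps, P.loc = t) :
    ∀ z ∈ (reduce 1 ps v).nums,
      IsGaussianLE (N.factorial * β ^ N * β * (N.factorial * β ^ N * γ)) z := by
  have hG : 1 ≤ (N.factorial : ℝ) * β ^ N := one_le_factorial_mul_pow hβ N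
  have hGβ : 1 ≤ (N.factorial : ℝ) * β ^ N * β := one_le_mul_of_one_le_of_one_le hG hβ
  have hγ0 : 0 ≤ γ := by linarith
  induction h with
  | nil => simp [reduce]
  | @concat rows ps w t h ht ih =>
    rw [List.length_append, List.length_singleton] at hN₀
    have hrows' : ∀ w' ∈ rows, ∀ t, IsGaussianLE β (w' t) := fun w' hw' =>
      hrows w' (List.mem_append_left _ hw')
    have hw : ∀ t, IsGaussianLE β (w t) := hrows w (by simp)
    have hv1 := h.isGaussianLE_reduce hβ hγ0 hrows' hv (Or.inl hN₀)
    have hr := h.isGaussianLE_reduce hβ (by linarith) hrows' hw (Or.inl hN₀)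
    have hc := h.concat ht
    have hv2 := hc.isGaussianLE_reduce hβ hγ0 hrows hv hN
    intro z hz
    rcases mem_reduce_concat_nums hz with hz | ⟨s, rfl | rfl | rfl | rfl⟩
    · exact ih hrows' (by omega) (Or.inl hN₀) z hz
    · exact (hr t).mul (hv1 s)
    · rw [mul_comm (_ * β)]; exact (hv1 t).mul (hr s)
    -- The difference before division is the previous pivot times the next reduced entry, thus a
    -- product of two bounded Gaussian integers. With no previous pivot the factor is `1`.
    · have hδ := h.lastPivot_ne_zero
      have hδ' : IsGaussianLE (N.factorial * β ^ N * β) (lastPivot 1 ps) := by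
        cases h with
        | nil => exact IsGaussianLE.one hGβ
        | @concat rows ps w' t' h' ht' =>
          rw [lastPivot_concat]
          rw [List.length_append, List.length_singleton] at hN₀
          exact h'.isGaussianLE_reduce hβ (by linarith)
            (fun w'' hw'' => hrows' w'' (List.mem_append_left _ hw'')) (hrows' w' (by simp))
            (Or.inl (by omega)) t'
      have := hδ'.mul (hv2 s)
      rw [reduce_concat_val] at this
      rwa [mul_div_cancel₀ _ hδ] at this
    · refine (hv2 s).mono ?_
      exact le_mul_of_one_le_left (by positivity) hGβ

/-- A list of distinct pivot coordinates that is as long as possible contains all coordinates. -/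
lemma exists_loc_of_length (h : Echelon rows ps)
    (hlen : Fintype.card τ ≤ ps.length) (t : τ) : ∃ P ∈ ps, P.loc = t := by
  classical
  have h1 : (ps.map Pivot.loc).toFinset = Finset.univ := by
    rw [← Finset.card_eq_iff_eq_univ, List.toFinset_card_of_nodup h.nodup_locs, List.length_map]
    refine le_antisymm ?_ hlen
    have := h.nodup_locs.length_le_card
    rwa [List.length_map] at this
  have h2 : t ∈ (ps.map Pivot.loc).toFinset := h1 ▸ Finset.mem_univ t
  simpa using h2

/-- Supplies the alternative required by the size bounds, so that minors of order above the
dimension never enter. -/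
lemma Echelon.length_lt_or (h : Echelon rows ps) :
    ps.length ≤ Fintype.card τ ∧
      (ps.length + 1 ≤ Fintype.card τ ∨ ∀ t, ∃ P ∈ ps, P.loc = t) := by
  have := h.nodup_locs.length_le_card
  rw [List.length_map] at this
  refine ⟨this, ?_⟩
  rcases Nat.lt_or_ge ps.length (Fintype.card τ) with hlt | hge
  · exact Or.inl hlt
  · exact Or.inr (exists_loc_of_length h hge)

lemma isGaussianLE_dot {m : ℕ} {x y : Fin m → ℂ} {a b : ℝ}
    (hx : ∀ i, IsGaussianLE a (x i)) (hy : ∀ i, IsGaussianLE b (y i)) :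
    IsGaussianLE (m * (a * b)) (dot x y).val ∧
      ∀ z ∈ (dot x y).nums, IsGaussianLE (m * (a * b)) z := by
  have key : ∀ l : List (Fin m),
      IsGaussianLE (l.length * (a * b)) (sumList (l.map fun i => mul (x i) (y i))).val ∧
      ∀ z ∈ (sumList (l.map fun i => mul (x i) (y i))).nums,
        IsGaussianLE (l.length * (a * b)) z := by
    intro l
    induction l with
    | nil => simpa [sumList] using IsGaussianLE.zero le_rfl
    | cons i l ih =>
      have hi := (hx i).mul (hy i)
      have h0 := hi.nonneg
      have hl : 0 ≤ (l.length : ℝ) * (a * b) := by positivity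
      have he : (((i :: l).length : ℕ) : ℝ) * (a * b) = a * b + l.length * (a * b) := by
        rw [List.length_cons]; push_cast; ring
      rw [he]
      have hsum := hi.add ih.1
      refine ⟨hsum, ?_⟩
      simp only [List.map_cons, sumList, bind_nums, mul_nums, mul_val, add_nums]
      rintro z (rfl | hz | rfl)
      · exact hi.mono (by linarith)
      · exact (ih.2 z hz).mono (by linarith)
      · exact hsum
  have := key (List.finRange m)
  rwa [List.length_finRange] at this

end Size

/-! ### Growth of the entries along the Wong sequence -/

section AlgorithmSize

variable {n d p : ℕ}

lemma isGaussianLE_tensorUnit {u : Fin n → ℂ} {γ : ℝ} (hγ : 0 ≤ γ)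
    (hu : ∀ t, IsGaussianLE γ (u t)) (a : Fin d) (q : Fin n × Fin d) :
    IsGaussianLE γ (tensorUnit u a q) := by
  unfold tensorUnit
  split_ifs
  · exact hu _
  · exact IsGaussianLE.zero hγ

/-- The vectors computed by `candidates`. -/
lemma isGaussianLE_candidates {A : Fin p → Matrix (Fin n) (Fin n) ℂ} {M T U : ℝ}
    (hA : ∀ i s t, IsGaussianLE M (A i s t)) (hT : n * M ≤ T) (hU : 0 ≤ U)
    {us : List (Fin n × Fin d → ℂ)} (hus : ∀ u ∈ us, ∀ q, IsGaussianLE U (u q))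
    {c : Arith ℂ (Fin n → ℂ)} (hc : c ∈ candidates A us) :
    (∀ t, IsGaussianLE (T * U) (c.val t)) ∧ (∀ z ∈ c.nums, IsGaussianLE (T * U) z) ∧
      c.scratch = ∅ := by
  simp only [candidates, List.mem_flatMap, List.mem_map] at hc
  obtain ⟨u, hu, b, -, j, -, rfl⟩ := hc
  have hle : (n : ℝ) * (M * U) ≤ T * U := by
    rw [← mul_assoc]; exact mul_le_mul_of_nonneg_right hT hU
  have hdot : ∀ s, _ := fun s =>
    isGaussianLE_dot (x := A j s) (y := fun t => u (t, b)) (fun t => hA j s t)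
      (fun t => hus u hu (t, b))
  refine ⟨fun s => (hdot s).1.mono hle, fun z hz => ?_, ?_⟩
  · rw [vec_nums, Set.mem_iUnion] at hz
    obtain ⟨s, hs⟩ := hz
    exact ((hdot s).2 z hs).mono hle
  · simp [dot_scratch]

/-- The numbers in the tableaux of the independence tests for vectors with entries up to `γ`. -/
noncomputable def tableauBound (n : ℕ) (γ : ℝ) : ℝ :=
  n.factorial * γ ^ n * γ * (n.factorial * γ ^ n * γ)

lemma tableauBound_mono {γ γ' : ℝ} (hγ : 0 ≤ γ) (h : γ ≤ γ') :
    tableauBound n γ ≤ tableauBound n γ' := by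
  have hγ' : 0 ≤ γ' := hγ.trans h
  unfold tableauBound
  gcongr

lemma isGaussianLE_select_scratch {cs : List (Arith ℂ (Fin n → ℂ))} {S : Selection n ℂ}
    (hS : Echelon S.basis S.tableau) {γ : ℝ} (hγ : 1 ≤ γ)
    (hb : ∀ w ∈ S.basis, ∀ t, IsGaussianLE γ (w t))
    (hc : ∀ c ∈ cs, ∀ t, IsGaussianLE γ (c.val t)) (hs : ∀ c ∈ cs, c.scratch = ∅) :
    ∀ z ∈ (select cs S).scratch, IsGaussianLE (tableauBound n γ) z := by
  intro z hz
  obtain ⟨c, hcs, hz | ⟨rows, ps, he, hr, hz⟩⟩ := (select_cost cs S hS).2.2 z hz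
  · rw [hs c hcs] at hz
    exact hz.elim
  · have hlen := he.length_lt_or
    rw [Fintype.card_fin] at hlen
    refine he.isGaussianLE_reduce_nums hγ hγ (fun w hw => ?_) (hc c hcs) hlen.1 hlen.2 z hz
    rcases hr w hw with hw | ⟨c', hc', rfl⟩
    · exact hb w hw
    · exact hc c' hc'

/-- With an empty kernel, the Wong sequence vanishes. -/
lemma wongSteps_nil (A : Fin p → Matrix (Fin n) (Fin n) ℂ) (F : Factored n d ℂ) (m : ℕ) :
    (wongSteps A F m [] [] ⟨[], []⟩).val = (⟨[], []⟩, []) ∧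
      (wongSteps A F m [] [] ⟨[], []⟩).nums = ∅ ∧
      (wongSteps A F m [] [] ⟨[], []⟩).scratch = ∅ := by
  induction m with
  | zero => exact ⟨rfl, rfl, rfl⟩
  | succ m ih =>
    simp [wongSteps, candidates, select, mapList, tensorList, ih]

variable {A : Fin p → Matrix (Fin n) (Fin n) ℂ} {F : Factored n d ℂ}
  {rows : List ((Fin n × Fin d) ⊕ (Fin n × Fin d) → ℂ)}

/-- The pseudoinverse of a vector with entries up to `γ`. -/
lemma isGaussianLE_pseudoInverse (hF : Echelon rows F.pivots) {β γ : ℝ} {N : ℕ} (hβ : 1 ≤ β)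
    (hrows : ∀ w ∈ rows, ∀ t, IsGaussianLE β (w t)) (hN : F.pivots.length + 1 ≤ N) (hγ : 1 ≤ γ)
    {w : Fin n × Fin d → ℂ} (hw : ∀ q, IsGaussianLE γ (w q)) :
    (∀ q, IsGaussianLE (N.factorial * β ^ N * γ) ((pseudoInverse F w).val q)) ∧
      (∀ z ∈ (pseudoInverse F w).nums,
        IsGaussianLE (N.factorial * β ^ N * β * (N.factorial * β ^ N * γ)) z) ∧
      (pseudoInverse F w).scratch = ∅ := by
  have hw' : ∀ t, IsGaussianLE γ ((Sum.elim w (0 : Fin n × Fin d → ℂ)) t) := by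
    rintro (q | q)
    · exact hw q
    · exact IsGaussianLE.zero (by linarith)
  refine ⟨fun q => ?_, fun z hz => ?_, ?_⟩
  · exact hF.isGaussianLE_reduce hβ (by linarith) hrows hw' (Or.inl hN) (Sum.inr q)
  · simp only [pseudoInverse, bind_nums, pure_nums, Set.union_empty] at hz
    exact hF.isGaussianLE_reduce_nums hβ hγ hrows hw' (by omega) (Or.inl hN) z hz
  · simp [pseudoInverse, reduce_scratch]

/-- In each step of the Wong sequence, the entries grow by a factor of at most `R`. -/
lemma isGaussianLE_wongSteps (hF : Echelon rows F.pivots) {M T β R R' : ℝ} {N : ℕ}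
    (hA : ∀ i s t, IsGaussianLE M (A i s t)) (hT1 : 1 ≤ T) (hT : n * M ≤ T) (hβ : 1 ≤ β)
    (hrows : ∀ w ∈ rows, ∀ t, IsGaussianLE β (w t)) (hN : F.pivots.length + 1 ≤ N)
    (hR1 : 1 ≤ R) (hR : N.factorial * β ^ N * T ≤ R)
    (hR' : N.factorial * β ^ N * β * (N.factorial * β ^ N * T) ≤ R') (hTR' : T ≤ R')
    (m : ℕ) {U : ℝ} (hU : 1 ≤ U) {fresh us : List (Fin n × Fin d → ℂ)} {S : Selection n ℂ}
    (hS : Echelon S.basis S.tableau)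
    (hfresh : ∀ u ∈ fresh, ∀ q, IsGaussianLE U (u q))
    (hus : ∀ u ∈ us, ∀ q, IsGaussianLE U (u q))
    (hb : ∀ w ∈ S.basis, ∀ t, IsGaussianLE (T * U) (w t)) :
    (∀ w ∈ (wongSteps A F m fresh us S).val.1.basis, ∀ t,
        IsGaussianLE (T * (U * R ^ m)) (w t)) ∧
      (∀ u ∈ (wongSteps A F m fresh us S).val.2, ∀ q, IsGaussianLE (U * R ^ m) (u q)) ∧
      (∀ z ∈ (wongSteps A F m fresh us S).nums, IsGaussianLE (R' * (U * R ^ m)) z) ∧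
      (∀ z ∈ (wongSteps A F m fresh us S).scratch,
        IsGaussianLE (tableauBound n (T * (U * R ^ m))) z) := by
  induction m generalizing U fresh us S with
  | zero =>
    simp only [pow_zero, mul_one]
    exact ⟨hb, hus, by simp [wongSteps], by simp [wongSteps]⟩
  | succ m ih =>
    have hTU : 1 ≤ T * U := one_le_mul_of_one_le_of_one_le hT1 hU
    have hcand := fun c (hc : c ∈ candidates A fresh) =>
      isGaussianLE_candidates hA hT (by linarith) hfresh hc
    obtain ⟨h1, ⟨new, h2, h3⟩, -⟩ := select_correct (candidates A fresh) S hS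
    obtain ⟨-, c2, -⟩ := select_cost (candidates A fresh) S hS
    have c3 := isGaussianLE_select_scratch hS hTU hb (fun c hc => (hcand c hc).1)
      (fun c hc => (hcand c hc).2.2)
    have hdrop : (select (candidates A fresh) S).val.basis.drop S.basis.length = new := by
      rw [h2]; simp
    have hnew : ∀ w ∈ new, ∀ t, IsGaussianLE (T * U) (w t) := by
      intro w hw
      obtain ⟨c, hc, rfl⟩ := h3 w hw
      exact (hcand c hc).1
    have hpinv : ∀ w ∈ tensorList d new, _ := fun w (hw : w ∈ tensorList d new) =>
      isGaussianLE_pseudoInverse (w := w) hF hβ hrows hN hTU (by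
        simp only [tensorList, List.mem_flatMap, List.mem_map] at hw
        obtain ⟨w', hw', a, -, rfl⟩ := hw
        exact isGaussianLE_tensorUnit (by linarith) (hnew w' hw') a)
    have hU0 : 0 ≤ U := by linarith
    have hR0 : 0 ≤ R := by linarith
    have hT0 : 0 ≤ T := by linarith
    have hR'0 : 0 ≤ R' := by linarith
    have hUR : U ≤ U * R := le_mul_of_one_le_right hU0 hR1
    have hfr : ∀ u ∈ (tensorList d new).map fun w => (pseudoInverse F w).val, ∀ q,
        IsGaussianLE (U * R) (u q) := by
      intro u hu q
      obtain ⟨w, hw, rfl⟩ := List.mem_map.1 hu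
      refine ((hpinv w hw).1 q).mono ?_
      calc N.factorial * β ^ N * (T * U) = U * (N.factorial * β ^ N * T) := by ring
        _ ≤ U * R := by gcongr
    obtain ⟨i1, i2, i3, i4⟩ := ih (U := U * R)
      (us := us ++ (tensorList d new).map fun w => (pseudoInverse F w).val)
      (hU.trans hUR) h1 hfr (fun u hu q => by
        rcases List.mem_append.1 hu with hu | hu
        · exact (hus u hu q).mono hUR
        · exact hfr u hu q) (fun w hw t => by
        rw [h2] at hw
        rcases List.mem_append.1 hw with hw | hw
        · exact (hb w hw t).mono (by gcongr)
        · exact (hnew w hw t).mono (by gcongr))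
    have hpow : U * R * R ^ m = U * R ^ (m + 1) := by ring
    have hUm : U ≤ U * R ^ (m + 1) := le_mul_of_one_le_right hU0 (one_le_pow₀ hR1)
    rw [hpow] at i1 i2 i3 i4
    refine ⟨?_, ?_, ?_, ?_⟩
    · rw [wongSteps_succ_val, hdrop]; exact i1
    · rw [wongSteps_succ_val, hdrop]; exact i2
    · simp only [wongSteps, bind_nums, mapList_val, hdrop]
      rintro z (hz | hz | hz)
      · obtain ⟨c, hc, hz⟩ := c2 z hz
        exact ((hcand c hc).2.1 z hz).mono (mul_le_mul hTR' hUm hU0 hR'0)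
      · obtain ⟨w, hw, hz⟩ := mem_mapList_nums.1 hz
        refine ((hpinv w hw).2.1 z hz).mono ?_
        calc _ = N.factorial * β ^ N * β * (N.factorial * β ^ N * T) * U := by ring
          _ ≤ _ := mul_le_mul hR' hUm hU0 hR'0
      · exact i3 z hz
    · simp only [wongSteps, bind_scratch, mapList_val, hdrop]
      rintro z (hz | hz | hz)
      · exact (c3 z hz).mono (tableauBound_mono (by linarith) (by gcongr))
      · obtain ⟨w, hw, hz⟩ := mem_mapList_scratch.1 hz
        rw [(hpinv w hw).2.2] at hz
        exact hz.elim
      · exact i4 z hz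

end AlgorithmSize

/-! ### The size of the numbers of the algorithm -/

section AlgorithmBound

variable {n d p : ℕ}

/-- With every bound a power of one base `T`, the size estimates become inequalities between
exponents. -/
lemma factorial_mul_pow_le {T : ℝ} (m e : ℕ) (hm : (m : ℝ) ≤ T) :
    (m.factorial : ℝ) * (T ^ e) ^ m ≤ T ^ (m + e * m) := by
  have h0 : 0 ≤ T := (Nat.cast_nonneg m).trans hm
  rw [pow_add, pow_mul]
  refine mul_le_mul_of_nonneg_right ?_ (by positivity)
  calc (m.factorial : ℝ) ≤ (m : ℝ) ^ m := by exact_mod_cast Nat.factorial_le_pow m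
    _ ≤ T ^ m := by gcongr

lemma tableauBound_pow_le {T : ℝ} (hT : 1 ≤ T) (hn : (n : ℝ) ≤ T) {γ : ℝ} (hγ0 : 0 ≤ γ) {e : ℕ}
    (hγ : γ ≤ T ^ e) : tableauBound n γ ≤ T ^ (2 * (n + e * n + e)) := by
  have h0 : 0 ≤ T := by linarith
  refine (tableauBound_mono hγ0 hγ).trans ?_
  have h := factorial_mul_pow_le n e hn
  have h' : (n.factorial : ℝ) * (T ^ e) ^ n * T ^ e ≤ T ^ (n + e * n + e) := by
    rw [pow_add T (n + e * n)]; gcongr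
  rw [two_mul, pow_add]
  exact mul_le_mul h' h' (by positivity) (by positivity)

lemma isGaussianLE_blowUpElement {A : Fin p → Matrix (Fin n) (Fin n) ℂ}
    {X : Fin p → Matrix (Fin d) (Fin d) ℂ} {M : ℝ} {k : ℕ} (hM : 1 ≤ M) (hd : 0 < d) (hk : 0 < k)
    (hp : p ≤ n * n) (hA : ∀ i s t, IsGaussianLE M (A i s t))
    (hX : ∀ i a b, ∃ x < 2 * d * k, X i a b = (x : ℂ)) :
    (∀ q q', IsGaussianLE ((M * n * d * k) ^ 2) ((blowUpElement A X).val q q')) ∧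
      ∀ z ∈ (blowUpElement A X).nums, IsGaussianLE ((M * n * d * k) ^ 2) z := by
  have hX' : ∀ i a b, IsGaussianLE ((d * k : ℝ) ^ 2) (X i a b) := by
    intro i a b
    obtain ⟨x, hx, e⟩ := hX i a b
    rw [e]
    refine (IsGaussianLE.natCast x).mono ?_
    have h1 : (x : ℝ) + 1 ≤ 2 * d * k := by exact_mod_cast hx
    -- From `x ≤ 2dk - 1 ≤ (dk)²`. With `p ≤ n²` and `M ≤ M²`, the entries of `B` are at most `T²`,
    -- without a constant factor.
    nlinarith [sq_nonneg ((d : ℝ) * k - 1)]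
  have hle : (p : ℝ) * (M * (d * k : ℝ) ^ 2) ≤ (M * n * d * k) ^ 2 := by
    have hp' : (p : ℝ) ≤ n * n := by exact_mod_cast hp
    have hMM : M ≤ M * M := le_mul_of_one_le_left (by linarith) hM
    calc (p : ℝ) * (M * (d * k : ℝ) ^ 2) ≤ (n * n) * (M * M * (d * k : ℝ) ^ 2) := by gcongr
      _ = _ := by ring
  have hdot : ∀ q q', _ := fun (q q' : Fin n × Fin d) =>
    isGaussianLE_dot (x := fun i => A i q.1 q'.1) (y := fun i => X i q.2 q'.2)
      (fun i => hA i _ _) (fun i => hX' i _ _)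
  refine ⟨fun q q' => (hdot q q').1.mono hle, fun z hz => ?_⟩
  simp only [blowUpElement, vec_nums, Set.mem_iUnion] at hz
  obtain ⟨q, q', hz⟩ := hz
  exact ((hdot q q').2 z hz).mono hle

lemma isGaussianLE_extCol {B : Matrix (Fin n × Fin d) (Fin n × Fin d) ℂ} {β : ℝ} (hβ : 1 ≤ β)
    (hB : ∀ q q', IsGaussianLE β (B q q')) (q : Fin n × Fin d)
    (t : (Fin n × Fin d) ⊕ (Fin n × Fin d)) : IsGaussianLE β (extCol B q t) := by
  rcases t with t | t
  · exact hB t q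
  · change IsGaussianLE β ((Pi.single q 1 : Fin n × Fin d → ℂ) t)
    by_cases h : t = q
    · subst h; rw [Pi.single_eq_same]; exact IsGaussianLE.one hβ
    · rw [Pi.single_eq_of_ne h]; exact IsGaussianLE.zero (by linarith)

/-- The numbers computed by `factor`, for a matrix with entries up to `T²`. -/
lemma isGaussianLE_factor {B : Matrix (Fin n × Fin d) (Fin n × Fin d) ℂ} {T : ℝ} (hT : 1 ≤ T)
    (hnd : 0 < n * d) (hndT : ((n * d : ℕ) : ℝ) ≤ T)
    (hB : ∀ q q', IsGaussianLE (T ^ 2) (B q q')) :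
    (∀ z ∈ (factor B (coords n d) ⟨[], []⟩).nums, IsGaussianLE (T ^ (10 * (n * d))) z) ∧
      (∀ x ∈ (factor B (coords n d) ⟨[], []⟩).val.kernel, ∀ q,
        IsGaussianLE (T ^ (5 * (n * d))) (x q)) ∧
      (∀ P ∈ (factor B (coords n d) ⟨[], []⟩).val.pivots, ∀ t,
        IsGaussianLE (T ^ (5 * (n * d))) (P.row t)) := by
  have hβ : 1 ≤ T ^ 2 := one_le_pow₀ hT
  have hT0 : 0 ≤ T := by linarith
  have hcol := isGaussianLE_extCol hβ hB
  obtain ⟨-, -, f1, f2, f3⟩ := factor_cost (B := B) (coords n d) isPartialFactor_nil (N := n * d)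
    (by simp [length_coords])
  have hG := factorial_mul_pow_le (n * d) 2 hndT
  have hval : ∀ ps q, IsFactorStage B (n * d) ps → ∀ t,
      IsGaussianLE (T ^ (5 * (n * d))) ((reduce 1 ps (extCol B q)).val t) := by
    rintro ps q ⟨hlen, rows, he, hr⟩ t
    refine (he.isGaussianLE_reduce hβ (by positivity) (fun w hw s => ?_) (hcol q)
      (Or.inl hlen) t).mono ?_
    · obtain ⟨q', rfl⟩ := hr w hw
      exact hcol q' s
    · calc _ ≤ T ^ (n * d + 2 * (n * d)) * T ^ 2 := by gcongr
        _ = T ^ (n * d + 2 * (n * d) + 2) := (pow_add _ _ _).symm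
        _ ≤ _ := pow_le_pow_right₀ hT (by omega)
  refine ⟨?_, ?_, ?_⟩
  · intro z hz
    obtain ⟨ps, q, ⟨hlen, rows, he, hr⟩, hz⟩ := f1 z hz
    refine (he.isGaussianLE_reduce_nums hβ hβ (fun w hw s => ?_) (hcol q) (by omega)
      (Or.inl hlen) z hz).mono ?_
    · obtain ⟨q', rfl⟩ := hr w hw
      exact hcol q' s
    · calc _ ≤ T ^ (n * d + 2 * (n * d)) * T ^ 2 * (T ^ (n * d + 2 * (n * d)) * T ^ 2) := by
            gcongr
        _ = T ^ (6 * (n * d) + 4) := by ring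
        _ ≤ _ := pow_le_pow_right₀ hT (by omega)
  · intro x hx q'
    rcases f2 x hx with hx | ⟨ps, q, hst, rfl⟩
    · simp at hx
    · exact hval ps q hst _
  · intro P hP t
    rcases f3 P hP with hP | ⟨ps, q, hst, e⟩
    · simp at hP
    · rw [e]; exact hval ps q hst t

/-- The numbers computed in the Wong sequence, for a matrix with entries up to `T²`. -/
lemma isGaussianLE_wong {A : Fin p → Matrix (Fin n) (Fin n) ℂ}
    {B : Matrix (Fin n × Fin d) (Fin n × Fin d) ℂ} {M T : ℝ} (hT : 1 ≤ T)
    (hnd : 0 < n * d) (hndT : ((n * d : ℕ) : ℝ) ≤ T) (hnM : n * M ≤ T)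
    (hA : ∀ i s t, IsGaussianLE M (A i s t)) (hB : ∀ q q', IsGaussianLE (T ^ 2) (B q q'))
    {F : Factored n d ℂ} (hF : F = (factor B (coords n d) ⟨[], []⟩).val)
    {R : Arith ℂ (Selection n ℂ × List (Fin n × Fin d → ℂ))}
    (hR : R = wongSteps A F n F.kernel F.kernel ⟨[], []⟩) :
    (∀ w ∈ R.val.1.basis, ∀ t, IsGaussianLE (T ^ (10 * (n * (n * d)))) (w t)) ∧
      (∀ u ∈ R.val.2, ∀ q, IsGaussianLE (T ^ (9 * (n * (n * d)))) (u q)) ∧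
      (∀ z ∈ R.nums, IsGaussianLE (T ^ (18 * (n * (n * d)))) z) ∧
      (∀ z ∈ R.scratch, IsGaussianLE (T ^ (42 * (n * (n * (n * d))))) z) := by
  have hT0 : 0 ≤ T := by linarith
  have hn : 0 < n := Nat.pos_of_mul_pos_right hnd
  have hd : 0 < d := Nat.pos_of_mul_pos_left hnd
  -- An empty kernel means `nd` pivots, too many for minors of order at most `nd`; but then the Wong
  -- sequence has nothing to process. Otherwise there are at most `nd - 1` pivots.
  by_cases hker : F.kernel = []
  · rw [hker] at hR
    obtain ⟨h1, h2, h3⟩ := wongSteps_nil A F n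
    rw [hR, h1, h2, h3]
    simp
  · have hβ : 1 ≤ T ^ 2 := one_le_pow₀ hT
    obtain ⟨rows, hf⟩ := exists_isFactor B
    rw [← hF] at hf
    have hlen : F.pivots.length + 1 ≤ n * d := by
      have h1 := hf.2.1
      have h2 := List.length_pos_iff.2 hker
      omega
    have hkb := (isGaussianLE_factor hT hnd hndT hB).2.1
    rw [← hF] at hkb
    have hG := factorial_mul_pow_le (n * d) 2 hndT
    have hN : n * d ≤ n * (n * d) := Nat.le_mul_of_pos_left _ hn
    have hN2 : n * (n * d) ≤ n * (n * (n * d)) := Nat.le_mul_of_pos_left _ hn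
    have hN3 : n ≤ n * d := Nat.le_mul_of_pos_right _ hd
    have hnT : (n : ℝ) ≤ T := (Nat.cast_le.2 hN3).trans hndT
    -- Kernel vectors start at exponent `5nd`, and each of the `n` rounds adds `4nd`.
    have hU : T ^ (5 * (n * d)) * (T ^ (4 * (n * d))) ^ n ≤ T ^ (9 * (n * (n * d))) := by
      rw [← pow_mul, ← pow_add]
      refine pow_le_pow_right₀ hT ?_
      rw [show 4 * (n * d) * n = 4 * (n * (n * d)) by ring]
      omega
    obtain ⟨w1, w2, w3, w4⟩ := isGaussianLE_wongSteps (A := A) (T := T) (β := T ^ 2)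
      (R := T ^ (4 * (n * d))) (R' := T ^ (9 * (n * d))) (N := n * d) hf.1.1 hA hT hnM hβ
      (fun w hw t => by
        obtain ⟨q, rfl⟩ := hf.1.2.1 w hw
        exact isGaussianLE_extCol hβ hB q t) hlen (one_le_pow₀ hT)
      (by
        calc _ ≤ T ^ (n * d + 2 * (n * d)) * T := by gcongr
          _ = T ^ (n * d + 2 * (n * d) + 1) := (pow_succ _ _).symm
          _ ≤ _ := pow_le_pow_right₀ hT (by omega))
      (by
        calc _ ≤ T ^ (n * d + 2 * (n * d)) * T ^ 2 * (T ^ (n * d + 2 * (n * d)) * T) := by gcongr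
          _ = T ^ (6 * (n * d) + 3) := by ring
          _ ≤ _ := pow_le_pow_right₀ hT (by omega))
      (le_self_pow₀ hT (by omega)) n (U := T ^ (5 * (n * d))) (one_le_pow₀ hT)
      (fresh := F.kernel) (us := F.kernel) (S := ⟨[], []⟩) Echelon.nil hkb hkb (by simp)
    rw [← hR] at w1 w2 w3 w4
    have hTU : T * (T ^ (5 * (n * d)) * (T ^ (4 * (n * d))) ^ n) ≤
        T ^ (10 * (n * (n * d))) := by
      calc _ ≤ T * T ^ (9 * (n * (n * d))) := by gcongr
        _ = T ^ (9 * (n * (n * d)) + 1) := (pow_succ' _ _).symm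
        _ ≤ _ := pow_le_pow_right₀ hT (by omega)
    refine ⟨fun w hw t => (w1 w hw t).mono hTU, fun u hu q => (w2 u hu q).mono hU,
      fun z hz => (w3 z hz).mono ?_, fun z hz => (w4 z hz).mono ?_⟩
    · calc _ ≤ T ^ (9 * (n * d)) * T ^ (9 * (n * (n * d))) := by gcongr
        _ = T ^ (9 * (n * d) + 9 * (n * (n * d))) := (pow_add _ _ _).symm
        _ ≤ _ := pow_le_pow_right₀ hT (by omega)
    -- The exponent is `2(n + 10n³d + 10n²d) ≤ 42n³d`.
    · refine (tableauBound_pow_le hT hnT (by positivity) hTU).trans (pow_le_pow_right₀ hT ?_)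
      rw [show 10 * (n * (n * d)) * n = 10 * (n * (n * (n * d))) by ring]
      omega

theorem isGaussianLE_algorithm {A : Fin p → Matrix (Fin n) (Fin n) ℂ}
    {X : Fin p → Matrix (Fin d) (Fin d) ℂ} {M : ℝ} {k : ℕ} (hM : 1 ≤ M) (hn : 0 < n) (hd : 0 < d)
    (hk : 0 < k) (hp : p ≤ n * n) (hA : ∀ i s t, IsGaussianLE M (A i s t))
    (hX : ∀ i a b, ∃ x < 2 * d * k, X i a b = (x : ℂ)) :
    (∀ z ∈ (algorithm A X).nums ∪ (algorithm A X).val.entries,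
        IsGaussianLE ((M * n * d * k) ^ (18 * (n * (n * d)))) z) ∧
      ∀ z ∈ (algorithm A X).scratch,
        IsGaussianLE ((M * n * d * k) ^ (42 * (n * (n * (n * d))))) z := by
  obtain ⟨b1, b2⟩ := isGaussianLE_blowUpElement hM hd hk hp hA hX
  have hn1 : (1 : ℝ) ≤ n := by exact_mod_cast hn
  have hd1 : (1 : ℝ) ≤ d := by exact_mod_cast hd
  have hk1 : (1 : ℝ) ≤ k := by exact_mod_cast hk
  have hM0 : 0 ≤ M := by linarith
  set T : ℝ := M * n * d * k with hTdef
  have hnM : n * M ≤ T := by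
    calc (n : ℝ) * M = M * n * 1 * 1 := by ring
      _ ≤ T := by rw [hTdef]; gcongr
  have hndT : ((n * d : ℕ) : ℝ) ≤ T := by
    push_cast
    calc (n : ℝ) * d = 1 * n * d * 1 := by ring
      _ ≤ T := by rw [hTdef]; gcongr
  have hT : 1 ≤ T := (one_le_mul_of_one_le_of_one_le hn1 hM).trans hnM
  have hT0 : 0 ≤ T := by linarith
  have hnd : 0 < n * d := Nat.mul_pos hn hd
  have hN : n * d ≤ n * (n * d) := Nat.le_mul_of_pos_left _ hn
  have hN2 : n * (n * d) ≤ n * (n * (n * d)) := Nat.le_mul_of_pos_left _ hn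
  have hN3 : n ≤ n * d := Nat.le_mul_of_pos_right _ hd
  have hnT : (n : ℝ) ≤ T := (Nat.cast_le.2 hN3).trans hndT
  set B := (blowUpElement A X).val with hB
  obtain ⟨f1, f2, f3⟩ := isGaussianLE_factor hT hnd hndT b1
  have f4 := (factor_cost (B := B) (coords n d) isPartialFactor_nil (N := n * d)
    (by simp [length_coords])).2.1
  obtain ⟨w1, w2, w3, w4⟩ := isGaussianLE_wong hT hnd hndT hnM hA b1 rfl rfl
  set F := (factor B (coords n d) ⟨[], []⟩).val with hF
  set R := wongSteps A F n F.kernel F.kernel ⟨[], []⟩ with hR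
  let cs : List (Arith ℂ (Fin n → ℂ)) :=
    R.val.2.flatMap fun u => (List.finRange d).map fun b => pure fun t => u (t, b)
  have hcs : ∀ c ∈ cs, (∀ t, IsGaussianLE (T ^ (9 * (n * (n * d)))) (c.val t)) ∧
      c.nums = ∅ ∧ c.scratch = ∅ := by
    intro c hc
    simp only [cs, List.mem_flatMap, List.mem_map] at hc
    obtain ⟨u, hu, b, -, rfl⟩ := hc
    exact ⟨fun t => w2 u hu _, rfl, rfl⟩
  have s1 := isGaussianLE_select_scratch (S := ⟨[], []⟩) Echelon.nil (one_le_pow₀ hT) (by simp)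
    (fun c hc => (hcs c hc).1) fun c hc => (hcs c hc).2.2
  have s2 := (select_cost cs ⟨[], []⟩ Echelon.nil).2.1
  obtain ⟨-, ⟨new, s3, s4⟩, -⟩ := select_correct cs ⟨[], []⟩ Echelon.nil
  have hpow : ∀ {e e' : ℕ} {z : ℂ}, e ≤ e' → IsGaussianLE (T ^ e) z → IsGaussianLE (T ^ e') z :=
    fun he hz => hz.mono (pow_le_pow_right₀ hT he)
  constructor
  · rintro z (hz | hz)
    · simp only [algorithm, bind_nums, pure_nums, ← hB, ← hF, ← hR, Set.union_empty] at hz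
      rcases hz with hz | hz | hz | hz
      · exact hpow (by omega) (b2 z hz)
      · exact hpow (by omega) (f1 z hz)
      · exact w3 z hz
      · obtain ⟨c, hc, hz⟩ := s2 z hz
        rw [(hcs c hc).2.1] at hz
        exact hz.elim
    · simp only [algorithm, bind_val, pure_val, ← hB, ← hF, ← hR, Result.entries,
        Set.mem_ofPred_eq] at hz
      rcases hz with ⟨i, j, rfl⟩ | ⟨P, hP, i, rfl⟩ | ⟨u, hu, i, rfl⟩ | ⟨w, hw, i, rfl⟩ |
        ⟨u, hu, i, rfl⟩ | ⟨u, hu, i, rfl⟩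
      · exact hpow (by omega) (b1 i j)
      · exact hpow (by omega) (f3 P hP i)
      · exact hpow (by omega) (f2 u hu i)
      · exact hpow (by omega) (w1 w hw i)
      · exact hpow (by omega) (w2 u hu i)
      · change u ∈ (select cs ⟨[], []⟩).val.basis at hu
        rw [s3, List.nil_append] at hu
        obtain ⟨c, hc, rfl⟩ := s4 u hu
        exact hpow (by omega) ((hcs c hc).1 i)
  · intro z hz
    simp only [algorithm, bind_scratch, pure_scratch, ← hB, ← hF, ← hR, Set.union_empty, f4,
      Set.empty_union] at hz
    rcases hz with hz | hz | hz
    · simp [blowUpElement, dot_scratch] at hz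
    · exact w4 z hz
    · refine (s1 z hz).mono ((tableauBound_pow_le hT hnT (by positivity) le_rfl).trans
        (pow_le_pow_right₀ hT ?_))
      rw [show 9 * (n * (n * d)) * n = 9 * (n * (n * (n * d))) by ring]
      omega

end AlgorithmBound

/-! ### The probability of success -/

section Probability

variable {n d p : ℕ}

/-- A polynomial of degree at most `rk (∑ A_i ⊗ X_i)` that certifies that rank. -/
lemma exists_rank_polynomial (A : Fin p → Matrix (Fin n) (Fin n) ℂ)
    (X : Fin p → Matrix (Fin d) (Fin d) ℂ) :
    ∃ P : MvPolynomial (Fin p × Fin d × Fin d) ℂ, P.totalDegree ≤ (∑ i, A i ⊗ₖ X i).rank ∧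
      MvPolynomial.eval (fun v => X v.1 v.2.1 v.2.2) P ≠ 0 ∧
      ∀ Y : Fin p → Matrix (Fin d) (Fin d) ℂ,
        MvPolynomial.eval (fun v => Y v.1 v.2.1 v.2.2) P ≠ 0 →
        (∑ i, A i ⊗ₖ X i).rank ≤ (∑ i, A i ⊗ₖ Y i).rank := by
  -- In rank normal form a fixed `r × r` submatrix of `V (∑ A_i ⊗ X_i) U` is the identity. The same
  -- minor with indeterminates for the entries of the `X_i` has linear entries, hence degree at most
  -- `r`; where it is nonzero, the rank is at least `r`.
  obtain ⟨r, hr, V, U, e, hVU⟩ : ∃ r, (∑ i, A i ⊗ₖ X i).rank = r ∧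
      ∃ (V U : Matrix (Fin n × Fin d) (Fin n × Fin d) ℂ)
        (e : Fin n × Fin d ≃ Fin r ⊕ Fin (Fintype.card (Fin n × Fin d) - r)),
        V * (∑ i, A i ⊗ₖ X i) * U = (Matrix.fromBlocks 1 0 0 0).submatrix e e := by
    obtain ⟨V, U, e, -, -, hVU⟩ := Matrix.exists_rank_normal_form (∑ i, A i ⊗ₖ X i)
    exact ⟨_, rfl, V, U, e, hVU⟩
  rw [hr]
  let f : Fin r → Fin n × Fin d := fun i => e.symm (Sum.inl i)
  let G : Matrix (Fin n × Fin d) (Fin n × Fin d) (MvPolynomial (Fin p × Fin d × Fin d) ℂ) :=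
    Matrix.of fun q q' => ∑ i, MvPolynomial.C (A i q.1 q'.1) * MvPolynomial.X (i, q.2, q'.2)
  let Q : Matrix (Fin r) (Fin r) (MvPolynomial (Fin p × Fin d × Fin d) ℂ) :=
    (V.map MvPolynomial.C * G * U.map MvPolynomial.C).submatrix f f
  have heval : ∀ Y : Fin p → Matrix (Fin d) (Fin d) ℂ,
      MvPolynomial.eval (fun v => Y v.1 v.2.1 v.2.2) Q.det =
        ((V * (∑ i, A i ⊗ₖ Y i) * U).submatrix f f).det := by
    intro Y
    rw [RingHom.map_det]
    refine congrArg Matrix.det ?_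
    ext i j
    simp only [RingHom.mapMatrix_apply, Matrix.map_apply, Q, Matrix.submatrix_apply,
      Matrix.mul_apply, map_sum, map_mul, MvPolynomial.eval_C, G, Matrix.of_apply,
      MvPolynomial.eval_X, Matrix.sum_apply, Matrix.kroneckerMap_apply]
  refine ⟨Q.det, ?_, ?_, fun Y hY => ?_⟩
  · have hG : ∀ q q', (G q q').totalDegree ≤ 1 := by
      intro q q'
      simp only [G, Matrix.of_apply]
      refine MvPolynomial.totalDegree_finsetSum_le fun i _ => ?_
      refine (MvPolynomial.totalDegree_mul _ _).trans ?_
      rw [MvPolynomial.totalDegree_C, MvPolynomial.totalDegree_X]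
    have hQ : ∀ i j, (Q i j).totalDegree ≤ 1 := by
      intro i j
      simp only [Q, Matrix.submatrix_apply, Matrix.mul_apply, Matrix.map_apply]
      refine MvPolynomial.totalDegree_finsetSum_le fun q _ => ?_
      refine (MvPolynomial.totalDegree_mul _ _).trans ?_
      rw [MvPolynomial.totalDegree_C, add_zero]
      refine MvPolynomial.totalDegree_finsetSum_le fun q' _ => ?_
      refine (MvPolynomial.totalDegree_mul _ _).trans ?_
      rw [MvPolynomial.totalDegree_C, zero_add]
      exact hG _ _
    rw [Matrix.det_apply]
    refine MvPolynomial.totalDegree_finsetSum_le fun σ _ => ?_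
    have hprod : (∏ i, Q (σ i) i).totalDegree ≤ r := by
      refine (MvPolynomial.totalDegree_finsetProd _ _).trans ?_
      refine (Finset.sum_le_card_nsmul _ _ 1 fun i _ => hQ _ _).trans ?_
      simp
    rcases Int.units_eq_one_or (Equiv.Perm.sign σ) with h | h <;> rw [h]
    · rwa [one_smul]
    · rwa [Units.neg_smul, one_smul, MvPolynomial.totalDegree_neg]
  · rw [heval, hVU, Matrix.submatrix_submatrix]
    have : (Matrix.fromBlocks (1 : Matrix (Fin r) (Fin r) ℂ) 0 0
        (0 : Matrix (Fin (Fintype.card (Fin n × Fin d) - r))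
          (Fin (Fintype.card (Fin n × Fin d) - r)) ℂ)).submatrix (e ∘ f) (e ∘ f) = 1 := by
      ext i j
      simp [f]
    rw [this, Matrix.det_one]
    exact one_ne_zero
  · rw [heval] at hY
    have h1 := Matrix.rank_of_det_ne_zero hY
    rw [Fintype.card_fin] at h1
    rw [← h1]
    exact (Matrix.rank_submatrix_le _ _ _).trans
      ((Matrix.rank_mul_le_left _ _).trans (Matrix.rank_mul_le_right _ _))

/-- By the Schwartz–Zippel lemma, at least half of the draws yield at least the rank of a given
element, if this rank is at most `d k`. -/
lemma card_draw_le {k : ℕ} (hd : 0 < d) (hk : 0 < k) (A : Fin p → Matrix (Fin n) (Fin n) ℂ)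
    (X : Fin p → Matrix (Fin d) (Fin d) ℂ) (hr : (∑ i, A i ⊗ₖ X i).rank ≤ d * k)
    {G : Finset (Draw p d k)}
    (hG : ∀ Y : Draw p d k, (∑ i, A i ⊗ₖ X i).rank ≤
      (∑ i, A i ⊗ₖ Matrix.of fun a b => ((Y i a b : ℕ) : ℂ)).rank → Y ∈ G) :
    Fintype.card (Draw p d k) ≤ 2 * G.card := by
  classical
  obtain ⟨P, hdeg, hP0, hP⟩ := exists_rank_polynomial A X
  let e := Fintype.equivFin (Fin p × Fin d × Fin d)
  let S : Finset ℂ := (Finset.range (2 * d * k)).image fun x : ℕ => (x : ℂ)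
  have hS : S.card = 2 * d * k := by
    rw [Finset.card_image_of_injective _ Nat.cast_injective, Finset.card_range]
  have hSpos : 0 < 2 * d * k := by positivity
  have hne : MvPolynomial.rename e P ≠ 0 := by
    intro h
    apply hP0
    have := congrArg (MvPolynomial.eval ((fun v => X v.1 v.2.1 v.2.2) ∘ e.symm)) h
    rwa [MvPolynomial.eval_rename, Function.comp_assoc, Equiv.symm_comp_self, Function.comp_id,
      map_zero] at this
  have hsz := MvPolynomial.schwartz_zippel_totalDegree hne S
  set Z := {f ∈ Fintype.piFinset fun _ : Fin (Fintype.card (Fin p × Fin d × Fin d)) => S |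
    MvPolynomial.eval f (MvPolynomial.rename e P) = 0} with hZ
  have hcardpow : Fintype.card (Draw p d k) =
      (2 * d * k) ^ Fintype.card (Fin p × Fin d × Fin d) := by
    simp only [Fintype.card_fun, Fintype.card_fin, Fintype.card_prod]
    rw [← pow_mul, ← pow_mul]
    congr 1
    ring
  -- Bad draws inject into the zeros of the polynomial on the grid, whose proportion is at most `dk
  -- / (2dk)`.
  have hbad : (Gᶜ).card ≤ Z.card := by
    refine Finset.card_le_card_of_injOn
      (fun Y => (fun v : Fin p × Fin d × Fin d => ((Y v.1 v.2.1 v.2.2 : ℕ) : ℂ)) ∘ e.symm) ?_ ?_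
    · intro Y hY
      rw [Finset.mem_coe, Finset.mem_compl] at hY
      rw [Finset.mem_coe, hZ, Finset.mem_filter, Fintype.mem_piFinset]
      refine ⟨fun v => Finset.mem_image.2 ⟨_, Finset.mem_range.2 (Y _ _ _).2, rfl⟩, ?_⟩
      rw [MvPolynomial.eval_rename, Function.comp_assoc, Equiv.symm_comp_self, Function.comp_id]
      by_contra h
      exact hY (hG Y (hP (fun i => Matrix.of fun a b => ((Y i a b : ℕ) : ℂ)) h))
    · intro Y _ Y' _ h
      funext i a b
      have := congrFun h (e (i, a, b))
      simp only [Function.comp_apply, Equiv.symm_apply_apply, Nat.cast_inj] at this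
      exact Fin.ext this
  have hdeg' : (MvPolynomial.rename e P).totalDegree ≤ d * k :=
    ((MvPolynomial.totalDegree_rename_le _ _).trans hdeg).trans hr
  rw [hS, div_le_div_iff₀ (by positivity) (by positivity)] at hsz
  have hsz' : Z.card * (2 * d * k) ≤
      (MvPolynomial.rename e P).totalDegree *
        (2 * d * k) ^ Fintype.card (Fin p × Fin d × Fin d) := by
    exact_mod_cast hsz
  rw [← hcardpow] at hsz'
  have hZ2 : 2 * Z.card ≤ Fintype.card (Draw p d k) := by
    refine Nat.le_of_mul_le_mul_left (c := d * k) ?_ (by positivity)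
    calc d * k * (2 * Z.card) = Z.card * (2 * d * k) := by ring
      _ ≤ _ := hsz'
      _ ≤ _ := Nat.mul_le_mul_right _ hdeg'
  have := Finset.card_add_card_compl G
  omega

lemma half_le_uniformOn {Ω : Type} [Fintype Ω] [Nonempty Ω] [MeasurableSpace Ω]
    [MeasurableSingletonClass Ω] (s : Set Ω) [DecidablePred (· ∈ s)]
    (h : Fintype.card Ω ≤ 2 * (Finset.univ.filter (· ∈ s)).card) :
    (1 / 2 : ENNReal) ≤ ProbabilityTheory.uniformOn Set.univ s := by
  have hs : s = ((Finset.univ.filter (· ∈ s) : Finset Ω) : Set Ω) := by ext; simp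
  rw [ProbabilityTheory.uniformOn_univ]
  conv_rhs => rw [hs]
  rw [MeasureTheory.Measure.count_apply_finset]
  have hpos : (Fintype.card Ω : ENNReal) ≠ 0 := by
    exact_mod_cast Fintype.card_ne_zero
  rw [ENNReal.le_div_iff_mul_le (Or.inl hpos) (Or.inl (ENNReal.natCast_ne_top _)), mul_comm,
    mul_one_div]
  refine ENNReal.div_le_of_le_mul ?_
  rw [mul_comm]
  exact_mod_cast h

/-- The optimal element has rank at most `d · ncrank ≤ dk`, and any draw reaching its rank is again
of maximal relative rank. -/
theorem half_le_probability {k : ℕ} (A : Fin p → Matrix (Fin n) (Fin n) GaussianInt)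
    (hk : 0 < k) (hd : IsMinBlowUpSize (toComplexMat A) d)
    (hrk : ncrank (matrixSpace (toComplexMat A)) ≤ k) :
    (1 / 2 : ENNReal) ≤
      ProbabilityTheory.uniformOn Set.univ {X : Draw p d k | Successful A X} := by
  classical
  obtain ⟨⟨hd0, X, hX⟩, -⟩ := hd
  have hmax := isMaxRatio_of_blowUpRatio_le hd0 hX
  have : Nonempty (Fin (2 * d * k)) := ⟨⟨0, by positivity⟩⟩
  refine half_le_uniformOn _ (card_draw_le hd0 hk (toComplexMat A) X
    ((rank_le_mul_ncrank _ X).trans (Nat.mul_le_mul_left d hrk)) fun Y hY => ?_)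
  rw [Finset.mem_filter]
  refine ⟨Finset.mem_univ _, successful_of_isMaxRatio hd0 A Y fun κ _ Z => ?_⟩
  exact (hmax κ Z).trans (Nat.mul_le_mul_left _ hY)

end Probability

/-! ### The main theorem -/

lemma IsGaussianLE.isGaussianIntLE {T b : ℝ} (hT : 0 < T) {e : ℕ} {z : ℂ}
    (hz : IsGaussianLE (T ^ e) z) (hb : e * Real.log T ≤ b) : IsGaussianIntLE z b := by
  obtain ⟨⟨g, hg⟩, hle⟩ := hz
  refine ⟨⟨g, hg.symm⟩, hle.trans ?_⟩
  rw [← Real.exp_log (pow_pos hT e), Real.log_pow]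
  exact Real.exp_le_exp.2 hb

end ShrunkSubspace

open ShrunkSubspace in
theorem mainTheorem9 :
    ∃ C : ℝ, 0 < C ∧
      ∀ (p n d k : ℕ) (M : ℝ) (A : Fin p → Matrix (Fin n) (Fin n) GaussianInt),
        0 < p →
        LinearIndependent ℂ (toComplexMat A) →
        (∀ i a b, ‖GaussianInt.toComplex (A i a b)‖ ≤ M) →
        IsMinBlowUpSize (toComplexMat A) d →
        ncrank (matrixSpace (toComplexMat A)) ≤ k →
        (1 / 2 : ENNReal) ≤
            ProbabilityTheory.uniformOn Set.univ {X : Draw p d k | Successful A X} ∧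
          ∀ X : Draw p d k,
            ((run A X).ops : ℝ) ≤ C * (p * d ^ 4 * n ^ 4) ∧
            (∀ z ∈ (run A X).nums ∪ (run A X).val.entries,
              IsGaussianIntLE z
                (C * (n ^ 2 * d ^ 2 * Real.log (M * n * d * k) + n * d * Real.log M))) ∧
            (∀ z ∈ (run A X).scratch,
              IsGaussianIntLE z
                (C * (n * (n ^ 2 * d ^ 2 * Real.log (M * n * d * k) + n * d * Real.log M)))) := by
  -- The constant comes from the operation count; it also covers the exponents 18 and 42 of the size
  -- bounds.
  refine ⟨234, by norm_num, fun p n d k M A hp hA hM hd hk => ?_⟩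
  have hd0 : 0 < d := hd.1.1
  have hpn : p ≤ n * n := by
    have := hA.fintype_card_le_finrank
    simpa [Module.finrank_matrix] using this
  have hn : 0 < n := by
    rcases Nat.eq_zero_or_pos n with rfl | h
    · omega
    · exact h
  -- some entry is a nonzero Gaussian integer
  obtain ⟨i, a, b, hne⟩ : ∃ i a b, A i a b ≠ 0 := by
    by_contra! h
    apply hA.ne_zero ⟨0, hp⟩
    ext a b
    simp [toComplexMat, h]
  have hM1 : 1 ≤ M := by
    refine le_trans ?_ (hM i a b)
    have h1 : 1 ≤ (A i a b).norm := by
      have h2 := GaussianInt.norm_nonneg (A i a b)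
      have h3 : (A i a b).norm ≠ 0 := fun h => hne (GaussianInt.norm_eq_zero.1 h)
      omega
    have h2 : ((A i a b).norm : ℝ) = ‖GaussianInt.toComplex (A i a b)‖ ^ 2 := by
      rw [GaussianInt.intCast_real_norm, Complex.normSq_eq_norm_sq]
    have h3 : (1 : ℝ) ≤ ((A i a b).norm : ℝ) := by exact_mod_cast h1
    rw [h2] at h3
    exact (one_le_sq_iff₀ (norm_nonneg _)).1 h3
  -- Were `ncrank` zero, an optimal `U` would be all of `ℂⁿ` with `𝒜(U) = 0`, against the nonzero
  -- entry found above.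
  have hk0 : 0 < k := by
    refine lt_of_lt_of_le (Nat.pos_of_ne_zero fun h0 => ?_) hk
    obtain ⟨U, hU⟩ := exists_ncrank_eq (matrixSpace (toComplexMat A))
    have hUn := finrank_le_card U
    rw [h0] at hU
    have hUtop : U = ⊤ := by
      apply Submodule.eq_top_of_finrank_eq
      rw [Module.finrank_fintype_fun_eq_card]
      omega
    have hbot : image (matrixSpace (toComplexMat A)) U = ⊥ :=
      Submodule.finrank_eq_zero.1 (by omega)
    have hmem : (toComplexMat A i).mulVec (Pi.single b 1) ∈
        image (matrixSpace (toComplexMat A)) U :=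
      mulVec_mem_image (Submodule.subset_span (Set.mem_range_self i)) (hUtop ▸ Submodule.mem_top)
    rw [hbot, Submodule.mem_bot, Matrix.mulVec_single_one] at hmem
    have := congrFun hmem a
    simp only [Matrix.col_apply, toComplexMat, Matrix.map_apply, Pi.zero_apply,
      GaussianInt.toComplex_eq_zero] at this
    exact hne this
  refine ⟨half_le_probability A hk0 hd hk, fun X => ?_⟩
  have hn1 : (1 : ℝ) ≤ n := by exact_mod_cast hn
  have hd1 : (1 : ℝ) ≤ d := by exact_mod_cast hd0
  have hk1 : (1 : ℝ) ≤ k := by exact_mod_cast hk0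
  have hT : 1 ≤ M * n * d * k := by
    refine one_le_mul_of_one_le_of_one_le (one_le_mul_of_one_le_of_one_le
      (one_le_mul_of_one_le_of_one_le hM1 hn1) hd1) hk1
  have hlogT := Real.log_nonneg hT
  have hlogM := Real.log_nonneg hM1
  have hndM : 0 ≤ (n : ℝ) * d * Real.log M := by positivity
  -- The entry bounds are of the form `T^{O(n²d)}`, which fits into the exponent `n²d² log T`.
  have hdd : (n : ℝ) * (n * d) ≤ n ^ 2 * d ^ 2 := by
    calc (n : ℝ) * (n * d) = n ^ 2 * d ^ 1 := by ring
      _ ≤ n ^ 2 * d ^ 2 := by (gcongr; simp)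
  have hdd' := mul_le_mul_of_nonneg_right hdd hlogT
  have hpos : 0 ≤ (n : ℝ) ^ 2 * d ^ 2 * Real.log (M * n * d * k) := by positivity
  obtain ⟨g1, g2⟩ := isGaussianLE_algorithm (A := toComplexMat A)
    (X := fun i => Matrix.of fun a b => ((X i a b : ℕ) : ℂ)) hM1 hn hd0 hk0 hpn
    (fun i s t => ⟨⟨A i s t, rfl⟩, hM i s t⟩) (fun i a b => ⟨(X i a b : ℕ), (X i a b).2, rfl⟩)
  refine ⟨?_, fun z hz => (g1 z hz).isGaussianIntLE (by linarith) ?_,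
    fun z hz => (g2 z hz).isGaussianIntLE (by linarith) ?_⟩
  · exact_mod_cast algorithm_ops_le hp hn hd0 (toComplexMat A)
      (fun i => Matrix.of fun a b => ((X i a b : ℕ) : ℂ))
  · push_cast
    linarith
  · push_cast
    have h := mul_le_mul_of_nonneg_left hdd' (by positivity : (0 : ℝ) ≤ n)
    have h1 : 0 ≤ (n : ℝ) * (n ^ 2 * d ^ 2 * Real.log (M * n * d * k)) := by positivity
    have h2 : 0 ≤ (n : ℝ) * (n * d * Real.log M) := by positivity
    linarith
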